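/- Let $n\ge 3$ be odd and let $M\subset\mathbb R^n$ be a connected embedded real analytic hypersurface with convex hull $\widehat M$. Assume that $M$ is strictly convex: every $a\in M$ has a unit normal vector $\nu_a$, directed towards $\widehat M$, with $\langle x-a,\nu_a\rangle>0$ for all $x\in M\setminus\{a\}$. Assume also that the Gauss map $\gamma:a\mapsto\nu_a$ is a real analytic diffeomorphism of $M$ onto an open subset $\gamma(M)$ of the unit sphere $S^{n-1}$. Suppose that $M$ is polynomially integrable: for every $a\in M$ there is $\varepsilon_a>0$ such that $$A_M^a(t)=\mathrm{vol}_{n-1}\{x\in\widehat M:\langle x-a,\nu_a\rangle=t\}$$ is a polynomial in $t$ on $[0,\varepsilon_a)$. For $\xi\in\gamma(M)$ put $h_M(\xi)=\langle\gamma^{-1}(\xi),\xi\rangle$, and for $c>0$ put $M_{\xi,c}=\{x\in M:\langle x,\xi\rangle-h_M(\xi)\le c\}$. Fix $c>0$ and a function $\rho_c\in C^\infty(\mathbb R)$ that equals $1$ in a neighbourhood of $0$ and has support in $(-c,c)$, and put $\rho_{\xi,c}(x)=\rho_c(\langle x,\xi\rangle-h_M(\xi))$. Let $U\subset\gamma(M)$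 be an open subset of $S^{n-1}$ such that, for every $\xi\in U$, the cap $M_{\xi,c}$ is compact and different from $M$. For $\xi\in U$ and $\lambda>0$ consider $$I_{\xi,c}(\lambda)=\int_M\frac{\partial}{\partial\nu_x}\big(e^{i\lambda\langle\xi,x\rangle}\big)\,\rho_{\xi,c}(x)\,dS(x).$$ Then for each $\xi\in U$ there is exactly one sequence $(b_j(\xi))_{j\ge0}$ of complex numbers such that, for every $N$, $$I_{\xi,c}(\lambda)=e^{i\lambda h_M(\xi)}\lambda^{-\frac{n-3}{2}}\Big(\sum_{j=0}^{N}\frac{b_j(\xi)}{\lambda^j}+o(\lambda^{-N})\Big),\qquad\lambda\to+\infty,$$ and this expansion has only finitely many nonzero terms: there is $\overline N$, independent of $\xi\in U$, such that $b_j(\xi)=0$ for all $j>\overline N$ and all $\xi\in U$. Moreover there are polynomials $Q_\xi$ ($\xi\in U$) with complex coefficients and $\deg Q_\xi\le\overline N+\frac{n-3}{2}$ such that $$I_{\xi,c}(\lambda)=e^{i\lambda h_M(\xi)}\,Q_\xi\Big(\frac1\lambda\Big)+R_\xi(\lambda)\qquad(\xi\in U,\ \lambda>0),$$ where $R_\xi(\lambda)$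 is $C^\infty$ in $\xi\in U$ for every $\lambda>0$ and $R_\xi(\lambda)=O(\lambda^{-\infty})$ uniformly on compact subsets of $U$ together with all $\xi$-derivatives. That is, with $\widetilde R(\omega,\lambda)=R_{\omega/|\omega|}(\lambda)$, for every compact $K\subset U$, every $N\ge0$ and every multi-index $\alpha$, $$\lambda^N\sup_{\omega\in K}\big|D_\omega^\alpha\widetilde R(\omega,\lambda)\big|\to0\qquad(\lambda\to+\infty).$$ -/

import Mathlib

open Set Filter Topology MeasureTheory
open scoped ContDiff RealInnerProductSpace

noncomputable section

namespace PolyIntegrable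

/-- The space `ℝⁿ` with its Euclidean norm. -/
abbrev Space (n : ℕ) : Type := EuclideanSpace ℝ (Fin n)

/-- `M` is an (embedded) real analytic hypersurface: near each of its points it is the zero set
of a real analytic function with non-vanishing differential. -/
def IsAnalyticHypersurface {n : ℕ} (M : Set (Space n)) : Prop :=
  ∀ a ∈ M, ∃ (V : Set (Space n)) (F : Space n → ℝ), IsOpen V ∧ a ∈ V ∧
    AnalyticOnNhd ℝ F V ∧ (∀ x ∈ V, fderiv ℝ F x ≠ 0) ∧ M ∩ V = {x ∈ V | F x = 0}

/-- `ν` is the unit normal vector of `M` at `a` directed towards the convex hull of `M`. -/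
def IsInwardNormal {n : ℕ} (M : Set (Space n)) (a ν : Space n) : Prop :=
  ‖ν‖ = 1 ∧ (∀ v ∈ tangentConeAt ℝ M a, ⟪v, ν⟫ = 0) ∧ ∀ x ∈ M, 0 ≤ ⟪x - a, ν⟫

/-- Strict convexity: apart from the point of tangency, `M` lies strictly on one side of each of
its tangent hyperplanes. -/
def IsStrictlyConvex {n : ℕ} (M : Set (Space n)) : Prop :=
  ∀ a ∈ M, ∃ ν, IsInwardNormal M a ν ∧ ∀ x ∈ M, x ≠ a → 0 < ⟪x - a, ν⟫

open Classical in
/-- The Gauss map `γ`, sending `a ∈ M` to the inward unit normal vector `ν_a`. -/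
def gaussMap {n : ℕ} (M : Set (Space n)) (a : Space n) : Space n :=
  if h : ∃ ν, IsInwardNormal M a ν then h.choose else 0

/-- The set `γ(M)` of the inward unit normals of `M`. -/
def normals {n : ℕ} (M : Set (Space n)) : Set (Space n) := gaussMap M '' M

/-- The inverse `γ⁻¹ : γ(M) → M` of the Gauss map. -/
def gaussInv {n : ℕ} (M : Set (Space n)) : Space n → Space n :=
  Function.invFunOn (gaussMap M) M

/-- `U` is an open subset of the unit sphere. -/
def IsOpenInSphere {n : ℕ} (U : Set (Space n)) : Prop :=
  ∃ W : Set (Space n), IsOpen W ∧ U = W ∩ Metric.sphere 0 1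

/-- The Gauss map is a real analytic diffeomorphism of `M` onto an open subset of the unit
sphere. -/
def IsGaussDiffeo {n : ℕ} (M : Set (Space n)) : Prop :=
  InjOn (gaussMap M) M ∧ IsOpenInSphere (normals M) ∧
    AnalyticOn ℝ (gaussMap M) M ∧ AnalyticOn ℝ (gaussInv M) (normals M)

/-- The section volume `A_M^a(t)`: the `(n-1)`-dimensional volume of the section of the convex
hull of `M` by the tangent hyperplane at `a` translated by `t ν_a`. -/
def sectionVolume {n : ℕ} (M : Set (Space n)) (a : Space n) (t : ℝ) : ℝ :=
  (μHE[n - 1] : Measure (Space n)).real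
    {x | x ∈ convexHull ℝ M ∧ ⟪x - a, gaussMap M a⟫ = t}

/-- (Local) polynomial integrability. -/
def IsPolynomiallyIntegrable {n : ℕ} (M : Set (Space n)) : Prop :=
  ∀ a ∈ M, ∃ ε : ℝ, 0 < ε ∧ ∃ p : Polynomial ℝ,
    ∀ t ∈ Ico (0 : ℝ) ε, sectionVolume M a t = p.eval t

/-- The function `h_M(ξ) = ⟨γ⁻¹(ξ), ξ⟩`. -/
def supp {n : ℕ} (M : Set (Space n)) (ξ : Space n) : ℝ := ⟪gaussInv M ξ, ξ⟫

/-- The cap `M_{ξ,c} = {x ∈ M : ⟨x, ξ⟩ - h_M(ξ) ≤ c}`. -/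
def cap {n : ℕ} (M : Set (Space n)) (ξ : Space n) (c : ℝ) : Set (Space n) :=
  {x ∈ M | ⟪x, ξ⟫ - supp M ξ ≤ c}

/-- `ρ` is a cut-off function `ρ_c`: smooth on the line, equal to one near zero, and supported
in `(-c, c)`. -/
def IsCutoff (ρ : ℝ → ℝ) (c : ℝ) : Prop :=
  ContDiff ℝ ∞ ρ ∧ (∀ᶠ t in 𝓝 (0 : ℝ), ρ t = 1) ∧ tsupport ρ ⊆ Ioo (-c) c

/-- The plane wave `x ↦ exp(i l ⟨ξ, x⟩)`. -/
def planeWave {n : ℕ} (ξ : Space n) (l : ℝ) (x : Space n) : ℂ :=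
  Complex.exp (Complex.I * (l : ℂ) * ((⟪ξ, x⟫ : ℝ) : ℂ))

/-- The oscillating integral `I_{ξ,c}(l)`: the integral over `M`, with respect to surface
measure, of the derivative of the plane wave along the inward unit normal times the cut-off
`ρ(⟨x, ξ⟩ - h_M(ξ))`. -/
def oscIntegral {n : ℕ} (M : Set (Space n)) (ρ : ℝ → ℝ) (ξ : Space n) (l : ℝ) : ℂ :=
  ∫ x in M, fderiv ℝ (planeWave ξ l) x (gaussMap M x) * ((ρ (⟪x, ξ⟫ - supp M ξ) : ℝ) : ℂ)
    ∂(μHE[n - 1] : Measure (Space n))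

/-- The factor `exp(i l h_M(ξ))`. -/
def phase {n : ℕ} (M : Set (Space n)) (ξ : Space n) (l : ℝ) : ℂ :=
  Complex.exp (Complex.I * (l : ℂ) * ((supp M ξ : ℝ) : ℂ))

/-- The formal series `exp(i l h_M(ξ)) l^{-m} ∑_j β_j l^{-j}` is an asymptotic expansion of
`f(l)` as `l → +∞`. -/
def IsAsymptoticExpansion {n : ℕ} (M : Set (Space n)) (ξ : Space n) (f : ℝ → ℂ) (m : ℕ)
    (β : ℕ → ℂ) : Prop :=
  ∀ N : ℕ,
    (fun l : ℝ => f l - phase M ξ l *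
        ((1 / (l : ℂ)) ^ m * ∑ j ∈ Finset.range (N + 1), β j * (1 / (l : ℂ)) ^ j))
      =o[atTop] fun l : ℝ => (1 / l) ^ (m + N)

/-- The extension of a function on (a subset of the) unit sphere by homogeneity of degree zero,
`w ↦ g(w / |w|)`. -/
def homExt {n : ℕ} (g : Space n → ℂ) (w : Space n) : ℂ := g (‖w‖⁻¹ • w)

/-- The open cone spanned by a subset of the unit sphere. -/
def coneOver {n : ℕ} (U : Set (Space n)) : Set (Space n) :=
  {w | w ≠ 0 ∧ ‖w‖⁻¹ • w ∈ U}

/-- The family `R_ξ(l)`, `ξ ∈ U`, is `o(l^{-N})` as `l → +∞` for every `N`, uniformly on compact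
subsets of `U`, together with all its `ξ`-derivatives, which are taken on the extension of `R`
by homogeneity of degree zero. -/
def IsRapidlyDecaying {n : ℕ} (U : Set (Space n)) (R : Space n → ℝ → ℂ) : Prop :=
  (∀ l : ℝ, 0 < l → ContDiffOn ℝ ∞ (homExt fun ξ => R ξ l) (coneOver U)) ∧
  ∀ K : Set (Space n), IsCompact K → K ⊆ U → ∀ k N : ℕ,
    TendstoUniformlyOn
      (fun (l : ℝ) (ξ : Space n) =>
        l ^ N * ‖iteratedFDeriv ℝ k (homExt fun ξ' => R ξ' l) ξ‖)
      (fun _ => 0) atTop K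

end PolyIntegrable

end

/-! The integrand of `oscIntegral` is `iλ⟨ν_x, ξ⟩ e^{iλ⟨ξ,x⟩}` times a cut-off, so the integral is
the flux of a field parallel to `ξ` whose size depends only on the height `t = ⟨x,ξ⟩ - h_M(ξ)`. The
divergence theorem below height `c` reduces it to `-e^{iλh} iλ ∫₀ᶜ A(t) (e^{iλt}ρ(t))' dt`, with `A`
the section volume (`IsAdmissible.oscIntegral_eq`). The flux identity behind this compares the
shadows, on the tangent hyperplane, of the lower and upper sheets of `M` (`volume_sheet_eq`). `M`
need not be closed; compactness and properness of the cap force the boundary of the closed hull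
below height `c` to lie in `M` (`mem_of_mem_frontier`).

If `A` equals a polynomial `P_ξ` on `(0, c)` with `P_ξ(0) = 0`, integration by parts leaves the
moments `∫₀ᶜ t^k ρ(t) e^{iλt} dt`, weighted by the coefficients of `P_ξ'`. As `ρ` is one near `0`
and vanishes near `c`, such a moment is the single boundary term `k!(i/λ)^{k+1}` plus an error
`O(λ^{-∞})` independent of `ξ` (`IsCutoff.exists_norm_momentError_le`). Hence the main part is a
polynomial in `1/λ`, and the remainder is a finite sum of `e^{iλh(ξ)}`, smooth coefficients and
rapidly decaying factors; each `ξ`-derivative costs at most one power of `λ`.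

It remains to see that the polynomial valid near `t = 0` is valid up to `c`, that its degree is
bounded uniformly in `ξ`, that its coefficients are smooth in `ξ`, and that the low ones vanish. The
first three rest on joint real analyticity of the section volume in direction and height
(`analyticAt_sectionVolume`), proved in polar coordinates about an interior point of the section,
the radial function coming from the implicit function theorem. The identity theorem extends the
polynomial in `t`; Baire's theorem bounds the degree on an open set of directions, and interpolation
with the identity theorem spreads the bound over the connected set of normals
(`exists_natDegree_le`). Finally sections at height `t` have diameter `O(√t)`, so `A(t) =
O(t^{(n-1)/2})`, an integer power for odd `n`. -/

namespace PolyIntegrable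

/-! ### Supporting half-spaces and the interior of the convex hull -/

/-- The standing assumptions on the hypersurface. -/
structure IsAdmissible {n : ℕ} (M : Set (Space n)) : Prop where
  three_le : 3 ≤ n
  analytic : IsAnalyticHypersurface M
  connected : IsConnected M
  convex : IsStrictlyConvex M
  gauss : IsGaussDiffeo M

variable {n : ℕ} {M : Set (Space n)}

/-- A vector supporting the zero set of `F` at `x` is a multiple of the gradient of `F`. -/
lemma exists_eq_smul_fderiv_of_support {x w : Space n} (hx : x ∈ M) {V : Set (Space n)}
    {F : Space n → ℝ} (hV : IsOpen V) (hxV : x ∈ V) (hF : AnalyticOnNhd ℝ F V)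
    (hF' : ∀ x ∈ V, fderiv ℝ F x ≠ 0) (hMV : M ∩ V = {x ∈ V | F x = 0})
    (hw : ∀ m ∈ M, 0 ≤ ⟪m - x, w⟫) :
    ∃ κ : ℝ, ∀ v, ⟪v, w⟫ = κ * fderiv ℝ F x v := by
  have hFx : F x = 0 := by
    have : x ∈ M ∩ V := ⟨hx, hxV⟩
    rw [hMV] at this
    exact this.2
  -- The linear functional is minimal at `x` on the zero set of `F`, so Lagrange multipliers apply;
  -- the multiplier of the functional is nonzero because the gradient of `F` is.
  have hmin : IsLocalExtrOn (innerSL ℝ w) {y | F y = F x} x := by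
    left
    filter_upwards [inter_mem_nhdsWithin _ (hV.mem_nhds hxV)] with y hy
    have hyM : y ∈ M ∩ V := by
      rw [hMV]
      exact ⟨hy.2, hy.1.trans hFx⟩
    have := hw y hyM.1
    rw [inner_sub_left] at this
    simp only [innerSL_apply_apply]
    rw [real_inner_comm x w, real_inner_comm y w]
    linarith
  obtain ⟨a, b, hab, h⟩ := hmin.exists_multipliers_of_hasStrictFDerivAt_1d
    (hF x hxV).hasStrictFDerivAt (innerSL ℝ w).hasStrictFDerivAt
  have hb : b ≠ 0 := by
    rintro rfl
    have ha : a ≠ 0 := by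
      rintro rfl
      exact hab rfl
    apply hF' x hxV
    simpa [ha] using h
  refine ⟨-(a / b), fun v => ?_⟩
  have := DFunLike.congr_fun h v
  simp only [add_apply, smul_apply, smul_eq_mul,
    innerSL_apply_apply, zero_apply] at this
  rw [real_inner_comm w v]
  field_simp
  linarith

namespace IsAdmissible

variable (hA : IsAdmissible M)
include hA

/-- If `M` were a single point, every vector would support it and so be a multiple of one gradient,
which is impossible in dimension at least two. -/
lemma exists_ne {x : Space n} (hx : x ∈ M) : ∃ m ∈ M, m ≠ x := by
  by_contra! h
  obtain ⟨V, F, hV, hxV, hF, hF', hMV⟩ := hA.analytic x hx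
  have key : ∀ w : Space n, ∃ κ : ℝ, ∀ v, ⟪v, w⟫ = κ * fderiv ℝ F x v := fun w =>
    exists_eq_smul_fderiv_of_support hx hV hxV hF hF' hMV fun m hm => by simp [h m hm]
  have h1 := hA.three_le
  let e : Fin n → Space n := fun i => EuclideanSpace.single i 1
  obtain ⟨κ₀, h₀⟩ := key (e ⟨0, by omega⟩)
  obtain ⟨κ₁, h₁⟩ := key (e ⟨1, by omega⟩)
  have a := h₀ (e ⟨0, by omega⟩)
  have b := h₀ (e ⟨1, by omega⟩)
  have c := h₁ (e ⟨1, by omega⟩)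
  have d := h₁ (e ⟨0, by omega⟩)
  simp only [e, EuclideanSpace.inner_single_left, PiLp.single_apply] at a b c d
  norm_num at a b c d
  rcases b with b | b
  · rw [b] at a
    norm_num at a
  · rw [b] at c
    norm_num at c

/-- The chosen normal is the strictly supporting one. -/
lemma gaussMap_spec {x : Space n} (hx : x ∈ M) :
    ‖gaussMap M x‖ = 1 ∧ ∀ m ∈ M, m ≠ x → 0 < ⟪m - x, gaussMap M x⟫ := by
  obtain ⟨ν₀, hν₀, hs⟩ := hA.convex x hx
  have hex : ∃ ν, IsInwardNormal M x ν := ⟨ν₀, hν₀⟩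
  have hg : gaussMap M x = hex.choose := by
    unfold gaussMap
    rw [dif_pos hex]
  have hν : IsInwardNormal M x (gaussMap M x) := hg ▸ hex.choose_spec
  set ν := gaussMap M x
  obtain ⟨V, F, hV, hxV, hF, hF', hMV⟩ := hA.analytic x hx
  obtain ⟨κ, hκ⟩ := exists_eq_smul_fderiv_of_support hx hV hxV hF hF' hMV hν.2.2
  obtain ⟨κ₀, hκ₀⟩ := exists_eq_smul_fderiv_of_support hx hV hxV hF hF' hMV hν₀.2.2
  have hκ₀0 : κ₀ ≠ 0 := by
    rintro rfl
    have := hκ₀ ν₀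
    rw [real_inner_self_eq_norm_sq, hν₀.1] at this
    norm_num at this
  refine ⟨hν.1, fun m hm hne => ?_⟩
  -- `gaussMap` picks some inward normal, perhaps not the strict one `ν₀`. Both are multiples of the
  -- gradient, hence of each other, and a negative factor is excluded by their signs at `m`.
  have h1 : ∀ v, ⟪v, ν⟫ = κ / κ₀ * ⟪v, ν₀⟫ := fun v => by
    rw [hκ, hκ₀]
    field_simp
  have hc : κ / κ₀ ≠ 0 := by
    intro h0
    have := h1 ν
    rw [real_inner_self_eq_norm_sq, hν.1, h0] at this
    norm_num at this
  have h2 := h1 (m - x)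
  have h3 := hν.2.2 m hm
  have h4 := hs m hm hne
  rcases lt_or_gt_of_ne hc with hc | hc
  · nlinarith
  · rw [h2]
    positivity

lemma norm_gaussMap {x : Space n} (hx : x ∈ M) : ‖gaussMap M x‖ = 1 := (hA.gaussMap_spec hx).1

lemma inner_pos {x m : Space n} (hx : x ∈ M) (hm : m ∈ M) (h : m ≠ x) :
    0 < ⟪m - x, gaussMap M x⟫ := (hA.gaussMap_spec hx).2 m hm h

lemma inner_nonneg {x m : Space n} (hx : x ∈ M) (hm : m ∈ M) :
    0 ≤ ⟪m - x, gaussMap M x⟫ := by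
  by_cases h : m = x
  · simp [h]
  · exact (hA.inner_pos hx hm h).le

/-- The nonzero factor turns transversality to `M` into a statement about the inner product with the
normal. -/
lemma exists_fderiv_eq {x : Space n} (hx : x ∈ M) {V : Set (Space n)}
    {F : Space n → ℝ} (hV : IsOpen V) (hxV : x ∈ V) (hF : AnalyticOnNhd ℝ F V)
    (hF' : ∀ x ∈ V, fderiv ℝ F x ≠ 0) (hMV : M ∩ V = {x ∈ V | F x = 0}) :
    ∃ κ : ℝ, κ ≠ 0 ∧ ∀ v, fderiv ℝ F x v = κ * ⟪v, gaussMap M x⟫ := by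
  obtain ⟨κ, hκ⟩ := exists_eq_smul_fderiv_of_support hx hV hxV hF hF' hMV
    fun m hm => hA.inner_nonneg hx hm
  have h0 : κ ≠ 0 := by
    rintro rfl
    have := hκ (gaussMap M x)
    rw [real_inner_self_eq_norm_sq, hA.norm_gaussMap hx] at this
    norm_num at this
  refine ⟨κ⁻¹, inv_ne_zero h0, fun v => ?_⟩
  rw [hκ]
  field_simp

/-- The supporting half-space of `M` at each of its points is unique. -/
lemma eq_smul_of_support {x w : Space n} (hx : x ∈ M) (hw : ∀ m ∈ M, 0 ≤ ⟪m - x, w⟫) :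
    ∃ κ : ℝ, 0 ≤ κ ∧ w = κ • gaussMap M x := by
  obtain ⟨V, F, hV, hxV, hF, hF', hMV⟩ := hA.analytic x hx
  obtain ⟨κ, hκ⟩ := exists_eq_smul_fderiv_of_support hx hV hxV hF hF' hMV hw
  obtain ⟨κ', -, hκ'⟩ := hA.exists_fderiv_eq hx hV hxV hF hF' hMV
  have h1 : w = (κ * κ') • gaussMap M x := ext_inner_left ℝ fun v => by
    rw [hκ, hκ', inner_smul_right]
    ring
  refine ⟨κ * κ', ?_, h1⟩
  obtain ⟨m, hm, hne⟩ := hA.exists_ne hx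
  have h2 := hw m hm
  rw [h1, inner_smul_right] at h2
  exact nonneg_of_mul_nonneg_left h2 (hA.inner_pos hx hm hne)

/-- Every point of the convex hull other than `x` lies strictly inside the tangent half-space
at `x`. -/
lemma inner_pos_of_mem_convexHull {x y : Space n} (hx : x ∈ M) (hy : y ∈ convexHull ℝ M)
    (h : y ≠ x) : 0 < ⟪y - x, gaussMap M x⟫ := by
  -- Adding a single boundary point to an open half-space keeps it convex, and the result contains
  -- `M`.
  have hconv : Convex ℝ ({x} ∪ {y | 0 < ⟪y - x, gaussMap M x⟫}) := by
    intro u hu v hv a b ha hb hab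
    have e : a • u + b • v - x = a • (u - x) + b • (v - x) := by
      have : x = (a + b) • x := by rw [hab, one_smul]
      nth_rw 1 [this]
      module
    have hnn : ∀ u ∈ ({x} ∪ {y | 0 < ⟪y - x, gaussMap M x⟫} : Set (Space n)),
        0 ≤ ⟪u - x, gaussMap M x⟫ := by
      rintro u (rfl | hu)
      · simp
      · exact le_of_lt hu
    rcases ha.eq_or_lt with rfl | ha
    · have : b = 1 := by linarith
      simpa [this] using hv
    rcases hb.eq_or_lt with rfl | hb
    · have : a = 1 := by linarith
      simpa [this] using hu
    rcases hu with hu | hu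
    · rcases hv with hv | hv
      · left
        rw [mem_singleton_iff] at hu hv ⊢
        rw [hu, hv, ← add_smul, hab, one_smul]
      · right
        simp only [mem_ofPred_eq] at hv ⊢
        rw [mem_singleton_iff.1 hu] at e ⊢
        rw [e, inner_add_left, inner_smul_left, inner_smul_left]
        simp only [sub_self, inner_zero_left, mul_zero, zero_add, conj_trivial]
        positivity
    · right
      have := hnn v hv
      simp only [mem_ofPred_eq] at hu ⊢
      rw [e, inner_add_left, inner_smul_left, inner_smul_left]
      simp only [conj_trivial]
      positivity
  have := convexHull_min (s := M) (fun m hm => by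
    by_cases hmx : m = x
    · exact Or.inl hmx
    · exact Or.inr (hA.inner_pos hx hm hmx)) hconv hy
  exact this.resolve_left h

lemma inner_nonneg_of_mem_closure {x y : Space n} (hx : x ∈ M)
    (hy : y ∈ closure (convexHull ℝ M)) : 0 ≤ ⟪y - x, gaussMap M x⟫ := by
  have hcl : IsClosed {y : Space n | 0 ≤ ⟪y - x, gaussMap M x⟫} :=
    isClosed_le continuous_const (by fun_prop)
  refine closure_minimal (fun z hz => ?_) hcl hy
  by_cases h : z = x
  · simp [h]
  · exact (hA.inner_pos_of_mem_convexHull hx hz h).le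

/-- A vector orthogonal to a proper affine span would support `M` with equality everywhere, against
strict convexity. -/
lemma interior_nonempty : (interior (convexHull ℝ M)).Nonempty := by
  rw [interior_convexHull_nonempty_iff_affineSpan_eq_top]
  obtain ⟨x, hx⟩ := hA.connected.nonempty
  by_contra hne
  have hdir : (affineSpan ℝ M).direction ≠ ⊤ := fun h => hne
    ((AffineSubspace.direction_eq_top_iff_of_nonempty
      ⟨x, subset_affineSpan ℝ M hx⟩).1 h)
  have : ((affineSpan ℝ M).direction)ᗮ ≠ ⊥ := by
    rwa [Ne, Submodule.orthogonal_eq_bot_iff]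
  obtain ⟨w, hw, hw0⟩ := Submodule.exists_mem_ne_zero_of_ne_bot this
  have hz : ∀ m ∈ M, ⟪m - x, w⟫ = 0 := fun m hm =>
    hw _ (AffineSubspace.vsub_mem_direction (subset_affineSpan ℝ M hm)
      (subset_affineSpan ℝ M hx))
  obtain ⟨κ, -, h1⟩ := hA.eq_smul_of_support hx fun m hm => (hz m hm).ge
  obtain ⟨m, hm, hmx⟩ := hA.exists_ne hx
  have := hz m hm
  rw [h1, inner_smul_right] at this
  rcases mul_eq_zero.1 this with h | h
  · exact hw0 (by rw [h1, h, zero_smul])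
  · exact (hA.inner_pos hx hm hmx).ne' h

lemma interior_closure_eq :
    interior (closure (convexHull ℝ M)) = interior (convexHull ℝ M) :=
  (convex_convexHull ℝ M).interior_closure_eq_interior_of_nonempty_interior hA.interior_nonempty

/-- A direction pointing strictly into the tangent half-space points into the interior. -/
lemma exists_add_smul_mem_interior {x v : Space n} (hx : x ∈ M)
    (hv : 0 < ⟪v, gaussMap M x⟫) :
    ∃ δ : ℝ, 0 < δ ∧ ∀ u ∈ Ioc 0 δ, x + u • v ∈ interior (convexHull ℝ M) := by
  set K := convexHull ℝ M
  have hxK : x ∈ K := subset_convexHull ℝ M hx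
  by_cases h : ∃ δ : ℝ, 0 < δ ∧ x + δ • v ∈ interior K
  · obtain ⟨δ, hδ, h⟩ := h
    refine ⟨δ, hδ, fun u hu => ?_⟩
    have := (convex_convexHull ℝ M).add_smul_mem_interior hxK
      (y := δ • v) h (t := u / δ) ⟨div_pos hu.1 hδ, (div_le_one hδ).2 hu.2⟩
    rwa [smul_smul, div_mul_cancel₀ _ hδ.ne'] at this
  exfalso
  push Not at h
  have hc : Convex ℝ ((fun u : ℝ => x + u • v) '' Ioi 0) := by
    rintro _ ⟨u, hu, rfl⟩ _ ⟨u', hu', rfl⟩ a b ha hb hab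
    refine ⟨a * u + b * u', ?_, ?_⟩
    · exact (convex_Ioi (0 : ℝ)) hu hu' ha hb hab
    · simp only
      have : x = (a + b) • x := by rw [hab, one_smul]
      nth_rw 1 [this]
      module
  -- A ray missing the interior can be separated from it. The separating functional supports the
  -- hull at `x`, hence is `-κ⟪·, ν⟫` with `κ ≥ 0`; its lower bound along the ray forces `κ = 0`,
  -- and the zero functional separates nothing strictly.
  obtain ⟨f, s, hf1, hf2⟩ := geometric_hahn_banach_open (convex_convexHull ℝ M).interior
    isOpen_interior hc (by
      rw [Set.disjoint_left]
      rintro _ h1 ⟨u, hu, rfl⟩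
      exact h u hu h1)
  have hfx : s ≤ f x := by
    have : Tendsto (fun u : ℝ => f (x + u • v)) (𝓝[>] 0) (𝓝 (f (x + (0 : ℝ) • v))) := by
      apply Continuous.continuousWithinAt
      fun_prop
    rw [zero_smul, add_zero] at this
    exact ge_of_tendsto this (by
      filter_upwards [self_mem_nhdsWithin] with u hu using hf2 _ ⟨u, hu, rfl⟩)
  have hfK : ∀ k ∈ K, f k ≤ s := by
    intro k hk
    have h1 : k ∈ closure (interior K) := by
      rw [(convex_convexHull ℝ M).closure_interior_eq_closure_of_nonempty_interior
        hA.interior_nonempty]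
      exact subset_closure hk
    exact closure_minimal (fun y hy => (hf1 y hy).le)
      (isClosed_le f.continuous continuous_const) h1
  obtain ⟨w, hw⟩ := (InnerProductSpace.toDual ℝ (Space n)).surjective f
  have hfw : ∀ y, f y = ⟪y, w⟫ := fun y => by
    rw [← hw, InnerProductSpace.toDual_apply_apply, real_inner_comm]
  obtain ⟨κ, hκ, h1⟩ := hA.eq_smul_of_support (w := -w) hx fun m hm => by
    have := hfK m (subset_convexHull ℝ M hm)
    rw [inner_neg_right, inner_sub_left, ← hfw, ← hfw]
    linarith
  have hsx : f x = s := le_antisymm (hfK x hxK) hfx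
  have h2 := hf2 _ ⟨1, mem_Ioi.2 one_pos, rfl⟩
  simp only [one_smul, map_add] at h2
  have h3 : f v = - (κ * ⟪v, gaussMap M x⟫) := by
    rw [hfw, ← inner_smul_right, ← h1, inner_neg_right, neg_neg]
  have h4 : κ = 0 := by nlinarith
  have hw0 : w = 0 := by rw [h4, zero_smul] at h1; exact neg_eq_zero.1 h1
  obtain ⟨p, hp⟩ := hA.interior_nonempty
  have := hf1 p hp
  rw [hfw, hw0, inner_zero_right] at this
  rw [hfw, hw0, inner_zero_right] at hsx
  linarith

end IsAdmissible

end PolyIntegrable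

/-! ### Good caps and the boundary of the closed convex hull -/

namespace PolyIntegrable

variable {n : ℕ} {M : Set (Space n)}

/-- The height of a point above the tangent hyperplane of `M` with normal `ξ`. -/
noncomputable def height (M : Set (Space n)) (ξ x : Space n) : ℝ := ⟪x, ξ⟫ - supp M ξ

lemma continuous_height (M : Set (Space n)) (ξ : Space n) : Continuous (height M ξ) := by
  unfold height
  fun_prop

lemma height_add (ξ x v : Space n) : height M ξ (x + v) = height M ξ x + ⟪v, ξ⟫ := by
  simp only [height, inner_add_left]
  ring

lemma gaussInv_mem {ξ : Space n} (hξ : ξ ∈ normals M) : gaussInv M ξ ∈ M :=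
  Function.invFunOn_mem hξ

lemma gaussMap_gaussInv {ξ : Space n} (hξ : ξ ∈ normals M) : gaussMap M (gaussInv M ξ) = ξ :=
  Function.invFunOn_eq hξ

lemma height_eq (ξ x : Space n) : height M ξ x = ⟪x - gaussInv M ξ, ξ⟫ := by
  simp [height, supp, inner_sub_left]

lemma height_gaussInv (ξ : Space n) : height M ξ (gaussInv M ξ) = 0 := by
  simp [height_eq]

/-- The cap of `M` at `ξ` of height `c` is compact and proper. -/
structure IsGoodCap (M : Set (Space n)) (ξ : Space n) (c : ℝ) : Prop where
  mem : ξ ∈ normals M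
  pos : 0 < c
  compact : IsCompact (cap M ξ c)
  ne : cap M ξ c ≠ M

/-- A segment from an interior point to a point of the closure is interior except perhaps at its
end, so a ray from an interior point meets the boundary at most once. -/
lemma _root_.Convex.eq_one_of_mem_frontier {E : Type*} [NormedAddCommGroup E] [NormedSpace ℝ E]
    {C : Set E} (hC : Convex ℝ C) {p v : E} {s : ℝ} (hs : 0 < s) (hp : p ∈ interior C)
    (h1 : p + v ∈ frontier C) (h2 : p + s • v ∈ frontier C) : s = 1 := by
  have key : ∀ (w : E) (u : ℝ), 0 < u → u < 1 → p + w ∈ frontier C → p + u • w ∉ frontier C := by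
    intro w u hu0 hu1 hw hu
    apply hu.2
    have := hC.combo_interior_closure_mem_interior hp (frontier_subset_closure hw)
      (a := 1 - u) (b := u) (by linarith) hu0.le (by ring)
    convert this using 1
    module
  rcases lt_trichotomy s 1 with h | h | h
  · exact absurd h2 (key v s hs h h1)
  · exact h
  · refine absurd ?_ (key (s • v) s⁻¹ (by positivity) (inv_lt_one_of_one_lt₀ h) h2)
    rwa [smul_smul, inv_mul_cancel₀ hs.ne', one_smul]

/-- A segment leaving a closed set meets its boundary. -/
lemma _root_.IsClosed.exists_mem_frontier_segment {E : Type*} [NormedAddCommGroup E]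
    [NormedSpace ℝ E] {C : Set E} (hC : IsClosed C) {q v : E} {T : ℝ}
    (hq : q ∈ C) (hT : 0 ≤ T) (hT' : q + T • v ∉ C) :
    ∃ u ∈ Icc 0 T, q + u • v ∈ frontier C := by
  have hpre : IsPreconnected ((fun u : ℝ => q + u • v) '' Icc 0 T) :=
    isPreconnected_Icc.image _ (by fun_prop)
  by_contra! h
  obtain ⟨z, -, hz1, hz2⟩ := hpre (interior C) Cᶜ isOpen_interior hC.isOpen_compl (by
      rintro _ ⟨u, hu, rfl⟩
      by_cases h1 : q + u • v ∈ C
      · left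
        by_contra h2
        exact h u hu ⟨subset_closure h1, h2⟩
      · exact Or.inr h1)
    ⟨q, ⟨0, ⟨le_rfl, hT⟩, by simp⟩, by
      by_contra h2
      exact h 0 ⟨le_rfl, hT⟩ (by simpa using ⟨subset_closure hq, h2⟩)⟩
    ⟨_, ⟨T, ⟨hT, le_rfl⟩, rfl⟩, hT'⟩
  exact hz2 (interior_subset hz1)

namespace IsAdmissible

variable (hA : IsAdmissible M)
include hA

lemma norm_normal {ξ : Space n} (hξ : ξ ∈ normals M) : ‖ξ‖ = 1 := by
  obtain ⟨x, hx, rfl⟩ := hξ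
  exact hA.norm_gaussMap hx

lemma gaussInv_gaussMap {x : Space n} (hx : x ∈ M) : gaussInv M (gaussMap M x) = x :=
  hA.gauss.1.leftInvOn_invFunOn hx

lemma height_nonneg {ξ x : Space n} (hξ : ξ ∈ normals M) (hx : x ∈ closure (convexHull ℝ M)) :
    0 ≤ height M ξ x := by
  have := hA.inner_nonneg_of_mem_closure (gaussInv_mem hξ) hx
  rwa [gaussMap_gaussInv hξ, ← height_eq] at this

/-- From an interior point one could move slightly along `-ν` and leave the tangent half-space. -/
lemma notMem_interior {x : Space n} (hx : x ∈ M) : x ∉ interior (convexHull ℝ M) := by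
  intro h
  have h1 : Tendsto (fun u : ℝ => x + u • (-gaussMap M x)) (𝓝[>] 0)
      (𝓝 (x + (0 : ℝ) • (-gaussMap M x))) := by
    apply Continuous.continuousWithinAt
    fun_prop
  rw [zero_smul, add_zero] at h1
  obtain ⟨u, hu, hu0⟩ := ((h1.eventually (isOpen_interior.mem_nhds h)).and
    self_mem_nhdsWithin).exists
  have := hA.inner_nonneg_of_mem_closure hx (subset_closure (interior_subset hu))
  rw [add_sub_cancel_left, inner_smul_left, inner_neg_left, real_inner_self_eq_norm_sq,
    hA.norm_gaussMap hx] at this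
  simp only [conj_trivial] at this
  have hu0 : 0 < u := hu0
  linarith

lemma subset_frontier : M ⊆ frontier (closure (convexHull ℝ M)) := fun x hx =>
  ⟨subset_closure (subset_closure (subset_convexHull ℝ M hx)), by
    rw [hA.interior_closure_eq]
    exact hA.notMem_interior hx⟩

/-- `M` is relatively open in the boundary of its convex hull. -/
lemma exists_isOpen_frontier_inter_subset {x : Space n} (hx : x ∈ M) :
    ∃ W, IsOpen W ∧ x ∈ W ∧ frontier (closure (convexHull ℝ M)) ∩ W ⊆ M := by
  obtain ⟨p, hp⟩ := hA.interior_nonempty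
  have hpx : p ≠ x := by
    rintro rfl
    exact hA.notMem_interior hx hp
  obtain ⟨V, F, hV, hxV, hF, hF', hMV⟩ := hA.analytic x hx
  obtain ⟨κ, hκ0, hκ⟩ := hA.exists_fderiv_eq hx hV hxV hF hF' hMV
  have hFx : F x = 0 := by
    have : x ∈ M ∩ V := ⟨hx, hxV⟩
    rw [hMV] at this
    exact this.2
  obtain ⟨r, hr, hrV⟩ := Metric.isOpen_iff.1 hV x hxV
  set d : ℝ := fderiv ℝ F x (x - p) with hd
  -- The ray from the interior point `p` crosses `M` transversally at `x`, so `F` changes sign along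
  -- it. The sign change persists on the ray through a nearby boundary point `y`, which therefore
  -- meets `M`; a ray has only one boundary point, so that point is `y`.
  have hd0 : d ≠ 0 := by
    rw [hd, hκ]
    have := hA.inner_pos_of_mem_convexHull hx (interior_subset hp) hpx
    rw [← neg_sub, inner_neg_left]
    exact mul_ne_zero hκ0 (by linarith)
  have hl : HasDerivAt (fun s : ℝ => p + s • (x - p)) (x - p) 1 := by
    simpa using ((hasDerivAt_id (1 : ℝ)).smul_const (x - p)).const_add p
  have h1 : p + (1 : ℝ) • (x - p) = x := by rw [one_smul]; abel
  have hder : HasDerivAt (fun s : ℝ => F (p + s • (x - p))) d 1 := by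
    have := (hF x hxV).differentiableAt.hasFDerivAt
    rw [← h1] at this
    have := this.comp_hasDerivAt (1 : ℝ) hl
    rwa [h1] at this
  have hsl := hasDerivAt_iff_tendsto_slope.1 hder
  have hev : ∀ᶠ s in 𝓝[≠] (1 : ℝ), 0 < d * slope (fun s : ℝ => F (p + s • (x - p))) 1 s := by
    have h2 := hsl.const_mul d
    exact h2.eventually (lt_mem_nhds (mul_self_pos.2 hd0))
  have hball : ∀ᶠ s in 𝓝 (1 : ℝ), p + s • (x - p) ∈ Metric.ball x r := by
    have := hl.continuousAt
    exact this.eventually (Metric.isOpen_ball.mem_nhds (by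
      simp only [h1]
      exact Metric.mem_ball_self hr))
  have hslope : ∀ s, slope (fun s : ℝ => F (p + s • (x - p))) 1 s
      = (s - 1)⁻¹ * F (p + s • (x - p)) := fun s => by
    rw [slope_def_field]
    simp only [h1, hFx, sub_zero]
    rw [div_eq_inv_mul]
  obtain ⟨s₁, ⟨⟨h₁, hb₁⟩, hs₁0⟩, hs₁⟩ : ∃ s, ((0 < d * slope (fun s : ℝ => F (p + s • (x - p))) 1 s ∧
      p + s • (x - p) ∈ Metric.ball x r) ∧ 0 < s) ∧ s ∈ Iio (1 : ℝ) :=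
    ((((hev.filter_mono (nhdsWithin_mono _ (show Iio (1 : ℝ) ⊆ {1}ᶜ from fun s hs => ne_of_lt hs))).and
      (hball.filter_mono nhdsWithin_le_nhds)).and
      (Filter.Eventually.filter_mono nhdsWithin_le_nhds (lt_mem_nhds one_pos))).and
      self_mem_nhdsWithin).exists
  obtain ⟨s₂, ⟨h₂, hb₂⟩, hs₂⟩ : ∃ s, (0 < d * slope (fun s : ℝ => F (p + s • (x - p))) 1 s ∧
      p + s • (x - p) ∈ Metric.ball x r) ∧ s ∈ Ioi (1 : ℝ) :=
    (((hev.filter_mono (nhdsWithin_mono _ (show Ioi (1 : ℝ) ⊆ {1}ᶜ from fun s hs => ne_of_gt hs))).and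
      (hball.filter_mono nhdsWithin_le_nhds)).and
      self_mem_nhdsWithin).exists
  rw [hslope] at h₁ h₂
  have hs₁ : s₁ < 1 := hs₁
  have hs₂ : 1 < s₂ := hs₂
  have hn₁ : d * F (p + s₁ • (x - p)) < 0 := by
    have h3 : (s₁ - 1)⁻¹ < 0 := inv_lt_zero.2 (by linarith)
    by_contra h
    push Not at h
    nlinarith
  have hn₂ : 0 < d * F (p + s₂ • (x - p)) := by
    have h3 : 0 < (s₂ - 1)⁻¹ := inv_pos.2 (by linarith)
    by_contra h
    push Not at h
    nlinarith
  have hcont : ∀ s : ℝ, ContinuousAt (fun y : Space n => p + s • (y - p)) x := fun s => by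
    fun_prop
  have hFc : ContinuousOn F (Metric.ball x r) := fun y hy =>
    (hF y (hrV hy)).continuousAt.continuousWithinAt
  have hFs : ∀ s : ℝ, p + s • (x - p) ∈ Metric.ball x r →
      ContinuousAt (fun y : Space n => d * F (p + s • (y - p))) x := fun s hs => by
    have : ContinuousAt (fun y : Space n => F (p + s • (y - p))) x :=
      ContinuousAt.comp (f := fun y : Space n => p + s • (y - p)) (g := F)
        (hF _ (hrV hs)).continuousAt (hcont s)
    exact this.const_mul d
  have hW : ∀ᶠ y in 𝓝 x, (d * F (p + s₁ • (y - p)) < 0 ∧ 0 < d * F (p + s₂ • (y - p))) ∧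
      (p + s₁ • (y - p) ∈ Metric.ball x r ∧ p + s₂ • (y - p) ∈ Metric.ball x r) :=
    (((hFs s₁ hb₁).eventually (gt_mem_nhds hn₁)).and
      ((hFs s₂ hb₂).eventually (lt_mem_nhds hn₂))).and
      (((hcont s₁).eventually (Metric.isOpen_ball.mem_nhds hb₁)).and
        ((hcont s₂).eventually (Metric.isOpen_ball.mem_nhds hb₂)))
  obtain ⟨W, hWs, hWo, hxW⟩ := eventually_nhds_iff.1 hW
  refine ⟨W, hWo, hxW, fun y hy => ?_⟩
  obtain ⟨⟨hy₁, hy₂⟩, hyb₁, hyb₂⟩ := hWs y hy.2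
  have hseg : ∀ s ∈ Icc s₁ s₂, p + s • (y - p) ∈ Metric.ball x r := by
    intro s hs
    have h12 : 0 < s₂ - s₁ := by linarith
    have := (convex_ball x r) hyb₁ hyb₂ (a := (s₂ - s) / (s₂ - s₁)) (b := (s - s₁) / (s₂ - s₁))
      (div_nonneg (by linarith [hs.2]) h12.le) (div_nonneg (by linarith [hs.1]) h12.le)
      (by field_simp; ring)
    convert this using 1
    have e : (s₂ - s) / (s₂ - s₁) * s₁ + (s - s₁) / (s₂ - s₁) * s₂ = s := by
      field_simp; ring
    have e' : (s₂ - s) / (s₂ - s₁) + (s - s₁) / (s₂ - s₁) = 1 := by field_simp; ring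
    calc p + s • (y - p) = ((s₂ - s) / (s₂ - s₁) + (s - s₁) / (s₂ - s₁)) • p +
          ((s₂ - s) / (s₂ - s₁) * s₁ + (s - s₁) / (s₂ - s₁) * s₂) • (y - p) := by
          rw [e, e', one_smul]
      _ = _ := by module
  obtain ⟨s, hs, hs0⟩ := intermediate_value_Icc (a := s₁) (b := s₂) (by linarith)
    (f := fun s => d * F (p + s • (y - p)))
    ((hFc.comp (by fun_prop) hseg).const_smul d) (show (0 : ℝ) ∈ _ from ⟨hy₁.le, hy₂.le⟩)
  have hz : p + s • (y - p) ∈ M := by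
    have : p + s • (y - p) ∈ M ∩ V := by
      rw [hMV]
      exact ⟨hrV (hseg s hs), (mul_eq_zero.1 hs0).resolve_left hd0⟩
    exact this.1
  have hs1 : s = 1 := (convex_convexHull ℝ M).closure.eq_one_of_mem_frontier
    (p := p) (v := y - p) (by linarith [hs.1])
    (by rwa [hA.interior_closure_eq]) (by simpa using hy.1) (hA.subset_frontier hz)
  rw [hs1, one_smul, add_sub_cancel] at hz
  exact hz

/-- Below the height of a good cap, the boundary of the closed convex hull is a connected set. -/
lemma isPreconnected_frontier_inter {ξ p : Space n} {c : ℝ} (hξ : ξ ∈ normals M)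
    (hp : p ∈ interior (convexHull ℝ M)) (hpc : c < height M ξ p) :
    IsPreconnected {x ∈ frontier (closure (convexHull ℝ M)) | height M ξ x < c} := by
  set C := closure (convexHull ℝ M) with hC
  have hCconv : Convex ℝ C := (convex_convexHull ℝ M).closure
  set C' : Set (Space n) := (fun v => p + v) ⁻¹' C with hC'
  have hC'conv : Convex ℝ C' := hCconv.translate_preimage_right p
  have hC'0 : C' ∈ 𝓝 0 := by
    apply (by fun_prop : Continuous fun v => p + v).continuousAt.preimage_mem_nhds
    simp only [add_zero]
    exact mem_interior_iff_mem_nhds.1 (by rwa [hC, hA.interior_closure_eq])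
  have hfr : ∀ v, gauge C' v = 1 ↔ p + v ∈ frontier C := fun v => by
    rw [gauge_eq_one_iff_mem_frontier hC'conv hC'0]
    exact (Set.ext_iff.1 ((Homeomorph.addLeft p).preimage_frontier C) v).symm
  -- A direction of zero gauge gives a ray inside the closed hull; here it would descend to negative
  -- height.
  have hpos : ∀ v, p + v ∈ C → height M ξ (p + v) < c → 0 < gauge C' v := by
    intro v hv hvc
    rcases (gauge_nonneg (s := C') v).eq_or_lt with h0 | h0
    swap
    · exact h0
    exfalso
    have hneg : ⟪v, ξ⟫ < 0 := by
      rw [height_add] at hvc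
      linarith
    obtain ⟨s, hs⟩ := exists_gt (height M ξ p / (-⟪v, ξ⟫))
    have hp0 : 0 ≤ height M ξ p := hA.height_nonneg hξ (subset_closure (interior_subset hp))
    have hs0 : 0 ≤ s := le_trans (div_nonneg hp0 (by linarith)) hs.le
    have hsC : s • v ∈ C' := by
      have : gauge C' (s • v) ≤ 1 := by
        rw [gauge_smul_of_nonneg hs0, ← h0]
        simp
      have := (gauge_le_one_iff_mem_closure hC'conv hC'0).1 this
      rwa [(isClosed_closure.preimage (by fun_prop : Continuous fun v => p + v)).closure_eq]
        at this
    have h2 := hA.height_nonneg hξ (x := p + s • v) hsC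
    rw [height_add, inner_smul_left] at h2
    simp only [conj_trivial] at h2
    rw [div_lt_iff₀ (by linarith)] at hs
    linarith
  -- Radial projection from `p` onto the boundary. As `p` lies above height `c`, pushing a lower
  -- point away from `p` lowers it further, so the low boundary is the continuous image of a convex
  -- set.
  have himg : {x ∈ frontier C | height M ξ x < c} =
      (fun q => p + (gauge C' (q - p))⁻¹ • (q - p)) '' {q ∈ C | height M ξ q < c} := by
    ext x
    constructor
    · rintro ⟨hx, hxc⟩
      refine ⟨x, ⟨isClosed_closure.frontier_subset hx, hxc⟩, ?_⟩
      have : gauge C' (x - p) = 1 := by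
        rw [hfr]
        simpa using hx
      simp [this]
    · rintro ⟨q, ⟨hq, hqc⟩, rfl⟩
      have hg := hpos (q - p) (by simpa using hq) (by simpa using hqc)
      have hg1 : gauge C' (q - p) ≤ 1 := gauge_le_one_of_mem (by
        simpa [hC'] using hq)
      constructor
      · rw [← hfr, gauge_smul_of_nonneg (inv_nonneg.2 hg.le), smul_eq_mul,
          inv_mul_cancel₀ hg.ne']
      · rw [height_add, inner_smul_left]
        have e : height M ξ q = height M ξ p + ⟪q - p, ξ⟫ := by
          rw [← height_add, add_sub_cancel]
        have h1 : 1 ≤ (gauge C' (q - p))⁻¹ := (one_le_inv₀ hg).2 hg1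
        have h2 : ⟪q - p, ξ⟫ < 0 := by linarith
        simp only [conj_trivial]
        nlinarith
  rw [himg]
  apply IsPreconnected.image
  · apply Convex.isPreconnected
    have : {q ∈ C | height M ξ q < c} = C ∩ {q | ⟪q, ξ⟫ < c + supp M ξ} := by
      ext q
      simp only [height, mem_ofPred_eq, mem_inter_iff, sub_lt_iff_lt_add]
    rw [this]
    apply hCconv.inter
    apply convex_halfSpace_lt
    exact ⟨fun x y => inner_add_left _ _ _, fun c x => by simp [inner_smul_left]⟩
  · have hgc : Continuous (gauge C') := continuous_gauge hC'conv hC'0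
    apply ContinuousOn.add continuousOn_const
    have h1 : ContinuousOn (fun q => (gauge C' (q - p))⁻¹) {q ∈ C | height M ξ q < c} :=
      ContinuousOn.inv₀ (by fun_prop) fun q hq =>
        (hpos (q - p) (by simpa using hq.1) (by simpa using hq.2)).ne'
    exact h1.smul (by fun_prop)

lemma exists_mem_interior_height_lt {ξ : Space n} {c : ℝ} (hg : IsGoodCap M ξ c) :
    ∃ p ∈ interior (convexHull ℝ M), c < height M ξ p := by
  obtain ⟨m, hm, hmc⟩ : ∃ m ∈ M, c < height M ξ m := by
    by_contra! h
    exact hg.ne (Subset.antisymm (fun x hx => hx.1) fun x hx => ⟨hx, h x hx⟩)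
  have h1 : m ∈ closure (interior (convexHull ℝ M)) := by
    rw [(convex_convexHull ℝ M).closure_interior_eq_closure_of_nonempty_interior
      hA.interior_nonempty]
    exact subset_closure (subset_convexHull ℝ M hm)
  obtain ⟨p, hp1, hp2⟩ := mem_closure_iff.1 h1 _
    (isOpen_lt continuous_const (continuous_height M ξ)) hmc
  exact ⟨p, hp2, hp1⟩

/-- Below the height of a good cap, the boundary of the closed convex hull is `M`. -/
lemma mem_of_mem_frontier {ξ x : Space n} {c : ℝ} (hg : IsGoodCap M ξ c)
    (hx : x ∈ frontier (closure (convexHull ℝ M))) (hxc : height M ξ x < c) : x ∈ M := by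
  obtain ⟨p, hp, hpc⟩ := hA.exists_mem_interior_height_lt hg
  have hpre := hA.isPreconnected_frontier_inter hg.mem hp hpc
  choose W hWo hxW hWM using fun y : M => hA.exists_isOpen_frontier_inter_subset y.2
  have ha := gaussInv_mem hg.mem
  by_contra hxM
  -- On the connected low boundary, the points of `M` form a nonempty subset that is open, since `M`
  -- is open in the boundary, and closed, since the cap is compact. Hence nothing else is left.
  obtain ⟨z, hz, hzu, hzv⟩ := hpre (⋃ y, W y) (cap M ξ c)ᶜ (isOpen_iUnion hWo)
    hg.compact.isClosed.isOpen_compl (fun y hy => by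
      by_cases hyM : y ∈ M
      · exact Or.inl (mem_iUnion.2 ⟨⟨y, hyM⟩, hxW _⟩)
      · exact Or.inr fun h => hyM h.1)
    ⟨gaussInv M ξ, ⟨hA.subset_frontier ha, by rw [height_gaussInv]; exact hg.pos⟩,
      mem_iUnion.2 ⟨⟨_, ha⟩, hxW _⟩⟩ ⟨x, ⟨hx, hxc⟩, fun h => hxM h.1⟩
  obtain ⟨y, hy⟩ := mem_iUnion.1 hzu
  exact hzv ⟨hWM y ⟨hz.1, hy⟩, hz.2.le⟩

/-- Below the cap height the hull has all its limit points, because its boundary there belongs to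
`M`. -/
lemma mem_convexHull_of_mem_closure {ξ x : Space n} {c : ℝ} (hg : IsGoodCap M ξ c)
    (hx : x ∈ closure (convexHull ℝ M)) (hxc : height M ξ x < c) : x ∈ convexHull ℝ M := by
  by_cases h : x ∈ interior (closure (convexHull ℝ M))
  · rw [hA.interior_closure_eq] at h
    exact interior_subset h
  · exact subset_convexHull ℝ M (hA.mem_of_mem_frontier hg ⟨subset_closure hx, h⟩ hxc)

/-- Every line inside a section below the height of a good cap leaves the convex hull. -/
lemma exists_notMem_of_inner_eq_zero {ξ q v : Space n} {c : ℝ} (hg : IsGoodCap M ξ c)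
    (hv : v ≠ 0) (hvξ : ⟪v, ξ⟫ = 0) : ∃ T : ℝ, 0 < T ∧ q + T • v ∉ closure (convexHull ℝ M) := by
  by_contra! h
  set C := closure (convexHull ℝ M)
  set a := gaussInv M ξ
  have ha : a ∈ M := gaussInv_mem hg.mem
  have haC : a ∈ C := subset_closure (subset_convexHull ℝ M ha)
  -- A ray that stays in the closed hull can be transported to the point of tangency, where it would
  -- run inside the tangent hyperplane; strict convexity forbids this.
  have hlim : Tendsto (fun k : ℝ => (1 - k⁻¹) • a + k⁻¹ • (q + k • v)) atTop (𝓝 (a + v)) := by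
    have h1 : Tendsto (fun k : ℝ => (1 - k⁻¹) • a + k⁻¹ • q + v) atTop
        (𝓝 ((1 - (0 : ℝ)) • a + (0 : ℝ) • q + v)) :=
      ((((tendsto_const_nhds.sub tendsto_inv_atTop_zero).smul_const a).add
        (tendsto_inv_atTop_zero.smul_const q)).add_const v)
    simp only [sub_zero, one_smul, zero_smul, add_zero] at h1
    refine h1.congr' ?_
    filter_upwards [eventually_gt_atTop 0] with k hk
    rw [smul_add, smul_smul, inv_mul_cancel₀ hk.ne', one_smul, add_assoc]
  have hav : a + v ∈ C := by
    refine isClosed_closure.mem_of_tendsto hlim ?_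
    filter_upwards [eventually_ge_atTop 1] with k hk
    have hk0 : (0 : ℝ) < k := by linarith
    exact (convex_convexHull ℝ M).closure haC (h k hk0)
      (by rw [sub_nonneg]; exact inv_le_one_of_one_le₀ hk) (by positivity) (by ring)
  have hh : height M ξ (a + v) = 0 := by rw [height_add, height_gaussInv, hvξ, add_zero]
  have hK := hA.mem_convexHull_of_mem_closure hg hav (by rw [hh]; exact hg.pos)
  have := hA.inner_pos_of_mem_convexHull ha hK (by simpa using hv)
  rw [gaussMap_gaussInv hg.mem, ← height_eq, hh] at this
  exact this.false

end IsAdmissible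

end PolyIntegrable

/-! ### Projections to hyperplanes and the area formula -/

namespace PolyIntegrable

variable {n : ℕ}

/-- `ι` identifies `ℝⁿ⁻¹` isometrically with the orthogonal complement of the unit vector `e`. -/
structure IsFrame (e : Space n) (ι : Space (n - 1) →ₗᵢ[ℝ] Space n) : Prop where
  norm_eq : ‖e‖ = 1
  inner_eq : ∀ y, ⟪ι y, e⟫ = 0
  mem_range : ∀ v, ⟪v, e⟫ = 0 → v ∈ range ι

/-- The orthogonal projection along `e`, in the coordinates of a frame. -/
noncomputable def proj (ι : Space (n - 1) →ₗᵢ[ℝ] Space n) : Space n →L[ℝ] Space (n - 1) :=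
  ContinuousLinearMap.adjoint ι.toContinuousLinearMap

lemma exists_isFrame (hn : 1 ≤ n) {e : Space n} (he : ‖e‖ = 1) : ∃ ι, IsFrame e ι := by
  have he0 : e ≠ 0 := by
    rintro rfl
    simp at he
  have : Fact (Module.finrank ℝ (Space n) = (n - 1) + 1) := ⟨by
    rw [finrank_euclideanSpace_fin]; omega⟩
  have hfr : Module.finrank ℝ ((ℝ ∙ e)ᗮ : Submodule ℝ (Space n)) = n - 1 :=
    Submodule.finrank_orthogonal_span_singleton he0
  let b := (stdOrthonormalBasis ℝ ((ℝ ∙ e)ᗮ : Submodule ℝ (Space n))).reindex (finCongr hfr)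
  refine ⟨((ℝ ∙ e)ᗮ).subtypeₗᵢ.comp b.repr.symm.toLinearIsometry, he, fun y => ?_, fun v hv => ?_⟩
  · have := (b.repr.symm y).2
    rw [Submodule.mem_orthogonal_singleton_iff_inner_left] at this
    exact this
  · have hv' : v ∈ (ℝ ∙ e)ᗮ := Submodule.mem_orthogonal_singleton_iff_inner_left.2 hv
    exact ⟨b.repr ⟨v, hv'⟩, by simp⟩

lemma inner_proj_left (ι : Space (n - 1) →ₗᵢ[ℝ] Space n) (x : Space n) (y : Space (n - 1)) :
    ⟪proj ι x, y⟫ = ⟪x, ι y⟫ :=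
  ContinuousLinearMap.adjoint_inner_left _ _ _

@[simp]
lemma proj_apply_self (ι : Space (n - 1) →ₗᵢ[ℝ] Space n) (y : Space (n - 1)) :
    proj ι (ι y) = y := ext_inner_right ℝ fun z => by
  rw [inner_proj_left, ι.inner_map_map]

namespace IsFrame

variable {e : Space n} {ι : Space (n - 1) →ₗᵢ[ℝ] Space n} (h : IsFrame e ι)
include h

lemma proj_self : proj ι e = 0 := ext_inner_right ℝ fun z => by
  rw [inner_proj_left, real_inner_comm, h.inner_eq, inner_zero_left]

lemma inner_eq_left (y : Space (n - 1)) : ⟪e, ι y⟫ = 0 := by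
  rw [real_inner_comm, h.inner_eq]

lemma inner_self : ⟪e, e⟫ = 1 := by
  rw [real_inner_self_eq_norm_sq, h.norm_eq]
  norm_num

lemma decomp (x : Space n) : x = ι (proj ι x) + ⟪x, e⟫ • e := by
  obtain ⟨y, hy⟩ := h.mem_range (x - ⟪x, e⟫ • e) (by
    rw [inner_sub_left, inner_smul_left, h.inner_self]
    simp)
  have : x = ι y + ⟪x, e⟫ • e := by rw [hy]; abel
  have h2 : proj ι x = y := by
    rw [this, map_add, map_smul, h.proj_self, smul_zero, add_zero, proj_apply_self]
  rw [h2]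
  exact this

lemma norm_sq (x : Space n) : ‖x‖ ^ 2 = ‖proj ι x‖ ^ 2 + ⟪x, e⟫ ^ 2 := by
  nth_rw 1 [h.decomp x]
  rw [← real_inner_self_eq_norm_sq, inner_add_left, inner_add_right, inner_add_right,
    ι.inner_map_map, inner_smul_left, inner_smul_right, inner_smul_left, inner_smul_right,
    h.inner_eq, h.inner_eq_left, h.inner_self, real_inner_self_eq_norm_sq]
  simp
  ring

lemma norm_proj_le (x : Space n) : ‖proj ι x‖ ≤ ‖x‖ := by
  have := h.norm_sq x
  nlinarith [norm_nonneg x, norm_nonneg (proj ι x), sq_nonneg ⟪x, e⟫]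

lemma lipschitz_proj : LipschitzWith 1 (proj ι) :=
  LipschitzWith.of_dist_le_mul fun x y => by
    rw [dist_eq_norm, dist_eq_norm, ← map_sub, NNReal.coe_one, one_mul]
    exact h.norm_proj_le _

/-- The determinant of the projection between two hyperplanes is the cosine of their angle. -/
lemma abs_det_proj_comp {e' : Space n} {ι' : Space (n - 1) →ₗᵢ[ℝ] Space n} (h' : IsFrame e' ι') :
    |((proj ι).comp ι'.toContinuousLinearMap).det| = |⟪e', e⟫| := by
  rw [← sq_eq_sq_iff_abs_eq_abs]
  set B : Space (n - 1) →L[ℝ] Space (n - 1) := (proj ι).comp ι'.toContinuousLinearMap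
  have h1 : B.det ^ 2 = ((LinearMap.adjoint (B : Space (n - 1) →ₗ[ℝ] Space (n - 1))) ∘ₗ
      (B : Space (n - 1) →ₗ[ℝ] Space (n - 1))).det := by
    have := LinearMap.normDet_sq (B : Space (n - 1) →ₗ[ℝ] Space (n - 1))
    rw [LinearMap.normDet_eq_norm_det, Real.norm_eq_abs, sq_abs] at this
    exact this
  set c := proj ι' e
  -- `BᵀB` is the identity minus the rank-one operator of `c`, with determinant `1 - ‖c‖²`; by
  -- Pythagoras for the unit vector `e` this is `⟪e', e⟫²`.
  have h2 : ((LinearMap.adjoint (B : Space (n - 1) →ₗ[ℝ] Space (n - 1))) ∘ₗ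
      (B : Space (n - 1) →ₗ[ℝ] Space (n - 1))) =
      LinearMap.transvection (-(innerₛₗ ℝ c)) c := by
    ext1 y
    refine ext_inner_right ℝ fun z => ?_
    rw [LinearMap.comp_apply, LinearMap.adjoint_inner_left]
    change ⟪proj ι (ι' y), proj ι (ι' z)⟫ = ⟪y + (-⟪c, y⟫) • c, z⟫
    have e1 : ⟪ι' y, ι' z⟫ = ⟪proj ι (ι' y), proj ι (ι' z)⟫ + ⟪ι' y, e⟫ * ⟪ι' z, e⟫ := by
      nth_rw 1 [h.decomp (ι' y), h.decomp (ι' z)]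
      rw [inner_add_left, inner_add_right, inner_add_right,
        ι.inner_map_map, inner_smul_left, inner_smul_right, inner_smul_left, inner_smul_right,
        h.inner_eq, h.inner_eq_left, h.inner_self]
      simp
    rw [ι'.inner_map_map] at e1
    rw [inner_add_left, inner_smul_left, e1, inner_proj_left ι' e y, inner_proj_left ι' e z,
      real_inner_comm (ι' y) e, real_inner_comm (ι' z) e]
    simp
  rw [h1, h2, LinearMap.transvection.det]
  change 1 + -⟪c, c⟫ = _
  have h3 := h'.norm_sq e
  rw [h.norm_eq] at h3
  rw [real_inner_self_eq_norm_sq, real_inner_comm e e']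
  linarith

end IsFrame

/-- The normalising factor depends only on `d`, so the Lipschitz bound for Hausdorff measure
survives it. -/
lemma _root_.LipschitzOnWith.euclideanHausdorffMeasure_image_le {X Y : Type*} [EMetricSpace X]
    [EMetricSpace Y] [MeasurableSpace X] [BorelSpace X] [MeasurableSpace Y] [BorelSpace Y]
    {K : NNReal} {f : X → Y} {s : Set X} (h : LipschitzOnWith K f s) (d : ℕ) :
    (μHE[d] : Measure Y) (f '' s) ≤ (K : ENNReal) ^ d * (μHE[d] : Measure X) s := by
  simp only [Measure.euclideanHausdorffMeasure_def, Measure.smul_apply, ENNReal.smul_def,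
    smul_eq_mul]
  rw [mul_left_comm]
  gcongr
  simpa using h.hausdorffMeasure_image_le (d := d) (by positivity)

/-- The set `M` has the tangent hyperplane `ν^⊥` at `x`, in the strict sense. -/
def IsTangent (M : Set (Space n)) (x ν : Space n) : Prop :=
  ∀ ε : ℝ, 0 < ε → ∃ W ∈ 𝓝 x, ∀ y ∈ M ∩ W, ∀ z ∈ M ∩ W, |⟪y - z, ν⟫| ≤ ε * ‖y - z‖

lemma volume_eq_euclideanHausdorffMeasure (m : ℕ) (s : Set (Space m)) :
    volume s = (μHE[m] : Measure (Space m)) s := by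
  rw [EuclideanSpace.euclideanHausdorffMeasure_eq_volume]

/-- Near a point with tangent hyperplane `ν^⊥`, the projection along `e` multiplies the area by a
factor close to `|⟨ν, e⟩|`. -/
lemma IsTangent.exists_measure_proj {M : Set (Space n)} {x ν e : Space n} (hM : IsTangent M x ν)
    {ι ι₀ : Space (n - 1) →ₗᵢ[ℝ] Space n} (h : IsFrame e ι) (h₀ : IsFrame ν ι₀) {m₁ m₂ : NNReal}
    (h₁ : m₁ < |⟪ν, e⟫|) (h₂ : |⟪ν, e⟫| < m₂) :
    ∃ W ∈ 𝓝 x, ∀ B ⊆ M ∩ W,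
      m₁ * (μHE[n - 1] : Measure (Space n)) B ≤ volume (proj ι '' B) ∧
      volume (proj ι '' B) ≤ m₂ * (μHE[n - 1] : Measure (Space n)) B := by
  set A : Space (n - 1) →L[ℝ] Space (n - 1) := (proj ι).comp ι₀.toContinuousLinearMap with hA
  have hdet : |A.det| = |⟪ν, e⟫| := h.abs_det_proj_comp h₀
  obtain ⟨m', hm₁', hm'⟩ := exists_between h₁
  lift m' to NNReal using m₁.2.trans hm₁'.le
  have ev₁ := mul_le_addHaar_image_of_lt_det (volume : Measure (Space (n - 1))) A (m := m') (by
    rw [hdet, ENNReal.lt_ofReal_iff_toReal_lt ENNReal.coe_ne_top]; exact hm')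
  have ev₂ := addHaar_image_le_mul_of_det_lt (volume : Measure (Space (n - 1))) A (m := m₂) (by
    rw [hdet, ENNReal.ofReal_lt_iff_lt_toReal (abs_nonneg _) ENNReal.coe_ne_top]; exact h₂)
  obtain ⟨δ, ⟨hδ₁, hδ₂⟩, hδ⟩ := ((ev₁.and ev₂).and self_mem_nhdsWithin).exists
  have hδ : 0 < δ := hδ
  -- `K` is the Lipschitz loss allowed when a piece of `M` is compared with its shadow in the
  -- tangent hyperplane; it must fit into the gap between `m₁` and `m'`.
  obtain ⟨K, hK1, hK⟩ : ∃ K : NNReal, 1 < K ∧ m₁ * K ^ (n - 1) ≤ m' := by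
    have hc : Tendsto (fun K : NNReal => m₁ * K ^ (n - 1)) (𝓝[>] 1) (𝓝 (m₁ * 1 ^ (n - 1))) := by
      apply Continuous.continuousWithinAt
      fun_prop
    rw [one_pow, mul_one] at hc
    obtain ⟨K, hK, hK1⟩ := ((hc.eventually (gt_mem_nhds (show m₁ < m' from hm₁'))).and
      self_mem_nhdsWithin).exists
    exact ⟨K, hK1, hK.le⟩
  have hK1' : (1 : ℝ) < K := hK1
  have hK0 : (0 : ℝ) < K := by linarith
  -- The first bound makes the inverse of the projection to the tangent hyperplane `K`-Lipschitz on
  -- a small piece of `M`; the second makes the projection along `e`, read in that hyperplane, a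
  -- `δ`-perturbation of `A`.
  obtain ⟨ε, hε, hεK, hεδ⟩ : ∃ ε : ℝ, 0 < ε ∧ ε ^ 2 ≤ 1 - ((K : ℝ)⁻¹) ^ 2 ∧ ε * K ≤ δ := by
    have hpos : 0 < 1 - ((K : ℝ)⁻¹) ^ 2 := by
      have : ((K : ℝ)⁻¹) < 1 := inv_lt_one_of_one_lt₀ hK1'
      have h0 : 0 < (K : ℝ)⁻¹ := by positivity
      nlinarith
    refine ⟨min (Real.sqrt (1 - ((K : ℝ)⁻¹) ^ 2)) (δ / K), by positivity, ?_, ?_⟩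
    · calc _ ≤ Real.sqrt (1 - ((K : ℝ)⁻¹) ^ 2) ^ 2 := by
            gcongr
            exact min_le_left _ _
        _ = _ := Real.sq_sqrt hpos.le
    · exact (le_div_iff₀ hK0).1 (min_le_right _ _)
  obtain ⟨W, hW, hWε⟩ := hM ε hε
  refine ⟨W, hW, fun B hB => ?_⟩
  have hlow : ∀ y ∈ B, ∀ z ∈ B, ‖y - z‖ ≤ K * ‖proj ι₀ (y - z)‖ := by
    intro y hy z hz
    have h1 := hWε y (hB hy) z (hB hz)
    have h2 := h₀.norm_sq (y - z)
    have h3 : ⟪y - z, ν⟫ ^ 2 ≤ (1 - ((K : ℝ)⁻¹) ^ 2) * ‖y - z‖ ^ 2 := by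
      calc ⟪y - z, ν⟫ ^ 2 = |⟪y - z, ν⟫| ^ 2 := (sq_abs _).symm
        _ ≤ (ε * ‖y - z‖) ^ 2 := by gcongr
        _ = ε ^ 2 * ‖y - z‖ ^ 2 := by ring
        _ ≤ _ := by gcongr
    have h4 : ((K : ℝ)⁻¹ * ‖y - z‖) ^ 2 ≤ ‖proj ι₀ (y - z)‖ ^ 2 := by
      rw [mul_pow]
      linarith
    have h5 := abs_le_of_sq_le_sq' h4 (norm_nonneg _)
    calc ‖y - z‖ = K * ((K : ℝ)⁻¹ * ‖y - z‖) := by field_simp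
      _ ≤ _ := by gcongr; exact h5.2
  have hinj : InjOn (proj ι₀) B := by
    intro y hy z hz hyz
    have := hlow y hy z hz
    rw [map_sub, hyz, sub_self, norm_zero, mul_zero] at this
    exact sub_eq_zero.1 (norm_le_zero_iff.1 this)
  set g := Function.invFunOn (proj ι₀) B
  have hg : LeftInvOn g (proj ι₀) B := hinj.leftInvOn_invFunOn
  have hgB : g '' (proj ι₀ '' B) = B := hg.image_image
  have hgmem : ∀ y ∈ proj ι₀ '' B, g y ∈ B := fun y hy => Function.invFunOn_mem hy
  have hgeq : ∀ y ∈ proj ι₀ '' B, proj ι₀ (g y) = y := fun y hy => Function.invFunOn_eq hy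
  have hglip : LipschitzOnWith K g (proj ι₀ '' B) := by
    refine LipschitzOnWith.of_dist_le_mul fun y hy z hz => ?_
    rw [dist_eq_norm, dist_eq_norm]
    have := hlow _ (hgmem y hy) _ (hgmem z hz)
    rwa [map_sub, hgeq y hy, hgeq z hz] at this
  have happ : ApproximatesLinearOn (fun y => proj ι (g y)) A (proj ι₀ '' B) δ := by
    intro y hy z hz
    have h1 : proj ι (g y) - proj ι (g z) - A (y - z) =
        ⟪g y - g z, ν⟫ • proj ι ν := by
      have h2 := h₀.decomp (g y - g z)
      have h3 := congrArg (proj ι) h2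
      rw [map_sub, map_add, map_smul] at h3
      rw [h3, hA]
      simp only [map_sub, hgeq y hy, hgeq z hz]
      simp
    rw [h1, norm_smul, Real.norm_eq_abs]
    have hν : ‖proj ι ν‖ ≤ 1 := (h.norm_proj_le ν).trans_eq h₀.norm_eq
    have h2 := hlow _ (hgmem y hy) _ (hgmem z hz)
    rw [map_sub, hgeq y hy, hgeq z hz] at h2
    calc |⟪g y - g z, ν⟫| * ‖proj ι ν‖ ≤ (ε * ‖g y - g z‖) * 1 := by
          gcongr
          exact hWε _ (hB (hgmem y hy)) _ (hB (hgmem z hz))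
      _ ≤ ε * (K * ‖y - z‖) := by rw [mul_one]; gcongr
      _ = (ε * K) * ‖y - z‖ := by ring
      _ ≤ δ * ‖y - z‖ := by gcongr
  have himg : (fun y => proj ι (g y)) '' (proj ι₀ '' B) = proj ι '' B := by
    rw [image_image]
    refine image_congr fun y hy => ?_
    rw [hg hy]
  have a₁ := hδ₁ _ _ happ
  have a₂ := hδ₂ _ _ happ
  rw [himg] at a₁ a₂
  constructor
  · have h1 := hglip.euclideanHausdorffMeasure_image_le (n - 1)
    rw [hgB, ← volume_eq_euclideanHausdorffMeasure] at h1
    calc (m₁ : ENNReal) * (μHE[n - 1] : Measure (Space n)) B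
        ≤ m₁ * (K ^ (n - 1) * volume (proj ι₀ '' B)) := by gcongr
      _ = ((m₁ * K ^ (n - 1) : NNReal) : ENNReal) * volume (proj ι₀ '' B) := by
        push_cast
        ring
      _ ≤ m' * volume (proj ι₀ '' B) := by gcongr
      _ ≤ _ := a₁
  · refine a₂.trans ?_
    gcongr
    have h1 := (h₀.lipschitz_proj.lipschitzOnWith (s := B)).euclideanHausdorffMeasure_image_le
      (n - 1)
    rw [← volume_eq_euclideanHausdorffMeasure] at h1
    simpa using h1

/-- Area formula for the projection of a hypersurface to a hyperplane. -/
lemma volume_proj_image {M B : Set (Space n)} {ν : Space n → Space n} {e : Space n}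
    (hn : 1 ≤ n) {ι : Space (n - 1) →ₗᵢ[ℝ] Space n} (h : IsFrame e ι)
    (hM : ∀ x ∈ M, IsTangent M x (ν x)) (hν : ∀ x ∈ M, ‖ν x‖ = 1) (hνc : ContinuousOn ν M)
    (hB : MeasurableSet B) (hBM : B ⊆ M) (hinj : InjOn (proj ι) B)
    (hpos : ∀ x ∈ B, ⟪ν x, e⟫ ≠ 0) :
    volume (proj ι '' B) =
      ∫⁻ x in B, ENNReal.ofReal |⟪ν x, e⟫| ∂(μHE[n - 1] : Measure (Space n)) := by
  set μ : Measure (Space n) := μHE[n - 1]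
  have hmeas : ∀ E ⊆ B, MeasurableSet E → MeasurableSet (proj ι '' E) := fun E hE hEm =>
    hEm.image_of_continuousOn_injOn (proj ι).continuous.continuousOn (hinj.mono hE)
  -- Locally the area factor and the cosine both lie between `d / κ` and `d * κ`, so the two sides
  -- agree up to `κ²`. A countable disjoint decomposition makes this global, and then `κ` tends to
  -- one.
  have key : ∀ κ : NNReal, 1 < κ →
      volume (proj ι '' B) ≤ κ ^ 2 * ∫⁻ x in B, ENNReal.ofReal |⟪ν x, e⟫| ∂μ ∧
      ∫⁻ x in B, ENNReal.ofReal |⟪ν x, e⟫| ∂μ ≤ κ ^ 2 * volume (proj ι '' B) := by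
    intro κ hκ
    have hκ0 : κ ≠ 0 := (zero_lt_one.trans hκ).ne'
    have hloc : ∀ x ∈ B, ∃ W, IsOpen W ∧ x ∈ W ∧ ∀ E ⊆ B ∩ W, MeasurableSet E →
        volume (proj ι '' E) ≤ κ ^ 2 * ∫⁻ x in E, ENNReal.ofReal |⟪ν x, e⟫| ∂μ ∧
        ∫⁻ x in E, ENNReal.ofReal |⟪ν x, e⟫| ∂μ ≤ κ ^ 2 * volume (proj ι '' E) := by
      intro x hx
      have hxM := hBM hx
      set d : NNReal := ⟨|⟪ν x, e⟫|, abs_nonneg _⟩ with hd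
      have hd0 : 0 < d := abs_pos.2 (hpos x hx)
      obtain ⟨ι₀, h₀⟩ := exists_isFrame hn (hν x hxM)
      have hm₁ : d / κ < d := div_lt_self hd0 hκ
      have hm₂ : d < d * κ := lt_mul_of_one_lt_right hd0 hκ
      obtain ⟨W₁, hW₁, h₁⟩ := (hM x hxM).exists_measure_proj h h₀ (m₁ := d / κ) (m₂ := d * κ)
        hm₁ hm₂
      have hcont : ContinuousWithinAt (fun y => |⟪ν y, e⟫|) M x :=
        ((hνc x hxM).inner continuousWithinAt_const).abs
      have hev : ∀ᶠ y in 𝓝[M] x, (d / κ : NNReal) < |⟪ν y, e⟫| ∧ |⟪ν y, e⟫| < (d * κ : NNReal) :=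
        hcont.eventually ((lt_mem_nhds (show ((d / κ : NNReal) : ℝ) < |⟪ν x, e⟫| from hm₁)).and
          (gt_mem_nhds (show |⟪ν x, e⟫| < ((d * κ : NNReal) : ℝ) from hm₂)))
      obtain ⟨W₂, hW₂, h₂⟩ := eventually_iff_exists_mem.1
        (eventually_nhdsWithin_iff.1 hev)
      obtain ⟨W, hWs, hWo, hxW⟩ := mem_nhds_iff.1 (inter_mem hW₁ hW₂)
      refine ⟨W, hWo, hxW, fun E hE hEm => ?_⟩
      obtain ⟨b₁, b₂⟩ := h₁ E fun y hy => ⟨hBM (hE hy).1, (hWs (hE hy).2).1⟩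
      have hd12 : ((d * κ : NNReal) : ENNReal) = κ ^ 2 * ((d / κ : NNReal) : ENNReal) := by
        norm_cast
        field_simp
      have c₁ : ((d / κ : NNReal) : ENNReal) * μ E ≤
          ∫⁻ x in E, ENNReal.ofReal |⟪ν x, e⟫| ∂μ := by
        rw [← setLIntegral_const]
        refine setLIntegral_mono' hEm fun y hy => ?_
        rw [ENNReal.le_ofReal_iff_toReal_le ENNReal.coe_ne_top (abs_nonneg _)]
        exact (h₂ y (hWs (hE hy).2).2 (hBM (hE hy).1)).1.le
      have c₂ : ∫⁻ x in E, ENNReal.ofReal |⟪ν x, e⟫| ∂μ ≤ ((d * κ : NNReal) : ENNReal) * μ E := by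
        rw [← setLIntegral_const]
        refine setLIntegral_mono' hEm fun y hy => ?_
        rw [ENNReal.ofReal_le_iff_le_toReal ENNReal.coe_ne_top]
        exact (h₂ y (hWs (hE hy).2).2 (hBM (hE hy).1)).2.le
      constructor
      · calc volume (proj ι '' E) ≤ ((d * κ : NNReal) : ENNReal) * μ E := b₂
          _ = κ ^ 2 * (((d / κ : NNReal) : ENNReal) * μ E) := by rw [hd12, mul_assoc]
          _ ≤ _ := by gcongr
      · calc _ ≤ ((d * κ : NNReal) : ENNReal) * μ E := c₂
          _ = κ ^ 2 * (((d / κ : NNReal) : ENNReal) * μ E) := by rw [hd12, mul_assoc]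
          _ ≤ _ := by gcongr
    rcases B.eq_empty_or_nonempty with rfl | hBne
    · simp
    choose! W hWo hxW hW using hloc
    obtain ⟨t, htB, htc, hcov⟩ := TopologicalSpace.countable_cover_nhdsWithin (f := W) (s := B)
      fun x hx => mem_nhdsWithin_of_mem_nhds ((hWo x hx).mem_nhds (hxW x hx))
    have htne : t.Nonempty := by
      rw [nonempty_iff_ne_empty]
      rintro rfl
      obtain ⟨x, hx⟩ := hBne
      simpa using hcov hx
    obtain ⟨f, rfl⟩ := htc.exists_eq_range htne
    set E : ℕ → Set (Space n) := fun i => B ∩ disjointed (fun i => W (f i)) i with hE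
    have hfB : ∀ i, f i ∈ B := fun i => htB ⟨i, rfl⟩
    have hEm : ∀ i, MeasurableSet (E i) := fun i =>
      hB.inter (MeasurableSet.disjointed (fun i => (hWo _ (hfB i)).measurableSet) i)
    have hEd : Pairwise (Function.onFun Disjoint E) := fun i j hij =>
      (disjoint_disjointed (fun i => W (f i)) hij).mono inter_subset_right inter_subset_right
    have hEB : ⋃ i, E i = B := by
      rw [hE, ← inter_iUnion, iUnion_disjointed]
      refine inter_eq_left.2 fun x hx => ?_
      simpa using hcov hx
    have hEs : ∀ i, E i ⊆ B ∩ W (f i) := fun i =>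
      inter_subset_inter_right _ (disjointed_subset _ i)
    have hvol : volume (proj ι '' B) = ∑' i, volume (proj ι '' (E i)) := by
      nth_rw 1 [← hEB]
      rw [image_iUnion, measure_iUnion]
      · intro i j hij
        rw [Function.onFun, Set.disjoint_left]
        rintro _ ⟨x, hx, rfl⟩ ⟨y, hy, hxy⟩
        have := hinj (hEs j hy).1 (hEs i hx).1 hxy
        subst this
        exact Set.disjoint_left.1 (hEd hij) hx hy
      · exact fun i => hmeas _ (fun x hx => (hEs i hx).1) (hEm i)
    have hint : ∫⁻ x in B, ENNReal.ofReal |⟪ν x, e⟫| ∂μ =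
        ∑' i, ∫⁻ x in E i, ENNReal.ofReal |⟪ν x, e⟫| ∂μ := by
      nth_rw 1 [← hEB]
      exact lintegral_iUnion hEm hEd _
    rw [hvol, hint, ← ENNReal.tsum_mul_left, ← ENNReal.tsum_mul_left]
    exact ⟨ENNReal.tsum_le_tsum fun i => (hW _ (hfB i) _ (hEs i) (hEm i)).1,
      ENNReal.tsum_le_tsum fun i => (hW _ (hfB i) _ (hEs i) (hEm i)).2⟩
  have hlim : ∀ a b : ENNReal, (∀ κ : NNReal, 1 < κ → a ≤ κ ^ 2 * b) → a ≤ b := by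
    intro a b hab
    rcases eq_or_ne b ⊤ with rfl | hb
    · exact le_top
    have hc : Tendsto (fun κ : NNReal => ((κ ^ 2 : NNReal) : ENNReal) * b) (𝓝[>] 1)
        (𝓝 (((1 ^ 2 : NNReal) : ENNReal) * b)) := by
      refine ENNReal.Tendsto.mul_const ?_ (Or.inr hb)
      apply Continuous.continuousWithinAt
      fun_prop
    rw [one_pow, ENNReal.coe_one, one_mul] at hc
    refine ge_of_tendsto hc ?_
    filter_upwards [self_mem_nhdsWithin] with κ hκ
    simpa using hab κ hκ
  exact le_antisymm (hlim _ _ fun κ hκ => (key κ hκ).1) (hlim _ _ fun κ hκ => (key κ hκ).2)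

end PolyIntegrable

/-! ### Sections, sheets and the flux identity -/

namespace PolyIntegrable

variable {n : ℕ} {M : Set (Space n)}

/-- The section of the convex hull of `M` at height `t` over the tangent hyperplane with
normal `ξ`. -/
def slice (M : Set (Space n)) (ξ : Space n) (t : ℝ) : Set (Space n) :=
  {x ∈ convexHull ℝ M | height M ξ x = t}

lemma IsFrame.eq_add_smul_of_proj_eq {ξ x y : Space n} {ι : Space (n - 1) →ₗᵢ[ℝ] Space n}
    (h : IsFrame ξ ι) (hxy : proj ι x = proj ι y) : y = x + (height M ξ y - height M ξ x) • ξ := by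
  have h1 := h.decomp (y - x)
  rw [map_sub, hxy, sub_self, map_zero, zero_add, inner_sub_left] at h1
  simp only [height]
  rw [sub_sub_sub_cancel_right, ← h1]
  abel

lemma IsFrame.proj_add_smul {ξ : Space n} {ι : Space (n - 1) →ₗᵢ[ℝ] Space n}
    (h : IsFrame ξ ι) (x : Space n) (u : ℝ) : proj ι (x + u • ξ) = proj ι x := by
  rw [map_add, map_smul, h.proj_self, smul_zero, add_zero]

lemma isTangent_hyperplane (ξ : Space n) (s : ℝ) (x : Space n) :
    IsTangent {x | ⟪x, ξ⟫ = s} x ξ := fun ε hε =>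
  ⟨univ, univ_mem, fun y hy z hz => by
    have h1 : ⟪y, ξ⟫ = s := hy.1
    have h2 : ⟪z, ξ⟫ = s := hz.1
    rw [inner_sub_left, h1, h2, sub_self, abs_zero]
    positivity⟩

lemma injOn_proj_hyperplane {ξ e : Space n} {ι : Space (n - 1) →ₗᵢ[ℝ] Space n}
    (h : IsFrame e ι) (hξe : ⟪ξ, e⟫ ≠ 0) (s : ℝ) : InjOn (proj ι) {x | ⟪x, ξ⟫ = s} := by
  intro x hx y hy hxy
  have hx : ⟪x, ξ⟫ = s := hx
  have hy : ⟪y, ξ⟫ = s := hy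
  have h1 := h.decomp (x - y)
  rw [map_sub, hxy, sub_self, map_zero, zero_add] at h1
  have h2 : ⟪x - y, ξ⟫ = 0 := by rw [inner_sub_left, hx, hy, sub_self]
  rw [h1, inner_smul_left, real_inner_comm ξ e] at h2
  simp only [conj_trivial] at h2
  rw [(mul_eq_zero.1 h2).resolve_right hξe, zero_smul] at h1
  exact sub_eq_zero.1 h1

/-- The projection of a set in a hyperplane along `e` multiplies its area by a cosine. -/
lemma volume_proj_image_of_subset_hyperplane (hn : 1 ≤ n) {ξ e : Space n} (hξ : ‖ξ‖ = 1)
    {ι : Space (n - 1) →ₗᵢ[ℝ] Space n} (h : IsFrame e ι) (hξe : ⟪ξ, e⟫ ≠ 0) {s : ℝ}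
    {B : Set (Space n)} (hB : MeasurableSet B) (hBs : B ⊆ {x | ⟪x, ξ⟫ = s}) :
    volume (proj ι '' B) = ENNReal.ofReal |⟪ξ, e⟫| * (μHE[n - 1] : Measure (Space n)) B := by
  rw [volume_proj_image (M := {x | ⟪x, ξ⟫ = s}) (ν := fun _ => ξ) hn h
    (fun x _ => isTangent_hyperplane ξ s x) (fun _ _ => hξ) continuousOn_const hB hBs
    ((injOn_proj_hyperplane h hξe s).mono hBs) (fun _ _ => hξe), setLIntegral_const]

lemma height_eq_iff {ξ x : Space n} {t : ℝ} : height M ξ x = t ↔ ⟪x, ξ⟫ = t + supp M ξ := by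
  simp [height, sub_eq_iff_eq_add]

lemma slice_subset_hyperplane (ξ : Space n) (t : ℝ) :
    slice M ξ t ⊆ {x | ⟪x, ξ⟫ = t + supp M ξ} := fun _ hx => height_eq_iff.1 hx.2

lemma convex_slice (M : Set (Space n)) (ξ : Space n) (t : ℝ) : Convex ℝ (slice M ξ t) := by
  have : slice M ξ t = convexHull ℝ M ∩ {x | ⟪x, ξ⟫ = t + supp M ξ} := by
    ext x
    simp [slice, height_eq_iff]
  rw [this]
  refine (convex_convexHull ℝ M).inter (convex_hyperplane ?_ _)
  exact ⟨fun x y => inner_add_left _ _ _, fun c x => by simp [inner_smul_left]⟩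

/-- The part of `M` below height `s` where `σ ⟨ν, ξ⟩ > 0`. -/
def sheet (M : Set (Space n)) (ξ : Space n) (σ s : ℝ) : Set (Space n) :=
  {x ∈ M | height M ξ x < s ∧ 0 < σ * ⟪gaussMap M x, ξ⟫}

/-- The sheet lies in the compact cap, whose shadow is compact. -/
lemma volume_proj_sheet_lt_top {ξ : Space n} {c : ℝ} (hg : IsGoodCap M ξ c)
    (ι : Space (n - 1) →ₗᵢ[ℝ] Space n) (σ : ℝ) {s : ℝ} (hs : s ≤ c) :
    volume (proj ι '' sheet M ξ σ s) < ⊤ := by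
  refine (measure_mono (image_mono fun x hx => ?_)).trans_lt
    (hg.compact.image (proj ι).continuous).measure_lt_top
  exact ⟨hx.1, hx.2.1.le.trans hs⟩

lemma sectionVolume_eq {ξ : Space n} (hξ : ξ ∈ normals M) (t : ℝ) :
    sectionVolume M (gaussInv M ξ) t = (μHE[n - 1] : Measure (Space n)).real (slice M ξ t) := by
  unfold sectionVolume slice
  congr 1
  ext x
  simp [gaussMap_gaussInv hξ, height_eq]

namespace IsAdmissible

variable (hA : IsAdmissible M)
include hA

lemma one_le : 1 ≤ n := by linarith [hA.three_le]

lemma continuousOn_gaussMap : ContinuousOn (gaussMap M) M := hA.gauss.2.2.1.continuousOn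

/-- Strict differentiability of `F` controls all pairs of points near `x`, and `F` vanishes at both
when they lie on `M`. -/
lemma isTangent {x : Space n} (hx : x ∈ M) : IsTangent M x (gaussMap M x) := by
  intro ε hε
  obtain ⟨V, F, hV, hxV, hF, hF', hMV⟩ := hA.analytic x hx
  obtain ⟨κ, hκ0, hκ⟩ := hA.exists_fderiv_eq hx hV hxV hF hF' hMV
  have hs : HasStrictFDerivAt F (fderiv ℝ F x) x := (hF x hxV).hasStrictFDerivAt
  have ho := (hasStrictFDerivAt_iff_isLittleO.1 hs).def (show 0 < ε * |κ| by positivity)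
  rw [nhds_prod_eq, eventually_prod_self_iff'] at ho
  obtain ⟨t, ht, h⟩ := ho
  refine ⟨t ∩ V, inter_mem ht (hV.mem_nhds hxV), fun y hy z hz => ?_⟩
  have h1 := h y hy.2.1 z hz.2.1
  have h0 : ∀ y ∈ M ∩ (t ∩ V), F y = 0 := fun y hy => by
    have : y ∈ M ∩ V := ⟨hy.1, hy.2.2⟩
    rw [hMV] at this
    exact this.2
  simp only [h0 y hy, h0 z hz, sub_self, zero_sub, norm_neg, hκ, Real.norm_eq_abs, abs_mul] at h1
  have : 0 < |κ| := by positivity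
  nlinarith

/-- Near each of its points `M` is the zero set of a continuous function on an open set, so `M` is
locally closed. -/
lemma measurableSet : MeasurableSet M := by
  have : IsLocallyClosed M := by
    refine ((isLocallyClosed_tfae M).out 0 3).2 fun x hx => ?_
    obtain ⟨V, F, hV, hxV, hF, hF', hMV⟩ := hA.analytic x hx
    refine ⟨V, hxV, hV, fun y hy => ?_⟩
    by_contra hyM
    have hFy : F y ≠ 0 := fun h0 => hyM (by
      have : y ∈ M ∩ V := by
        rw [hMV]
        exact ⟨hy.1, h0⟩
      exact this.1)
    obtain ⟨z, ⟨hzV, hzF⟩, hzM⟩ := mem_closure_iff_nhds.1 hy.2 _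
      (inter_mem (hV.mem_nhds hy.1) ((hF y hy.1).continuousAt.eventually_ne hFy))
    have : z ∈ M ∩ V := ⟨hzM, hzV⟩
    rw [hMV] at this
    exact hzF this.2
  obtain ⟨U, Z, hU, hZ, rfl⟩ := this
  exact hU.measurableSet.inter hZ.measurableSet

lemma measurableSet_sheet (ξ : Space n) (σ s : ℝ) : MeasurableSet (sheet M ξ σ s) := by
  have h1 : IsOpen (Subtype.val ⁻¹' (sheet M ξ σ s) : Set M) := by
    have hc : Continuous fun x : M => gaussMap M x :=
      continuousOn_iff_continuous_domRestrict.1 hA.continuousOn_gaussMap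
    have hh : Continuous fun x : M => height M ξ x :=
      (continuous_height M ξ).comp continuous_subtype_val
    have : (Subtype.val ⁻¹' (sheet M ξ σ s) : Set M) =
        {x : M | height M ξ x < s} ∩ {x : M | 0 < σ * ⟪gaussMap M x, ξ⟫} := by
      ext x
      simp [sheet]
    rw [this]
    exact (isOpen_lt hh continuous_const).inter (isOpen_lt continuous_const (by fun_prop))
  have h2 := hA.measurableSet.subtype_image h1.measurableSet
  rwa [Subtype.image_preimage_coe, inter_eq_right.2 (fun x hx => hx.1)] at h2

/-- At two points of `M` on one line parallel to `ξ`, strict convexity gives the cosines `⟪ν, ξ⟫`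
opposite signs, so the points are on different sheets. -/
lemma injOn_proj_sheet {ξ : Space n} {ι : Space (n - 1) →ₗᵢ[ℝ] Space n} (h : IsFrame ξ ι)
    (σ s : ℝ) : InjOn (proj ι) (sheet M ξ σ s) := by
  intro x hx y hy hxy
  by_contra hne
  have e1 := h.eq_add_smul_of_proj_eq (M := M) hxy
  have p1 := hA.inner_pos hx.1 hy.1 (Ne.symm hne)
  have p2 := hA.inner_pos hy.1 hx.1 hne
  have e2 : y - x = (height M ξ y - height M ξ x) • ξ := by
    nth_rw 1 [e1]
    abel
  have e3 : x - y = -(height M ξ y - height M ξ x) • ξ := by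
    rw [neg_smul, ← e2]; abel
  rw [e2, inner_smul_left, real_inner_comm] at p1
  rw [e3, inner_smul_left, real_inner_comm] at p2
  simp only [conj_trivial] at p1 p2
  have q1 := hx.2.2
  have q2 := hy.2.2
  set u := height M ξ y - height M ξ x
  have r1 : 0 < (u * ⟪gaussMap M x, ξ⟫) * (σ * ⟪gaussMap M y, ξ⟫) := mul_pos p1 q2
  have r2 : 0 < (-u * ⟪gaussMap M y, ξ⟫) * (σ * ⟪gaussMap M x, ξ⟫) := mul_pos p2 q1
  linarith

lemma volume_proj_sheet {ξ : Space n} {ι : Space (n - 1) →ₗᵢ[ℝ] Space n} (h : IsFrame ξ ι)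
    (σ s : ℝ) : volume (proj ι '' sheet M ξ σ s) =
      ∫⁻ x in sheet M ξ σ s, ENNReal.ofReal |⟪gaussMap M x, ξ⟫| ∂(μHE[n - 1] : Measure (Space n)) :=
  volume_proj_image hA.one_le h (fun _ hx => hA.isTangent hx) (fun _ hx => hA.norm_gaussMap hx)
    hA.continuousOn_gaussMap (hA.measurableSet_sheet ξ σ s) (fun _ hx => hx.1)
    (hA.injOn_proj_sheet h σ s) fun x hx h0 => by
      have := hx.2.2
      rw [h0, mul_zero] at this
      exact this.false

lemma isClosed_slice {ξ : Space n} {c t : ℝ} (hg : IsGoodCap M ξ c) (ht : t < c) :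
    IsClosed (slice M ξ t) := by
  have : slice M ξ t = closure (convexHull ℝ M) ∩ {x | height M ξ x = t} := by
    ext x
    constructor
    · exact fun hx => ⟨subset_closure hx.1, hx.2⟩
    · rintro ⟨hx, hxt⟩
      have hxt : height M ξ x = t := hxt
      exact ⟨hA.mem_convexHull_of_mem_closure hg hx (by rw [hxt]; exact ht), hxt⟩
  rw [this]
  exact isClosed_closure.inter (isClosed_eq (continuous_height M ξ) continuous_const)

lemma volume_proj_slice {ξ : Space n} {c t : ℝ} (hg : IsGoodCap M ξ c) (ht : t < c)
    {ι : Space (n - 1) →ₗᵢ[ℝ] Space n} (h : IsFrame ξ ι) :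
    volume (proj ι '' slice M ξ t) = (μHE[n - 1] : Measure (Space n)) (slice M ξ t) := by
  rw [volume_proj_image_of_subset_hyperplane hA.one_le h.norm_eq h (by rw [h.inner_self]; exact one_ne_zero)
    (hA.isClosed_slice hg ht).measurableSet (slice_subset_hyperplane ξ t), h.inner_self]
  simp

/-- Moving from a point of the hull against `ξ` one arrives at the lower sheet. -/
lemma exists_lower {ξ q : Space n} {c : ℝ} (hg : IsGoodCap M ξ c)
    (hq : q ∈ closure (convexHull ℝ M)) (hqc : height M ξ q < c) :
    ∃ u : ℝ, 0 ≤ u ∧ q - u • ξ ∈ M := by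
  have hξ1 := hA.norm_normal hg.mem
  have hout : q + (height M ξ q + 1) • (-ξ) ∉ closure (convexHull ℝ M) := fun hin => by
    have := hA.height_nonneg hg.mem hin
    rw [height_add, inner_smul_left, inner_neg_left, real_inner_self_eq_norm_sq, hξ1] at this
    simp only [conj_trivial] at this
    linarith
  have h0 := hA.height_nonneg hg.mem hq
  obtain ⟨u, hu, hfr⟩ := isClosed_closure.exists_mem_frontier_segment hq (by linarith) hout
  refine ⟨u, hu.1, ?_⟩
  have e : q + u • (-ξ) = q - u • ξ := by rw [smul_neg, sub_eq_add_neg]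
  rw [← e]
  refine hA.mem_of_mem_frontier hg hfr ?_
  rw [height_add, inner_smul_left, inner_neg_left, real_inner_self_eq_norm_sq, hξ1]
  simp only [conj_trivial]
  linarith [hu.1]

/-- Moving from a point of the hull along `ξ` one arrives at height `s` or at `M`. -/
lemma exists_upper {ξ q : Space n} {c s : ℝ} (hg : IsGoodCap M ξ c)
    (hq : q ∈ closure (convexHull ℝ M)) (hqs : height M ξ q ≤ s) (hsc : s < c)
    (hout : q + (s - height M ξ q) • ξ ∉ convexHull ℝ M) :
    ∃ u : ℝ, 0 ≤ u ∧ q + u • ξ ∈ M ∧ height M ξ (q + u • ξ) < s := by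
  have hξ1 := hA.norm_normal hg.mem
  have hh : ∀ u : ℝ, height M ξ (q + u • ξ) = height M ξ q + u := fun u => by
    rw [height_add, inner_smul_left, real_inner_self_eq_norm_sq, hξ1]
    simp
  have hout' : q + (s - height M ξ q) • ξ ∉ closure (convexHull ℝ M) := fun hin =>
    hout (hA.mem_convexHull_of_mem_closure hg hin (by rw [hh]; linarith))
  obtain ⟨u, hu, hfr⟩ := isClosed_closure.exists_mem_frontier_segment hq (by linarith) hout'
  have hM := hA.mem_of_mem_frontier hg hfr (by rw [hh]; linarith [hu.2])
  refine ⟨u, hu.1, hM, ?_⟩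
  rw [hh]
  rcases hu.2.lt_or_eq with h | h
  · linarith
  · rw [h] at hM
    exact absurd (subset_convexHull ℝ M hM) hout

/-- A chord into the hull points to the inner side of the tangent hyperplane, so `u` and the cosine
have the same sign. -/
lemma mem_sheet_of_add_smul {ξ x : Space n} {s u σ : ℝ} (hx : x ∈ M) (hs : height M ξ x < s)
    (hu : 0 < σ * u) (hξ0 : ξ ≠ 0) (hK : x + u • ξ ∈ convexHull ℝ M) : x ∈ sheet M ξ σ s := by
  refine ⟨hx, hs, ?_⟩
  have hu0 : u ≠ 0 := by
    rintro rfl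
    simp at hu
  have := hA.inner_pos_of_mem_convexHull hx hK (by simp [hu0, hξ0])
  rw [add_sub_cancel_left, inner_smul_left, real_inner_comm] at this
  simp only [conj_trivial] at this
  have h2 := mul_pos hu this
  have h3 : σ * u * (u * ⟪gaussMap M x, ξ⟫) = u ^ 2 * (σ * ⟪gaussMap M x, ξ⟫) := by ring
  rw [h3] at h2
  exact pos_of_mul_pos_right h2 (sq_nonneg u)

/-- Flux identity: the areas of the projections of the two sheets below height `s` differ by the
area of the section at height `s`. -/
lemma volume_sheet_eq {ξ : Space n} {c s : ℝ} (hg : IsGoodCap M ξ c) (hs0 : 0 < s) (hsc : s < c)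
    {ι : Space (n - 1) →ₗᵢ[ℝ] Space n} (h : IsFrame ξ ι) :
    volume (proj ι '' sheet M ξ 1 s) =
      volume (proj ι '' sheet M ξ (-1) s) + volume (proj ι '' slice M ξ s) := by
  have hξ1 := hA.norm_normal hg.mem
  have hξ0 : ξ ≠ 0 := by
    rintro rfl
    simp at hξ1
  have hh : ∀ (q : Space n) (u : ℝ), height M ξ (q + u • ξ) = height M ξ q + u := fun q u => by
    rw [height_add, inner_smul_left, real_inner_self_eq_norm_sq, hξ1]
    simp
  have hdisj : Disjoint (proj ι '' sheet M ξ (-1) s) (proj ι '' slice M ξ s) := by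
    rw [Set.disjoint_left]
    rintro _ ⟨x, hx, rfl⟩ ⟨q, hq, hqx⟩
    have e := h.eq_add_smul_of_proj_eq (M := M) hqx.symm
    have h1 : 0 < 1 * (height M ξ q - height M ξ x) := by
      rw [hq.2]
      linarith [hx.2.1]
    have := (hA.mem_sheet_of_add_smul hx.1 hx.2.1 h1 hξ0 (by rw [← e]; exact hq.1)).2.2
    linarith [hx.2.2]
  -- The shadows match only up to the edge of the section, where it meets `M`. The shadow of the
  -- section is convex, so its boundary is null.
  have hfr : volume (frontier (proj ι '' slice M ξ s)) = 0 :=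
    ((convex_slice M ξ s).is_linear_image (proj ι).isBoundedLinearMap.toIsLinearMap).addHaar_frontier
      volume
  rw [← measure_union hdisj ((hA.isClosed_slice hg hsc).measurableSet.image_of_continuousOn_injOn
    (proj ι).continuous.continuousOn ((injOn_proj_hyperplane h (by rw [h.inner_self]; exact one_ne_zero) _).mono
      (slice_subset_hyperplane ξ s)))]
  apply le_antisymm
  -- Rising from the lower sheet, a line parallel to `ξ` either reaches height `s` inside the hull
  -- or leaves it earlier through the upper sheet.
  · apply measure_mono
    rintro _ ⟨x, hx, rfl⟩
    by_cases hin : x + (s - height M ξ x) • ξ ∈ convexHull ℝ M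
    · right
      exact ⟨_, ⟨hin, by rw [hh]; ring⟩, h.proj_add_smul _ _⟩
    left
    have hx2 := hx.2.2
    rw [one_mul, real_inner_comm] at hx2
    obtain ⟨δ, hδ, hint⟩ := hA.exists_add_smul_mem_interior hx.1 hx2
    set δ' := min δ (s - height M ξ x) with hδ'
    have hδ'0 : 0 < δ' := lt_min hδ (by linarith [hx.2.1])
    have hq := hint δ' ⟨hδ'0, min_le_left _ _⟩
    have hδ's : δ' ≤ s - height M ξ x := min_le_right _ _
    obtain ⟨u, hu0, huM, hus⟩ := hA.exists_upper hg (subset_closure (interior_subset hq))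
      (s := s) (by rw [hh]; linarith) hsc (by
        rw [hh, add_assoc, ← add_smul]
        convert hin using 4
        ring)
    refine ⟨_, hA.mem_sheet_of_add_smul (σ := -1) (u := -(δ' + u)) huM hus (by linarith) hξ0 ?_, ?_⟩
    · convert subset_convexHull ℝ M hx.1 using 1
      module
    · rw [h.proj_add_smul, h.proj_add_smul]
  · have hsub : proj ι '' sheet M ξ (-1) s ∪ proj ι '' slice M ξ s ⊆
        proj ι '' sheet M ξ 1 s ∪ frontier (proj ι '' slice M ξ s) := by
      rintro _ (⟨x, hx, rfl⟩ | ⟨q, hq, rfl⟩)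
      · left
        have hx2 : 0 < ⟪-ξ, gaussMap M x⟫ := by
          rw [inner_neg_left, real_inner_comm]
          linarith [hx.2.2]
        obtain ⟨δ, hδ, hint⟩ := hA.exists_add_smul_mem_interior hx.1 hx2
        have hq := hint δ ⟨hδ, le_rfl⟩
        have e : x + δ • (-ξ) = x + (-δ) • ξ := by module
        rw [e] at hq
        have hq1 : height M ξ (x + (-δ) • ξ) < s := by
          rw [hh]
          linarith [hx.2.1]
        obtain ⟨u, hu0, huM⟩ := hA.exists_lower hg (subset_closure (interior_subset hq))
          (by linarith)
        have e2 : x + (-δ) • ξ - u • ξ = x + (-(δ + u)) • ξ := by module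
        rw [e2] at huM
        refine ⟨_, hA.mem_sheet_of_add_smul (σ := 1) (u := δ + u) (s := s) huM ?_
          (by linarith) hξ0 ?_, h.proj_add_smul _ _⟩
        · rw [hh]
          linarith [hx.2.1]
        · convert subset_convexHull ℝ M hx.1 using 1
          module
      · obtain ⟨u, hu0, huM⟩ := hA.exists_lower hg (subset_closure hq.1) (by rw [hq.2]; exact hsc)
        rcases hu0.eq_or_lt with rfl | hu0
        -- Here `q` itself lies on `M`. Its normal is not `ξ` because `s > 0`, and not `-ξ` because
        -- the cap is proper. Moving `q` within its hyperplane against the tangential part of the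
        -- normal leaves the hull, so `q` projects to the boundary.
        · right
          rw [zero_smul, sub_zero] at huM
          refine ⟨subset_closure ⟨q, hq, rfl⟩, fun hqi => ?_⟩
          set ν := gaussMap M q with hν
          have hνn : proj ι ν ≠ 0 := by
            intro h0
            have hd := h.decomp ν
            rw [h0, map_zero, zero_add] at hd
            have habs : |⟪ν, ξ⟫| = 1 := by
              have := congrArg norm hd
              rw [norm_smul, hξ1, mul_one, hν, hA.norm_gaussMap huM] at this
              exact this.symm
            rcases (abs_eq zero_le_one).1 habs with h1 | h1
            · rw [h1, one_smul] at hd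
              have : gaussInv M ξ = q := by rw [← hd, hν, hA.gaussInv_gaussMap huM]
              have h2 := hq.2
              rw [← this, height_gaussInv] at h2
              exact hs0.ne h2
            · rw [h1] at hd
              refine hg.ne (Subset.antisymm (fun x hx => hx.1) fun m hm => ⟨hm, ?_⟩)
              have h3 := hA.inner_nonneg huM hm
              rw [← hν, hd, inner_smul_right, inner_sub_left] at h3
              have h4 := hq.2
              simp only [height] at h4
              linarith
          have hcont : Tendsto (fun t : ℝ => proj ι q + t • (-proj ι ν)) (𝓝[>] 0)
              (𝓝 (proj ι q + (0 : ℝ) • (-proj ι ν))) := by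
            apply Continuous.continuousWithinAt
            fun_prop
          rw [zero_smul, add_zero] at hcont
          obtain ⟨t, ⟨k, hk, hkt⟩, ht⟩ :=
            ((hcont.eventually (mem_interior_iff_mem_nhds.1 hqi)).and self_mem_nhdsWithin).exists
          have ht : 0 < t := ht
          have h5 : proj ι (k - q) = -(t • proj ι ν) := by
            rw [map_sub, hkt]
            module
          have h6 : k - q = ι (proj ι (k - q)) := by
            have := h.decomp (k - q)
            rwa [inner_sub_left, slice_subset_hyperplane ξ s hk, slice_subset_hyperplane ξ s hq,
              sub_self, zero_smul, add_zero] at this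
          have h7 := hA.inner_nonneg_of_mem_closure huM (subset_closure hk.1)
          rw [h6, h5, real_inner_comm, ← inner_proj_left, inner_neg_right, inner_smul_right,
            real_inner_self_eq_norm_sq] at h7
          have : 0 < ‖proj ι ν‖ := norm_pos_iff.2 hνn
          have : 0 < t * ‖proj ι ν‖ ^ 2 := by positivity
          linarith
        · left
          have e : q - u • ξ = q + (-u) • ξ := by module
          rw [e] at huM
          refine ⟨_, hA.mem_sheet_of_add_smul (σ := 1) (u := u) (s := s) huM ?_
            (by linarith) hξ0 ?_, h.proj_add_smul _ _⟩
          · rw [hh, hq.2]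
            linarith
          · convert hq.1 using 1
            module
    calc _ ≤ _ := measure_mono hsub
      _ ≤ _ := measure_union_le _ _
      _ = _ := by rw [hfr, add_zero]

end IsAdmissible

end PolyIntegrable

/-! ### Layer-cake formula and divergence theorem for the cap -/

namespace PolyIntegrable

variable {n : ℕ} {M : Set (Space n)}

/-- Layer-cake formula for the integral of a function of `h`. -/
lemma integral_comp_eq_neg_intervalIntegral {X : Type*} [MeasurableSpace X] (τ : Measure X)
    [IsFiniteMeasure τ] {h : X → ℝ} (hh : Measurable h) {c : ℝ} (hc : 0 ≤ c)
    (hτ : ∀ᵐ x ∂τ, 0 ≤ h x ∧ h x ≤ c) {F F' : ℝ → ℂ} (hF : ∀ t, HasDerivAt F (F' t) t)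
    (hF' : Continuous F') {C : ℝ} (hC : ∀ t, ‖F' t‖ ≤ C) (hFc : F c = 0) :
    ∫ x, F (h x) ∂τ = -∫ s in (0 : ℝ)..c, (τ.real {x | h x < s} : ℂ) * F' s := by
  -- As `F c = 0`, the value `F (h x)` is minus the integral of `F'` from `h x` to `c`; Fubini then
  -- brings in the measures of the sublevel sets.
  have h1 : ∫ x, F (h x) ∂τ =
      ∫ x, -∫ s in Ioc 0 c, (if h x < s then F' s else 0) ∂volume ∂τ := by
    refine integral_congr_ae ?_
    filter_upwards [hτ] with x hx
    have e1 : ∫ s in (h x)..c, F' s = F c - F (h x) :=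
      intervalIntegral.integral_eq_sub_of_hasDerivAt (fun t _ => hF t)
        (hF'.intervalIntegrable _ _)
    rw [hFc, zero_sub] at e1
    have e2 : ∫ s in Ioc 0 c, (if h x < s then F' s else 0) ∂volume = ∫ s in (h x)..c, F' s := by
      rw [intervalIntegral.integral_of_le hx.2]
      have : (fun s => if h x < s then F' s else 0) = (Ioi (h x)).indicator F' := by
        ext s
        simp [indicator, mem_Ioi]
      rw [this, setIntegral_indicator measurableSet_Ioi, Ioc_inter_Ioi, max_eq_right hx.1]
    rw [e2, e1, neg_neg]
  have hmeas : Measurable fun p : X × ℝ => if h p.1 < p.2 then F' p.2 else 0 :=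
    Measurable.ite (measurableSet_lt (hh.comp measurable_fst) measurable_snd)
      (hF'.measurable.comp measurable_snd) measurable_const
  have hint : Integrable (fun p : X × ℝ => if h p.1 < p.2 then F' p.2 else 0)
      (τ.prod (volume.restrict (Ioc 0 c))) := by
    refine Integrable.mono' (integrable_const C) hmeas.aestronglyMeasurable
      (Eventually.of_forall fun p => ?_)
    split_ifs
    · exact hC _
    · simpa using (norm_nonneg _).trans (hC 0)
  rw [h1, integral_neg, intervalIntegral.integral_of_le hc, neg_inj,
    integral_integral_swap (f := fun x s => if h x < s then F' s else 0) hint]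
  refine integral_congr_ae (Eventually.of_forall fun s => ?_)
  have : (fun x => if h x < s then F' s else 0) = {x | h x < s}.indicator fun _ => F' s := by
    ext x
    simp [indicator]
  simp only [this]
  rw [integral_indicator_const _ (measurableSet_lt hh measurable_const)]
  simp

lemma sheet_inter (ξ : Space n) (σ : ℝ) {s c : ℝ} (hs : s ≤ c) :
    {x | height M ξ x < s} ∩ sheet M ξ σ c = sheet M ξ σ s := by
  ext x
  constructor
  · rintro ⟨h1, h2⟩
    exact ⟨h2.1, h1, h2.2.2⟩
  · exact fun h => ⟨h.2.1, h.1, h.2.1.trans_le hs, h.2.2⟩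

namespace IsAdmissible

variable (hA : IsAdmissible M)
include hA

lemma measurable_indicator_cos (ξ : Space n) (σ c : ℝ) :
    AEMeasurable (fun x => |⟪gaussMap M x, ξ⟫|)
      ((μHE[n - 1] : Measure (Space n)).restrict (sheet M ξ σ c)) := by
  have h1 : ContinuousOn (fun x => |⟪gaussMap M x, ξ⟫|) (sheet M ξ σ c) :=
    ((hA.continuousOn_gaussMap.mono fun x hx => hx.1).inner continuousOn_const).abs
  exact h1.aemeasurable (hA.measurableSet_sheet ξ σ c)

/-- The integral over one sheet of a function of the height, weighted by the cosine. -/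
lemma integral_sheet {ξ : Space n} {c : ℝ} (hg : IsGoodCap M ξ c)
    {ι : Space (n - 1) →ₗᵢ[ℝ] Space n} (h : IsFrame ξ ι) (σ : ℝ)
    {F F' : ℝ → ℂ} (hF : ∀ t, HasDerivAt F (F' t) t)
    (hF' : Continuous F') {C : ℝ} (hC : ∀ t, ‖F' t‖ ≤ C) {D : ℝ} (hD : ∀ t, ‖F t‖ ≤ D)
    (hFc : F c = 0) :
    IntegrableOn (fun x => ((|⟪gaussMap M x, ξ⟫| : ℝ) : ℂ) * F (height M ξ x)) (sheet M ξ σ c)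
      (μHE[n - 1] : Measure (Space n)) ∧
    ∫ x in sheet M ξ σ c, ((|⟪gaussMap M x, ξ⟫| : ℝ) : ℂ) * F (height M ξ x)
      ∂(μHE[n - 1] : Measure (Space n)) =
      -∫ s in (0 : ℝ)..c, ((volume (proj ι '' sheet M ξ σ s)).toReal : ℂ) * F' s := by
  set μ : Measure (Space n) := μHE[n - 1]
  set B := sheet M ξ σ c
  have hBm : MeasurableSet B := hA.measurableSet_sheet ξ σ c
  set φ : Space n → ℝ := fun x => |⟪gaussMap M x, ξ⟫|
  have hφ : AEMeasurable φ (μ.restrict B) := hA.measurable_indicator_cos ξ σ c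
  -- With the cosine as density, area on the sheet becomes area of its shadow.
  set τ := (μ.restrict B).withDensity fun x => ENNReal.ofReal (φ x)
  have hτ : ∀ s ≤ c, τ {x | height M ξ x < s} = volume (proj ι '' sheet M ξ σ s) := fun s hs => by
    have hm : MeasurableSet {x | height M ξ x < s} :=
      (isOpen_lt (continuous_height M ξ) continuous_const).measurableSet
    rw [withDensity_apply _ hm, Measure.restrict_restrict hm, sheet_inter ξ σ hs,
      hA.volume_proj_sheet h]
  have hτu : τ univ = volume (proj ι '' sheet M ξ σ c) := by
    rw [withDensity_apply _ MeasurableSet.univ, Measure.restrict_univ, hA.volume_proj_sheet h]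
  have : IsFiniteMeasure τ := ⟨by rw [hτu]; exact volume_proj_sheet_lt_top hg ι σ le_rfl⟩
  have hae : ∀ᵐ x ∂τ, 0 ≤ height M ξ x ∧ height M ξ x ≤ c := by
    refine (withDensity_absolutelyContinuous _ _).ae_le ?_
    filter_upwards [ae_restrict_mem hBm] with x hx
    exact ⟨hA.height_nonneg hg.mem (subset_closure (subset_convexHull ℝ M hx.1)), hx.2.1.le⟩
  have key := integral_comp_eq_neg_intervalIntegral τ (continuous_height M ξ).measurable
    hg.pos.le hae hF hF' hC hFc
  have hFcont : Continuous F := continuous_iff_continuousAt.2 fun t => (hF t).continuousAt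
  have hfin : ∀ᵐ x ∂(μ.restrict B), ENNReal.ofReal (φ x) < ⊤ :=
    Eventually.of_forall fun x => ENNReal.ofReal_lt_top
  have hFi : Integrable (fun x => F (height M ξ x)) τ :=
    Integrable.mono' (integrable_const D)
      (hFcont.comp (continuous_height M ξ)).aestronglyMeasurable
      (Eventually.of_forall fun x => hD _)
  have e : ∀ x, (ENNReal.ofReal (φ x)).toReal • F (height M ξ x) = (φ x : ℂ) * F (height M ξ x) :=
    fun x => by rw [ENNReal.toReal_ofReal (abs_nonneg _), Complex.real_smul]
  constructor
  · have := (integrable_withDensity_iff_integrable_smul₀' hφ.ennreal_ofReal hfin).1 hFi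
    simp only [e] at this
    exact this
  · rw [integral_withDensity_eq_integral_toReal_smul₀ hφ.ennreal_ofReal hfin] at key
    simp only [e] at key
    rw [key, neg_inj]
    refine intervalIntegral.integral_congr fun s hs => ?_
    rw [uIcc_of_le hg.pos.le] at hs
    simp only [Measure.real, hτ s hs.2]

/-- The divergence theorem for a function of the height. -/
lemma integral_flux {ξ : Space n} {c : ℝ} (hg : IsGoodCap M ξ c)
    {F F' : ℝ → ℂ} (hF : ∀ t, HasDerivAt F (F' t) t)
    (hF' : Continuous F') {C : ℝ} (hC : ∀ t, ‖F' t‖ ≤ C) {D : ℝ} (hD : ∀ t, ‖F t‖ ≤ D)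
    (hFc : ∀ t, c ≤ t → F t = 0) :
    ∫ x in M, (⟪gaussMap M x, ξ⟫ : ℂ) * F (height M ξ x) ∂(μHE[n - 1] : Measure (Space n)) =
      -∫ s in (0 : ℝ)..c, (sectionVolume M (gaussInv M ξ) s : ℂ) * F' s := by
  set μ : Measure (Space n) := μHE[n - 1]
  obtain ⟨ι, h⟩ := exists_isFrame hA.one_le (hA.norm_normal hg.mem)
  obtain ⟨i₁, e₁⟩ := hA.integral_sheet hg h 1 hF hF' hC hD (hFc c le_rfl)
  obtain ⟨i₂, e₂⟩ := hA.integral_sheet hg h (-1) hF hF' hC hD (hFc c le_rfl)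
  have s₁ : ∀ x ∈ sheet M ξ 1 c, ((|⟪gaussMap M x, ξ⟫| : ℝ) : ℂ) * F (height M ξ x) =
      (⟪gaussMap M x, ξ⟫ : ℂ) * F (height M ξ x) := fun x hx => by
    have := hx.2.2
    rw [one_mul] at this
    rw [abs_of_pos this]
  have s₂ : ∀ x ∈ sheet M ξ (-1) c, ((|⟪gaussMap M x, ξ⟫| : ℝ) : ℂ) * F (height M ξ x) =
      -((⟪gaussMap M x, ξ⟫ : ℂ) * F (height M ξ x)) := fun x hx => by
    have := hx.2.2
    rw [abs_of_neg (by linarith)]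
    push_cast
    ring
  have m₁ := hA.measurableSet_sheet ξ 1 c
  have m₂ := hA.measurableSet_sheet ξ (-1) c
  -- Points whose normal is orthogonal to `ξ` are on neither sheet, but the integrand vanishes
  -- there, as it does from height `c` on.
  have hsub : ∫ x in M, (⟪gaussMap M x, ξ⟫ : ℂ) * F (height M ξ x) ∂μ =
      ∫ x in sheet M ξ 1 c ∪ sheet M ξ (-1) c, (⟪gaussMap M x, ξ⟫ : ℂ) * F (height M ξ x) ∂μ := by
    refine setIntegral_eq_of_subset_of_forall_sdiff_eq_zero hA.measurableSet
      (union_subset (fun x hx => hx.1) fun x hx => hx.1) fun x hx => ?_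
    rcases le_or_gt c (height M ξ x) with hc | hc
    · rw [hFc _ hc, mul_zero]
    · have : ⟪gaussMap M x, ξ⟫ = 0 := by
        by_contra h0
        rcases lt_or_gt_of_ne h0 with h0 | h0
        · exact hx.2 (Or.inr ⟨hx.1, hc, by linarith⟩)
        · exact hx.2 (Or.inl ⟨hx.1, hc, by linarith⟩)
      rw [this]
      simp
  have i₁' : IntegrableOn (fun x => (⟪gaussMap M x, ξ⟫ : ℂ) * F (height M ξ x))
      (sheet M ξ 1 c) μ := i₁.congr_fun s₁ m₁
  have i₂' : IntegrableOn (fun x => (⟪gaussMap M x, ξ⟫ : ℂ) * F (height M ξ x))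
      (sheet M ξ (-1) c) μ := by
    have := (i₂.congr_fun s₂ m₂).neg
    refine this.congr_fun (fun x _ => ?_) m₂
    simp
  rw [setIntegral_congr_fun m₁ s₁] at e₁
  rw [setIntegral_congr_fun m₂ s₂, integral_neg, neg_inj] at e₂
  have hd : Disjoint (sheet M ξ 1 c) (sheet M ξ (-1) c) := by
    rw [Set.disjoint_left]
    intro x h1 h2
    have := h1.2.2
    have := h2.2.2
    linarith
  have hii : ∀ σ : ℝ, IntervalIntegrable
      (fun s => ((volume (proj ι '' sheet M ξ σ s)).toReal : ℂ) * F' s) volume 0 c := fun σ => by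
    have hm : MonotoneOn (fun s => (volume (proj ι '' sheet M ξ σ s)).toReal) (uIcc 0 c) := by
      intro s hs t ht hst
      rw [uIcc_of_le hg.pos.le] at ht
      exact ENNReal.toReal_mono (volume_proj_sheet_lt_top hg ι σ ht.2).ne
        (measure_mono (image_mono fun x hx => ⟨hx.1, hx.2.1.trans_le hst, hx.2.2⟩))
    have hi : IntervalIntegrable (fun s => ((volume (proj ι '' sheet M ξ σ s)).toReal : ℂ))
        volume 0 c := 
      ⟨Integrable.ofReal (𝕜 := ℂ) hm.intervalIntegrable.1,
        Integrable.ofReal (𝕜 := ℂ) hm.intervalIntegrable.2⟩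
    exact hi.mul_continuousOn hF'.continuousOn
  rw [hsub, setIntegral_union hd m₂ i₁' i₂', e₁, e₂, neg_add_eq_sub, ← neg_sub, neg_inj,
    ← intervalIntegral.integral_sub (hii 1) (hii (-1)),
    intervalIntegral.integral_of_le hg.pos.le, intervalIntegral.integral_of_le hg.pos.le,
    integral_Ioc_eq_integral_Ioo, integral_Ioc_eq_integral_Ioo]
  refine setIntegral_congr_fun measurableSet_Ioo fun s hs => ?_
  -- The shadows of the two sheets differ by the section. The endpoints were discarded because this
  -- needs `0 < s < c`.
  have hfl := hA.volume_sheet_eq hg hs.1 hs.2 h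
  rw [hA.volume_proj_slice hg hs.2 h] at hfl
  have hfin : (μHE[n - 1] : Measure (Space n)) (slice M ξ s) ≠ ⊤ := by
    intro htop
    rw [htop, add_top] at hfl
    exact (volume_proj_sheet_lt_top hg ι 1 hs.2.le).ne hfl
  rw [sectionVolume_eq hg.mem, Measure.real, hfl,
    ENNReal.toReal_add (volume_proj_sheet_lt_top hg ι (-1) hs.2.le).ne hfin]
  push_cast
  ring

end IsAdmissible

lemma fderiv_planeWave (ξ : Space n) (l : ℝ) (x v : Space n) :
    fderiv ℝ (planeWave ξ l) x v =
      Complex.I * l * (⟪v, ξ⟫ : ℝ) * planeWave ξ l x := by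
  have h1 : HasFDerivAt (fun x : Space n => ((⟪ξ, x⟫ : ℝ) : ℂ))
      (Complex.ofRealCLM.comp (innerSL ℝ ξ)) x :=
    (Complex.ofRealCLM.comp (innerSL ℝ ξ)).hasFDerivAt
  have h2 := (h1.const_mul (Complex.I * l)).cexp
  have : fderiv ℝ (planeWave ξ l) x = _ := h2.fderiv
  rw [this]
  simp only [smul_apply, ContinuousLinearMap.comp_apply, Complex.ofRealCLM_apply,
    innerSL_apply_apply, smul_eq_mul, planeWave]
  rw [real_inner_comm ξ v]
  ring

/-- The one-dimensional amplitude `exp(i l t) ρ(t)`. -/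
noncomputable def amplitude (ρ : ℝ → ℝ) (l t : ℝ) : ℂ := Complex.exp (Complex.I * l * t) * ρ t

lemma contDiff_amplitude {ρ : ℝ → ℝ} (hρ : ContDiff ℝ ∞ ρ) (l : ℝ) :
    ContDiff ℝ ∞ (amplitude ρ l) := by
  unfold amplitude
  have h1 : ContDiff ℝ ∞ fun t : ℝ => (t : ℂ) := Complex.ofRealCLM.contDiff
  have h2 : ContDiff ℝ ∞ fun t : ℝ => (ρ t : ℂ) := Complex.ofRealCLM.contDiff.comp hρ
  exact (contDiff_const.mul h1).cexp.mul h2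

namespace IsCutoff

variable {ρ : ℝ → ℝ} {c : ℝ} (hρ : IsCutoff ρ c)
include hρ

lemma hasCompactSupport : HasCompactSupport ρ :=
  (isCompact_Icc (a := -c) (b := c)).of_isClosed_subset (isClosed_tsupport ρ)
    (hρ.2.2.trans Ioo_subset_Icc_self)

lemma eq_zero {t : ℝ} (ht : c ≤ t) : ρ t = 0 := by
  by_contra h
  exact absurd (hρ.2.2 (subset_tsupport ρ h)).2 (not_lt.2 ht)

end IsCutoff

/-- The oscillating integral in terms of the volumes of the sections. -/
lemma IsAdmissible.oscIntegral_eq (hA : IsAdmissible M) {ξ : Space n} {c : ℝ}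
    (hg : IsGoodCap M ξ c) {ρ : ℝ → ℝ} (hρ : IsCutoff ρ c) (l : ℝ) :
    oscIntegral M ρ ξ l = -(phase M ξ l * (Complex.I * l) *
      ∫ s in (0 : ℝ)..c, (sectionVolume M (gaussInv M ξ) s : ℂ) * deriv (amplitude ρ l) s) := by
  have hsm := contDiff_amplitude hρ.1 l
  have hcs : HasCompactSupport (amplitude ρ l) := by
    refine hρ.hasCompactSupport.mono fun t ht => ?_
    intro h0
    exact ht (by simp [amplitude, h0])
  have hdc : Continuous (deriv (amplitude ρ l)) := hsm.continuous_deriv (by simp)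
  obtain ⟨C, hC⟩ := hdc.bounded_above_of_compact_support hcs.deriv
  obtain ⟨D, hD⟩ := hsm.continuous.bounded_above_of_compact_support hcs
  have key := hA.integral_flux hg
    (fun t => (hsm.differentiable (by simp) t).hasDerivAt) hdc hC hD
    (fun t ht => by simp [amplitude, hρ.eq_zero ht])
  rw [neg_mul_eq_mul_neg, ← key, ← integral_const_mul]
  unfold oscIntegral
  refine integral_congr_ae (Eventually.of_forall fun x => ?_)
  simp only [fderiv_planeWave]
  have e : planeWave ξ l x = phase M ξ l * Complex.exp (Complex.I * l * height M ξ x) := by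
    unfold planeWave phase height
    rw [← Complex.exp_add, real_inner_comm x ξ]
    congr 1
    push_cast
    ring
  rw [e]
  unfold amplitude
  rw [show ⟪x, ξ⟫ - supp M ξ = height M ξ x from rfl]
  ring

end PolyIntegrable

/-! ### Analyticity of parametric integrals and implicit functions -/

namespace PolyIntegrable

section ParametricIntegral

variable {E V X : Type*} [NormedAddCommGroup E] [NormedSpace ℝ E] [NormedAddCommGroup V]
  [NormedSpace ℝ V] [TopologicalSpace X] [MeasurableSpace X] [OpensMeasurableSpace X]
  [SecondCountableTopology X]

open scoped NNReal ENNReal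

/-- The integral, over a small set of parameters, of an analytic function is analytic. -/
lemma exists_analyticAt_setIntegral (μ : Measure X) [IsFiniteMeasure μ] {j : X → V}
    (hj : Continuous j) {f : E × V → ℝ} {z₀ : E} {x₀ : X} (hf : AnalyticAt ℝ f (z₀, j x₀)) :
    ∃ S : Set X, IsOpen S ∧ x₀ ∈ S ∧ ∀ T ⊆ S, MeasurableSet T →
      (∀ᶠ z in 𝓝 z₀, IntegrableOn (fun x => f (z, j x)) T μ) ∧
      AnalyticAt ℝ (fun z => ∫ x in T, f (z, j x) ∂μ) z₀ := by
  obtain ⟨p, r, hp⟩ := hf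
  obtain ⟨a, ha0, ha⟩ : ∃ a : ℝ≥0, 0 < a ∧ ((a + a : ℝ≥0) : ℝ≥0∞) < r := by
    obtain ⟨b, hb0, hb⟩ := ENNReal.lt_iff_exists_nnreal_btwn.1 hp.r_pos
    refine ⟨b / 2, by simpa using hb0, by rwa [add_halves]⟩
  have hrad : (a + a : ℝ≥0∞) < p.radius := by
    rw [ENNReal.coe_add] at ha
    exact ha.trans_le hp.r_le
  have har : (a : ℝ≥0∞) < p.radius := lt_of_le_of_lt le_self_add hrad
  have hsum := p.changeOriginSeries_summable_aux₁ hrad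
  -- `B k` bounds the `k`-th coefficient after recentring by at most `a` in the second variable.
  -- Room for two radii `a` inside the radius of convergence makes the sum of `B k * a ^ k` finite.
  set B : ℕ → ℝ≥0 := fun k =>
    ∑' s : Σ l : ℕ, { s : Finset (Fin (k + l)) // s.card = l }, ‖p (k + s.1)‖₊ * a ^ s.1 with hB
  have hBs : Summable fun k => B k * a ^ k := by
    have := (NNReal.summable_sigma.1 hsum).2
    refine this.congr fun k => ?_
    rw [hB]
    simp only
    rw [NNReal.tsum_mul_right]
  have hco : ∀ v : V, ‖v‖₊ ≤ a → ∀ k, ‖p.changeOrigin (0, v) k‖₊ ≤ B k := by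
    intro v hv k
    have hnorm : ‖((0, v) : E × V)‖₊ = ‖v‖₊ := by simp [Prod.nnnorm_def]
    refine (p.nnnorm_changeOrigin_le k ?_).trans ?_
    · rw [hnorm]
      exact lt_of_le_of_lt (by exact_mod_cast hv) har
    · rw [hnorm]
      refine Summable.tsum_le_tsum (fun s => by gcongr) ?_ (p.changeOriginSeries_summable_aux₂ har k)
      exact NNReal.summable_of_le (fun s => by gcongr) (p.changeOriginSeries_summable_aux₂ har k)
  set L : E →L[ℝ] E × V := ContinuousLinearMap.inl ℝ E V
  set q : X → FormalMultilinearSeries ℝ E ℝ := fun x =>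
    (p.changeOrigin (0, j x - j x₀)).compContinuousLinearMap L
  set S : Set X := {x | ‖j x - j x₀‖₊ < a}
  have hSo : IsOpen S := isOpen_lt (by fun_prop) continuous_const
  have hqB : ∀ x ∈ S, ∀ k, ‖q x k‖ ≤ B k := by
    intro x hx k
    calc ‖q x k‖ ≤ ‖p.changeOrigin (0, j x - j x₀) k‖ * ∏ _i : Fin k, ‖L‖ :=
          ContinuousMultilinearMap.norm_compContinuousLinearMap_le _ _
      _ ≤ B k * 1 := by
          gcongr
          · exact_mod_cast hco _ (le_of_lt hx) k
          · exact Finset.prod_le_one (fun _ _ => norm_nonneg _)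
              fun _ _ => ContinuousLinearMap.norm_inl_le_one ℝ E V
      _ = B k := mul_one _
  have hq : ∀ x ∈ S, ∀ w : E, ‖w‖₊ < a → HasSum (fun k => q x k fun _ => w) (f (z₀ + w, j x)) := by
    intro x hx w hw
    have hx : ‖j x - j x₀‖₊ < a := hx
    have hnorm : ‖((0, j x - j x₀) : E × V)‖₊ = ‖j x - j x₀‖₊ := by simp [Prod.nnnorm_def]
    have h1 := hp.changeOrigin (y := (0, j x - j x₀)) (by
      rw [hnorm]
      refine lt_of_le_of_lt ?_ ha
      exact_mod_cast hx.le.trans le_self_add)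
    have h2 := h1.hasSum (y := (w, 0)) (by
      rw [mem_eball_zero_iff, hnorm, lt_tsub_iff_right]
      have : ‖((w, 0) : E × V)‖ₑ = ‖w‖ₑ := by simp [enorm, Prod.nnnorm_def]
      rw [this]
      refine lt_trans ?_ ha
      rw [enorm_eq_nnnorm, ← ENNReal.coe_add, ENNReal.coe_lt_coe]
      exact add_lt_add hw hx)
    have e : ((z₀, j x₀) + (0, j x - j x₀) + (w, 0) : E × V) = (z₀ + w, j x) := by simp
    rw [e] at h2
    exact h2
  have hqc : ∀ k, ContinuousOn (fun x => q x k) S := by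
    intro k
    have h1 := (p.hasFPowerSeriesOnBall_changeOrigin k
      (lt_of_le_of_lt (zero_le) hrad)).continuousOn
    have h2 : ContinuousOn (fun x => p.changeOrigin (0, j x - j x₀) k) S :=
      h1.comp (f := fun x => ((0, j x - j x₀) : E × V)) (by fun_prop) fun x hx => by
        rw [mem_eball_zero_iff]
        have : ‖((0, j x - j x₀) : E × V)‖ₑ = ‖j x - j x₀‖ₑ := by simp [enorm, Prod.nnnorm_def]
        rw [this, enorm_eq_nnnorm]
        refine lt_trans ?_ har
        rw [ENNReal.coe_lt_coe]
        exact hx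
    exact (ContinuousMultilinearMap.compContinuousLinearMapL (𝕜 := ℝ) (F := ℝ)
      (fun _ : Fin k => L)).continuous.comp_continuousOn h2
  refine ⟨S, hSo, by simp [S, ha0], fun T hTS hT => ?_⟩
  have hTf : μ T < ⊤ := measure_lt_top μ T
  have hqi : ∀ k, IntegrableOn (fun x => q x k) T μ := fun k =>
    Integrable.mono' (integrable_const (B k : ℝ))
      (((hqc k).mono hTS).aestronglyMeasurable hT)
      (by filter_upwards [ae_restrict_mem hT] with x hx using hqB x (hTS hx) k)
  -- The series of the integral is obtained by integrating the recentred series term by term; the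
  -- bounds `B k` dominate it.
  set Q : FormalMultilinearSeries ℝ E ℝ := fun k => ∫ x in T, q x k ∂μ with hQ
  have hQn : ∀ k, ‖Q k‖ ≤ B k * μ.real T := fun k =>
    norm_setIntegral_le_of_norm_le_const hTf fun x hx => hqB x (hTS hx) k
  have hball : ∀ᶠ z in 𝓝 z₀, ‖z - z₀‖₊ < a := by
    have : ContinuousAt (fun z => ‖z - z₀‖₊) z₀ := by fun_prop
    refine this.eventually (gt_mem_nhds ?_)
    simpa using ha0
  have hmain : ∀ w : E, ‖w‖₊ < a → IntegrableOn (fun x => f (z₀ + w, j x)) T μ ∧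
      HasSum (fun k => Q k fun _ => w) (∫ x in T, f (z₀ + w, j x) ∂μ) := by
    intro w hw
    have hBs' : Summable fun k => ((B k : ℝ) * (a : ℝ) ^ k) := by exact_mod_cast hBs
    have hterm : ∀ k, ∀ x ∈ S, ‖q x k fun _ => w‖ ≤ B k * (a : ℝ) ^ k := fun k x hx => by
      refine ((q x k).le_opNorm _).trans ?_
      rw [Finset.prod_const, Finset.card_univ, Fintype.card_fin]
      gcongr
      · exact hqB x hx k
      · exact_mod_cast hw.le
    have hmeas : ∀ k, AEStronglyMeasurable (fun x => q x k fun _ => w) (μ.restrict T) := fun k =>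
      ((ContinuousMultilinearMap.apply ℝ (fun _ : Fin k => E) ℝ fun _ => w).continuous.comp_continuousOn
        ((hqc k).mono hTS)).aestronglyMeasurable hT
    have hS := hasSum_integral_of_dominated_convergence (μ := μ.restrict T)
      (F := fun k x => q x k fun _ => w) (f := fun x => f (z₀ + w, j x))
      (fun k _ => B k * (a : ℝ) ^ k) hmeas
      (fun k => by filter_upwards [ae_restrict_mem hT] with x hx using hterm k x (hTS hx))
      (Eventually.of_forall fun _ => hBs') (integrable_const _)
      (by filter_upwards [ae_restrict_mem hT] with x hx using hq x (hTS hx) w hw)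
    constructor
    · have hm : AEStronglyMeasurable (fun x => f (z₀ + w, j x)) (μ.restrict T) := by
        refine aestronglyMeasurable_of_tendsto_ae (u := atTop)
          (f := fun (N : ℕ) x => ∑ k ∈ Finset.range N, q x k fun _ => w)
          (fun N => ?_) (by
          filter_upwards [ae_restrict_mem hT] with x hx using (hq x (hTS hx) w hw).tendsto_sum_nat)
        exact Finset.aestronglyMeasurable_fun_sum _ fun k _ => hmeas k
      refine Integrable.mono' (integrable_const (∑' k, (B k : ℝ) * (a : ℝ) ^ k)) hm ?_
      filter_upwards [ae_restrict_mem hT] with x hx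
      rw [← (hq x (hTS hx) w hw).tsum_eq]
      exact tsum_of_norm_bounded hBs'.hasSum fun k => hterm k x (hTS hx)
    · have e : (fun k => Q k fun _ => w) = fun k => ∫ x in T, q x k (fun _ => w) ∂μ :=
        funext fun k => ((ContinuousMultilinearMap.apply ℝ (fun _ : Fin k => E) ℝ
          fun _ => w).integral_comp_comm (hqi k)).symm
      rw [e]
      exact hS
  constructor
  · filter_upwards [hball] with z hz
    simpa using (hmain (z - z₀) hz).1
  · refine ⟨Q, a, ?_, by exact_mod_cast ha0, ?_⟩
    · refine Q.le_radius_of_summable_norm ?_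
      have : Summable fun k => ((B k : ℝ) * (a : ℝ) ^ k) * μ.real T := by
        have hBs' : Summable fun k => ((B k : ℝ) * (a : ℝ) ^ k) := by exact_mod_cast hBs
        exact hBs'.mul_right _
      refine Summable.of_nonneg_of_le (fun k => by positivity) (fun k => ?_) this
      have := hQn k
      calc ‖Q k‖ * (a : ℝ) ^ k ≤ (B k * μ.real T) * (a : ℝ) ^ k := by gcongr
        _ = _ := by ring
    · intro w hw
      rw [mem_eball_zero_iff, enorm_eq_nnnorm, ENNReal.coe_lt_coe] at hw
      exact (hmain w hw).2

/-- The integral over a compact space of parameters of an analytic function is analytic. -/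
lemma analyticAt_integral [CompactSpace X] (μ : Measure X) [IsFiniteMeasure μ] {j : X → V}
    (hj : Continuous j) {f : E × V → ℝ} {z₀ : E} (hf : ∀ x, AnalyticAt ℝ f (z₀, j x)) :
    AnalyticAt ℝ (fun z => ∫ x, f (z, j x) ∂μ) z₀ := by
  have key : ∃ S : Set X, univ ⊆ S ∧ MeasurableSet S ∧ ∀ T ⊆ S, MeasurableSet T →
      (∀ᶠ z in 𝓝 z₀, IntegrableOn (fun x => f (z, j x)) T μ) ∧
      AnalyticAt ℝ (fun z => ∫ x in T, f (z, j x) ∂μ) z₀ := by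
    refine isCompact_univ.induction_on (p := fun A : Set X => ∃ S : Set X, A ⊆ S ∧
      MeasurableSet S ∧ ∀ T ⊆ S, MeasurableSet T →
      (∀ᶠ z in 𝓝 z₀, IntegrableOn (fun x => f (z, j x)) T μ) ∧
      AnalyticAt ℝ (fun z => ∫ x in T, f (z, j x) ∂μ) z₀) ?_ ?_ ?_ ?_
    · refine ⟨∅, Subset.rfl, MeasurableSet.empty, fun T hT _ => ?_⟩
      rw [subset_empty_iff.1 hT]
      simp [analyticAt_const]
    · rintro A A' hA ⟨S, hS, h⟩
      exact ⟨S, hA.trans hS, h⟩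
    · rintro A A' ⟨S, hS, hSm, h⟩ ⟨S', hS', hSm', h'⟩
      refine ⟨S ∪ S', union_subset_union hS hS', hSm.union hSm', fun T hT hTm => ?_⟩
      -- The property is asked of all measurable subsets so that overlapping pieces can be cut into
      -- disjoint ones.
      obtain ⟨i₁, a₁⟩ := h (T ∩ S) inter_subset_right (hTm.inter hSm)
      obtain ⟨i₂, a₂⟩ := h' (T \ S) (fun x hx => (hT hx.1).resolve_left hx.2) (hTm.diff hSm)
      have e : T ∩ S ∪ T \ S = T := inter_union_sdiff T S
      refine ⟨?_, (a₁.add a₂).congr ?_⟩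
      · filter_upwards [i₁, i₂] with z h₁ h₂
        rw [← e]
        exact h₁.union h₂
      · filter_upwards [i₁, i₂] with z h₁ h₂
        simp only [Pi.add_apply]
        rw [← setIntegral_union (disjoint_sdiff_right.mono_left inter_subset_right)
          (hTm.diff hSm) h₁ h₂, e]
    · intro x _
      obtain ⟨S, hSo, hxS, h⟩ := exists_analyticAt_setIntegral μ hj (hf x)
      exact ⟨S, mem_nhdsWithin_of_mem_nhds (hSo.mem_nhds hxS), S, Subset.rfl,
        hSo.measurableSet, h⟩
  obtain ⟨S, hS, -, h⟩ := key
  simpa using (h univ hS MeasurableSet.univ).2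

end ParametricIntegral

/-- The scalar analytic implicit function theorem. -/
lemma exists_analyticAt_implicit {E : Type*} [NormedAddCommGroup E] [NormedSpace ℝ E]
    [CompleteSpace E] {Φ : E × ℝ → ℝ} {w₀ : E} {r₀ d : ℝ} (hΦ : AnalyticAt ℝ Φ (w₀, r₀))
    (h0 : Φ (w₀, r₀) = 0) (hd : HasDerivAt (fun r => Φ (w₀, r)) d r₀) (hd0 : d ≠ 0) :
    ∃ φ : E → ℝ, AnalyticAt ℝ φ w₀ ∧ φ w₀ = r₀ ∧ ∀ᶠ w in 𝓝 w₀, Φ (w, φ w) = 0 := by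
  -- The differentiability index `ω` means analyticity, so the implicit function theorem for this
  -- index returns an analytic solution.
  have hc : ContDiffAt ℝ ω Φ (w₀, r₀) := hΦ.contDiffAt
  have hD : (fderiv ℝ Φ (w₀, r₀) ∘L ContinuousLinearMap.inr ℝ E ℝ) =
      ContinuousLinearMap.toSpanSingleton ℝ d := by
    ext
    have h1 : HasDerivAt (fun r : ℝ => (w₀, r)) ((0 : E), (1 : ℝ)) r₀ :=
      (hasDerivAt_const r₀ w₀).prodMk (hasDerivAt_id r₀)
    have h2 := hΦ.differentiableAt.hasFDerivAt.comp_hasDerivAt r₀ h1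
    simpa using h2.unique hd
  have hinv : (fderiv ℝ Φ (w₀, r₀) ∘L ContinuousLinearMap.inr ℝ E ℝ).IsInvertible := by
    rw [hD]
    refine ⟨ContinuousLinearEquiv.unitsEquivAut ℝ (Units.mk0 d hd0), ?_⟩
    ext
    simp
  refine ⟨hc.implicitFunction (by simp) hinv, ?_, hc.implicitFunction_apply_self _ hinv, ?_⟩
  · exact (hc.contDiffAt_implicitFunction (by simp) hinv).analyticAt
  · filter_upwards [hc.eventually_apply_implicitFunction (by simp) hinv] with w hw
    rw [hw, h0]

end PolyIntegrable

/-! ### Polar coordinates and homogeneous extension -/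

namespace PolyIntegrable

/-- Volume of a set which is star shaped about the origin, in polar coordinates. -/
lemma volumeReal_of_radial {m : ℕ} (hm : 1 ≤ m) {T : Set (Space m)} (hT : MeasurableSet T)
    {r : Space m → ℝ} (hr : ∀ θ ∈ Metric.sphere (0 : Space m) 1, 0 < r θ)
    (hTr : ∀ θ ∈ Metric.sphere (0 : Space m) 1, ∀ s, 0 < s → (s • θ ∈ T ↔ s ≤ r θ)) :
    volume.real T =
      ∫ θ : Metric.sphere (0 : Space m) 1, r θ ^ m / m ∂(volume : Measure (Space m)).toSphere := by
  have : Nonempty (Fin m) := ⟨⟨0, hm⟩⟩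
  have hdim : Module.finrank ℝ (Space m) = m := by simp
  set T' : Set (({0}ᶜ : Set (Space m))) := Subtype.val ⁻¹' T with hT'
  set S : Set (Metric.sphere (0 : Space m) 1 × Ioi (0 : ℝ)) :=
    (homeomorphUnitSphereProd (Space m)).symm ⁻¹' T' with hS
  have hSm : MeasurableSet S :=
    (homeomorphUnitSphereProd (Space m)).symm.measurable (measurable_subtype_coe hT)
  have hvol : volume T = ((volume : Measure (Space m)).toSphere.prod
      (Measure.volumeIoiPow (m - 1))) S := by
    have h := ((volume : Measure (Space m)).measurePreserving_homeomorphUnitSphereProd).measure_preimage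
      hSm.nullMeasurableSet
    rw [hdim] at h
    rw [← h, hS, ← preimage_comp, Homeomorph.symm_comp_self, preimage_id,
      comap_subtype_coe_apply (measurableSet_singleton _).compl, hT', Subtype.image_preimage_coe,
      inter_comm]
    exact (measure_sdiff_null (measure_singleton (0 : Space m))).symm
  have hslice : ∀ θ : Metric.sphere (0 : Space m) 1,
      Measure.volumeIoiPow (m - 1) (Prod.mk θ ⁻¹' S) = ENNReal.ofReal (r θ ^ m / m) := by
    intro θ
    have e : Prod.mk θ ⁻¹' S = Iic (⟨r θ, hr θ θ.2⟩ : Ioi (0 : ℝ)) := by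
      ext s
      rw [mem_Iic, ← Subtype.coe_le_coe, ← hTr θ θ.2 s s.2]
      rfl
    have e2 : Measure.volumeIoiPow (m - 1) (Iic (⟨r θ, hr θ θ.2⟩ : Ioi (0 : ℝ))) =
        Measure.volumeIoiPow (m - 1) (Iio (⟨r θ, hr θ θ.2⟩ : Ioi (0 : ℝ))) := by
      refine measure_congr (Iio_ae_eq_Iic' ?_).symm
      refine withDensity_absolutelyContinuous _ _ ?_
      rw [comap_subtype_coe_apply measurableSet_Ioi, image_singleton, measure_singleton]
    rw [e, e2, Measure.volumeIoiPow_apply_Iio]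
    have : m - 1 + 1 = m := by omega
    have h2 : ((m - 1 : ℕ) : ℝ) + 1 = m := by exact_mod_cast this
    rw [this, h2]
  have hmeas := measurable_measure_prodMk_left (ν := Measure.volumeIoiPow (m - 1)) hSm
  rw [Measure.real, hvol, Measure.prod_apply hSm, ← integral_toReal hmeas.aemeasurable]
  · refine integral_congr_ae (Eventually.of_forall fun θ => ?_)
    have := (hr θ θ.2).le
    simp only [hslice θ]
    rw [ENNReal.toReal_ofReal (by positivity)]
  · exact Eventually.of_forall fun θ => by simp only [hslice θ]; exact ENNReal.ofReal_lt_top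

variable {n : ℕ}

lemma analyticAt_normalize {w : Space n} (hw : w ≠ 0) :
    AnalyticAt ℝ (fun w : Space n => ‖w‖⁻¹ • w) w := by
  have h1 : AnalyticAt ℝ (fun w : Space n => ‖w‖) w := (contDiffAt_norm ℝ hw).analyticAt
  exact (h1.inv (norm_ne_zero_iff.2 hw)).smul analyticAt_id

lemma norm_normalize {w : Space n} (hw : w ≠ 0) : ‖‖w‖⁻¹ • w‖ = 1 := by
  rw [norm_smul, norm_inv, norm_norm, inv_mul_cancel₀ (norm_ne_zero_iff.2 hw)]

lemma IsOpenInSphere.isOpen_coneOver {U : Set (Space n)} (hU : IsOpenInSphere U) :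
    IsOpen (coneOver U) := by
  obtain ⟨W, hW, rfl⟩ := hU
  have hc : ContinuousOn (fun w : Space n => ‖w‖⁻¹ • w) {0}ᶜ := fun w hw =>
    (analyticAt_normalize hw).continuousAt.continuousWithinAt
  convert hc.isOpen_inter_preimage isOpen_compl_singleton hW using 1
  ext w
  constructor
  · exact fun h => ⟨h.1, h.2.1⟩
  · exact fun h => ⟨h.1, h.2, by simpa using norm_normalize h.1⟩

lemma mem_coneOver_of_norm_eq_one {U : Set (Space n)} {ξ : Space n} (hξ : ‖ξ‖ = 1) :
    ξ ∈ coneOver U ↔ ξ ∈ U := by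
  have h0 : ξ ≠ 0 := by
    rintro rfl
    simp at hξ
  simp [coneOver, hξ, h0]

namespace IsAdmissible

variable {M : Set (Space n)} (hA : IsAdmissible M)
include hA

/-- Composition with the normalisation turns analyticity relative to a subset of the sphere into
analyticity on an open cone of `ℝⁿ`. -/
lemma analyticAt_gaussInv_normalize {w : Space n} (hw : w ∈ coneOver (normals M)) :
    AnalyticAt ℝ (fun w => gaussInv M (‖w‖⁻¹ • w)) w := by
  have h1 : AnalyticWithinAt ℝ (fun w : Space n => ‖w‖⁻¹ • w) (coneOver (normals M)) w :=
    (analyticAt_normalize hw.1).analyticWithinAt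
  have h2 : AnalyticWithinAt ℝ (gaussInv M ∘ fun w : Space n => ‖w‖⁻¹ • w)
      (coneOver (normals M)) w :=
    AnalyticWithinAt.comp_of_eq (hA.gauss.2.2.2 _ hw.2) h1 (fun v hv => hv.2) rfl
  exact (h2.contDiffWithinAt.contDiffAt
    (hA.gauss.2.1.isOpen_coneOver.mem_nhds hw) : ContDiffAt ℝ ω _ w).analyticAt

lemma analyticAt_supp_normalize {w : Space n} (hw : w ∈ coneOver (normals M)) :
    AnalyticAt ℝ (fun w => supp M (‖w‖⁻¹ • w)) w := by
  have h1 := hA.analyticAt_gaussInv_normalize hw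
  have h2 := analyticAt_normalize hw.1
  exact ((h1.contDiffAt (n := ω)).inner ℝ (h2.contDiffAt (n := ω))).analyticAt

end IsAdmissible

end PolyIntegrable

/-! ### The radial function and analyticity of the section volume -/

namespace PolyIntegrable

variable {n : ℕ} {M : Set (Space n)}

/-- The point at height `t` over the tangent hyperplane with normal `w/|w|`, which projects along
`e` to the point with coordinate `y` relative to `q`. -/
noncomputable def sectionPoint (M : Set (Space n)) (e q : Space n)
    (ι : Space (n - 1) →ₗᵢ[ℝ] Space n) (p : (Space n × ℝ) × Space (n - 1)) : Space n :=
  q + ι p.2 - ((height M (‖p.1.1‖⁻¹ • p.1.1) (q + ι p.2) - p.1.2) / ⟪e, ‖p.1.1‖⁻¹ • p.1.1⟫) • e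

lemma analyticAt_comp_fst_fst {G Y : Type*} [NormedAddCommGroup G] [NormedSpace ℝ G]
    [NormedAddCommGroup Y] [NormedSpace ℝ Y] {g : Space n → G} {w : Space n}
    (hg : AnalyticAt ℝ g w) (t : ℝ) (y : Y) :
    AnalyticAt ℝ (fun p : (Space n × ℝ) × Y => g p.1.1) ((w, t), y) := by
  have h1 : AnalyticAt ℝ (fun p : (Space n × ℝ) × Y => p.1.1) ((w, t), y) :=
    AnalyticAt.fun_comp (g := Prod.fst) (f := Prod.fst) analyticAt_fst analyticAt_fst
  exact AnalyticAt.fun_comp (g := g) (f := fun p : (Space n × ℝ) × Y => p.1.1) hg h1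

section sectionPoint

variable {e q : Space n} {ι : Space (n - 1) →ₗᵢ[ℝ] Space n}

lemma height_sectionPoint {w : Space n} (he : ⟪e, ‖w‖⁻¹ • w⟫ ≠ 0) (t : ℝ) (y : Space (n - 1)) :
    height M (‖w‖⁻¹ • w) (sectionPoint M e q ι ((w, t), y)) = t := by
  rw [sectionPoint, sub_eq_add_neg, height_add, inner_neg_left, inner_smul_left]
  simp only [conj_trivial]
  rw [div_mul_cancel₀ _ he]
  ring

/-- For a fixed section the parametrisation is affine in `y`, so rays in coordinates are rays in the
section. -/
lemma sectionPoint_smul (z : Space n × ℝ) (s : ℝ) (y : Space (n - 1)) :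
    sectionPoint M e q ι (z, s • y) = sectionPoint M e q ι (z, 0) +
      s • (sectionPoint M e q ι (z, y) - sectionPoint M e q ι (z, 0)) := by
  simp only [sectionPoint, height_add, map_smul, map_zero, add_zero, inner_smul_left,
    conj_trivial]
  module

lemma proj_sectionPoint (h : IsFrame e ι) (p : (Space n × ℝ) × Space (n - 1)) :
    proj ι (sectionPoint M e q ι p) = proj ι q + p.2 := by
  rw [sectionPoint, map_sub, map_add, map_smul, h.proj_self, proj_apply_self, smul_zero, sub_zero]

lemma eq_sectionPoint (h : IsFrame e ι) {w x : Space n} (he : ⟪e, ‖w‖⁻¹ • w⟫ ≠ 0) :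
    x = sectionPoint M e q ι ((w, height M (‖w‖⁻¹ • w) x), proj ι x - proj ι q) := by
  have h1 := injOn_proj_hyperplane h (ξ := ‖w‖⁻¹ • w) (by rwa [real_inner_comm])
    (height M (‖w‖⁻¹ • w) x + supp M (‖w‖⁻¹ • w))
  refine h1 (height_eq_iff.1 rfl) (height_eq_iff.1 (height_sectionPoint he _ _)) ?_
  rw [proj_sectionPoint h, add_sub_cancel]

lemma sectionPoint_self (h : IsFrame e ι) {w : Space n} (hw : ‖w‖⁻¹ • w = e) {t : ℝ}
    (hq : height M e q = t) (y : Space (n - 1)) :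
    sectionPoint M e q ι ((w, t), y) = q + ι y := by
  simp [sectionPoint, hw, height_add, hq, h.inner_eq]

lemma IsAdmissible.analyticAt_sectionPoint (hA : IsAdmissible M) {w : Space n}
    (hw : w ∈ coneOver (normals M)) (he : ⟪e, ‖w‖⁻¹ • w⟫ ≠ 0) (t : ℝ) (y : Space (n - 1)) :
    AnalyticAt ℝ (sectionPoint M e q ι) ((w, t), y) := by
  have ht : AnalyticAt ℝ (fun p : (Space n × ℝ) × Space (n - 1) => p.1.2) ((w, t), y) :=
    AnalyticAt.fun_comp (g := Prod.snd) (f := Prod.fst) analyticAt_snd analyticAt_fst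
  have hy : AnalyticAt ℝ (fun p : (Space n × ℝ) × Space (n - 1) => p.2) ((w, t), y) :=
    analyticAt_snd
  have hN := analyticAt_comp_fst_fst (analyticAt_normalize hw.1) t y
  have hs := analyticAt_comp_fst_fst (hA.analyticAt_supp_normalize hw) t y
  have hι : AnalyticAt ℝ (fun p : (Space n × ℝ) × Space (n - 1) => q + ι p.2) ((w, t), y) :=
    analyticAt_const.add (AnalyticAt.fun_comp (g := fun y => ι y)
      (f := fun p : (Space n × ℝ) × Space (n - 1) => p.2)
      (ι.toContinuousLinearMap.analyticAt y) hy)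
  have hi : AnalyticAt ℝ (fun p : (Space n × ℝ) × Space (n - 1) =>
      ⟪q + ι p.2, ‖p.1.1‖⁻¹ • p.1.1⟫) ((w, t), y) :=
    ((hι.contDiffAt (n := ω)).inner ℝ (hN.contDiffAt (n := ω))).analyticAt
  have hd : AnalyticAt ℝ (fun p : (Space n × ℝ) × Space (n - 1) =>
      ⟪e, ‖p.1.1‖⁻¹ • p.1.1⟫) ((w, t), y) :=
    ((contDiffAt_const (n := ω)).inner ℝ (hN.contDiffAt (n := ω))).analyticAt
  have hσ : AnalyticAt ℝ (fun p : (Space n × ℝ) × Space (n - 1) =>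
      ((⟪q + ι p.2, ‖p.1.1‖⁻¹ • p.1.1⟫ - supp M (‖p.1.1‖⁻¹ • p.1.1) - p.1.2) /
        ⟪e, ‖p.1.1‖⁻¹ • p.1.1⟫) • e) ((w, t), y) :=
    (((hi.fun_sub hs).fun_sub ht).fun_div hd he).fun_smul analyticAt_const
  exact hι.fun_sub hσ

end sectionPoint

namespace IsAdmissible

variable (hA : IsAdmissible M)
include hA

/-- The chord from the exit point back to `q` points strictly inward. -/
lemma inner_neg_of_add_smul_mem {q v : Space n} {u : ℝ} (hq : q ∈ convexHull ℝ M)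
    (hu : 0 < u) (hv : v ≠ 0) (hm : q + u • v ∈ M) : ⟪v, gaussMap M (q + u • v)⟫ < 0 := by
  have h := hA.inner_pos_of_mem_convexHull hm hq (by simp [hu.ne', hv])
  rw [sub_add_cancel_left, inner_neg_left, inner_smul_left] at h
  simp only [conj_trivial] at h
  nlinarith

/-- Up to a point of `M` on the ray convexity applies; beyond it the ray is outside the tangent
half-space at that point. -/
lemma add_smul_mem_convexHull_iff {q v : Space n} {u s : ℝ} (hq : q ∈ convexHull ℝ M)
    (hu : 0 < u) (hv : v ≠ 0) (hm : q + u • v ∈ M) (hs : 0 < s) :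
    q + s • v ∈ convexHull ℝ M ↔ s ≤ u := by
  constructor
  · intro h
    by_contra! hus
    have h1 := hA.inner_neg_of_add_smul_mem hq hu hv hm
    have h2 := hA.inner_nonneg_of_mem_closure hm (subset_closure h)
    rw [show q + s • v - (q + u • v) = (s - u) • v by module, inner_smul_left] at h2
    simp only [conj_trivial] at h2
    nlinarith
  · intro h
    have h1 := (convex_convexHull ℝ M).add_smul_sub_mem hq (subset_convexHull ℝ M hm)
      (t := s / u) ⟨by positivity, (div_le_one hu).2 h⟩
    rwa [add_sub_cancel_left, smul_smul, div_mul_cancel₀ _ hu.ne'] at h1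

lemma eq_of_add_smul_mem {q v : Space n} {u s : ℝ} (hq : q ∈ convexHull ℝ M)
    (hu : 0 < u) (hv : v ≠ 0) (hm : q + u • v ∈ M) (hs : 0 < s) (hm' : q + s • v ∈ M) : s = u :=
  le_antisymm ((hA.add_smul_mem_convexHull_iff hq hu hv hm hs).1 (subset_convexHull ℝ M hm'))
    ((hA.add_smul_mem_convexHull_iff hq hs hv hm' hu).1 (subset_convexHull ℝ M hm))

/-- A ray parallel to the tangent hyperplane keeps its height and must leave the closed hull; below
the cap height the exit is on `M`. An interior starting point makes the exit time positive. -/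
lemma exists_add_smul_mem {ξ q v : Space n} {c : ℝ} (hg : IsGoodCap M ξ c)
    (hq : q ∈ interior (convexHull ℝ M)) (hqc : height M ξ q < c) (hv : v ≠ 0)
    (hvξ : ⟪v, ξ⟫ = 0) : ∃ u : ℝ, 0 < u ∧ q + u • v ∈ M := by
  obtain ⟨T, hT, hTn⟩ := hA.exists_notMem_of_inner_eq_zero (q := q) hg hv hvξ
  obtain ⟨u, hu, huf⟩ := isClosed_closure.exists_mem_frontier_segment
    (subset_closure (interior_subset hq)) hT.le hTn
  have hm : q + u • v ∈ M := hA.mem_of_mem_frontier hg huf (by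
    rwa [height_add, inner_smul_left, hvξ, mul_zero, add_zero])
  refine ⟨u, hu.1.lt_of_ne ?_, hm⟩
  rintro rfl
  rw [zero_smul, add_zero] at hm
  exact hA.notMem_interior hm hq

/-- The radial function of the sections is locally given by an analytic function. -/
lemma exists_analyticAt_radial {e q w : Space n} {ι : Space (n - 1) →ₗᵢ[ℝ] Space n} {c t : ℝ}
    (h : IsFrame e ι) (hw : ‖w‖⁻¹ • w = e) (hg : IsGoodCap M e c) (hw0 : w ≠ 0)
    (hq : q ∈ interior (convexHull ℝ M)) (hqt : height M e q = t) (htc : t < c)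
    {θ : Space (n - 1)} (hθ : θ ≠ 0) :
    ∃ φ : (Space n × ℝ) × Space (n - 1) → ℝ, AnalyticAt ℝ φ ((w, t), θ) ∧
      ∀ᶠ p in 𝓝 ((w, t), θ), 0 < φ p ∧ sectionPoint M e q ι (p.1, φ p • p.2) ∈ M := by
  have hwc : w ∈ coneOver (normals M) := ⟨hw0, by rw [hw]; exact hg.mem⟩
  have hee : ⟪e, ‖w‖⁻¹ • w⟫ ≠ 0 := by rw [hw, h.inner_self]; exact one_ne_zero
  have hιθ : ι θ ≠ 0 := by simpa using ι.injective.ne hθ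
  obtain ⟨u, hu, hm⟩ := hA.exists_add_smul_mem hg hq (hqt.trans_lt htc) hιθ (h.inner_eq θ)
  have hneg := hA.inner_neg_of_add_smul_mem (interior_subset hq) hu hιθ hm
  obtain ⟨V, F, hV, hmV, hF, hF', hMV⟩ := hA.analytic _ hm
  obtain ⟨κ, hκ, hκF⟩ := hA.exists_fderiv_eq hm hV hmV hF hF' hMV
  have hpt : ∀ r : ℝ, sectionPoint M e q ι ((w, t), r • θ) = q + r • ι θ := fun r => by
    rw [sectionPoint_self h hw hqt, map_smul]
  set Ψ : ((Space n × ℝ) × Space (n - 1)) × ℝ → Space n :=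
    fun a => sectionPoint M e q ι (a.1.1, a.2 • a.1.2) with hΨ
  have hΨu : Ψ (((w, t), θ), u) = q + u • ι θ := hpt u
  have hΨa : AnalyticAt ℝ Ψ (((w, t), θ), u) := by
    have h1 : AnalyticAt ℝ (fun a : ((Space n × ℝ) × Space (n - 1)) × ℝ => (a.1.1, a.2 • a.1.2))
        (((w, t), θ), u) :=
      (analyticAt_fst.fun_comp analyticAt_fst).prod
        (analyticAt_snd.smul (analyticAt_snd.fun_comp analyticAt_fst))
    exact AnalyticAt.fun_comp (g := sectionPoint M e q ι)
      (f := fun a : ((Space n × ℝ) × Space (n - 1)) × ℝ => (a.1.1, a.2 • a.1.2))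
      (hA.analyticAt_sectionPoint hwc hee t (u • θ)) h1
  have hFΨ : AnalyticAt ℝ (fun a => F (Ψ a)) (((w, t), θ), u) :=
    AnalyticAt.fun_comp (by rw [hΨu]; exact hF _ hmV) hΨa
  have h0 : F (Ψ (((w, t), θ), u)) = 0 := by
    rw [hΨu]
    have : q + u • ι θ ∈ M ∩ V := ⟨hm, hmV⟩
    rw [hMV] at this
    exact this.2
  have hd : HasDerivAt (fun r => F (Ψ (((w, t), θ), r)))
      (fderiv ℝ F (q + u • ι θ) (ι θ)) u := by
    have h1 : HasDerivAt (fun r : ℝ => q + r • ι θ) (ι θ) u := by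
      simpa using ((hasDerivAt_id u).smul_const (ι θ)).const_add q
    have h2 : (fun r => F (Ψ (((w, t), θ), r))) = fun r => F (q + r • ι θ) := by
      funext r
      exact congrArg F (hpt r)
    rw [h2]
    exact (hF _ hmV).differentiableAt.hasFDerivAt.comp_hasDerivAt u h1
  -- Transversality of the outgoing ray at its exit point is the nondegeneracy condition of the
  -- implicit function theorem.
  have hd0 : fderiv ℝ F (q + u • ι θ) (ι θ) ≠ 0 := by
    rw [hκF]
    exact mul_ne_zero hκ hneg.ne
  obtain ⟨φ, hφ, hφ0, hφF⟩ := exists_analyticAt_implicit hFΨ h0 hd hd0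
  refine ⟨φ, hφ, ?_⟩
  have hpos : ∀ᶠ p in 𝓝 ((w, t), θ), 0 < φ p :=
    hφ.continuousAt.eventually (lt_mem_nhds (by rwa [hφ0]))
  have hinV : ∀ᶠ p in 𝓝 ((w, t), θ), Ψ (p, φ p) ∈ V := by
    have h1 : ContinuousAt (fun p => Ψ (p, φ p)) ((w, t), θ) :=
      ContinuousAt.comp' (f := fun p => (p, φ p)) (g := Ψ)
        (by rw [hφ0]; exact hΨa.continuousAt) (continuousAt_id.prodMk hφ.continuousAt)
    refine h1.eventually (hV.mem_nhds ?_)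
    simp only [hφ0, hΨu]
    exact hmV
  filter_upwards [hpos, hinV, hφF] with p h1 h2 h3
  refine ⟨h1, ?_⟩
  have : Ψ (p, φ p) ∈ {x ∈ V | F x = 0} := ⟨h2, h3⟩
  rw [← hMV] at this
  exact this.1

end IsAdmissible

end PolyIntegrable

namespace PolyIntegrable

variable {n : ℕ} {M : Set (Space n)}

lemma continuous_sectionPoint (M : Set (Space n)) (e q : Space n)
    (ι : Space (n - 1) →ₗᵢ[ℝ] Space n) (z : Space n × ℝ) :
    Continuous fun y => sectionPoint M e q ι (z, y) := by
  have h1 : Continuous fun y => q + ι y := continuous_const.add ι.continuous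
  have h2 := (continuous_height M (‖z.1‖⁻¹ • z.1)).comp h1
  have h3 : Continuous fun y => ((height M (‖z.1‖⁻¹ • z.1) (q + ι y) - z.2) /
      ⟪e, ‖z.1‖⁻¹ • z.1⟫) • e := ((h2.sub continuous_const).div_const _).smul continuous_const
  exact h1.sub h3

open Classical in
/-- The distance from the point with coordinate `0` to `M` in the section, in the direction
with coordinate `p.2`. -/
noncomputable def radial (M : Set (Space n)) (e q : Space n)
    (ι : Space (n - 1) →ₗᵢ[ℝ] Space n) (p : (Space n × ℝ) × Space (n - 1)) : ℝ :=
  if h : ∃ r : ℝ, 0 < r ∧ sectionPoint M e q ι (p.1, r • p.2) ∈ M then h.choose else 0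

lemma radial_spec {e q : Space n} {ι : Space (n - 1) →ₗᵢ[ℝ] Space n}
    {p : (Space n × ℝ) × Space (n - 1)}
    (h : ∃ r : ℝ, 0 < r ∧ sectionPoint M e q ι (p.1, r • p.2) ∈ M) :
    0 < radial M e q ι p ∧ sectionPoint M e q ι (p.1, radial M e q ι p • p.2) ∈ M := by
  rw [radial, dif_pos h]
  exact h.choose_spec

lemma sectionPoint_ne {e q : Space n} {ι : Space (n - 1) →ₗᵢ[ℝ] Space n} (h : IsFrame e ι)
    (z : Space n × ℝ) {y : Space (n - 1)} (hy : y ≠ 0) :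
    sectionPoint M e q ι (z, y) - sectionPoint M e q ι (z, 0) ≠ 0 := by
  intro h0
  have := congrArg (proj ι) h0
  rw [map_sub, proj_sectionPoint h, proj_sectionPoint h, map_zero] at this
  exact hy (by simpa using this)

namespace IsAdmissible

variable (hA : IsAdmissible M)
include hA

/-- Uniqueness of the exit point makes the choice in `radial` agree with any local analytic
solution. -/
lemma eq_radial {e q : Space n} {ι : Space (n - 1) →ₗᵢ[ℝ] Space n} (h : IsFrame e ι)
    {p : (Space n × ℝ) × Space (n - 1)} (hq : sectionPoint M e q ι (p.1, 0) ∈ convexHull ℝ M)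
    (hp : p.2 ≠ 0) {r : ℝ} (hr : 0 < r) (hm : sectionPoint M e q ι (p.1, r • p.2) ∈ M) :
    r = radial M e q ι p := by
  obtain ⟨h1, h2⟩ := radial_spec ⟨r, hr, hm⟩
  rw [sectionPoint_smul] at hm h2
  exact hA.eq_of_add_smul_mem hq h1 (sectionPoint_ne h _ hp) h2 hr hm

lemma exists_mem_interior_height_eq {ξ : Space n} {c t : ℝ} (hg : IsGoodCap M ξ c)
    (ht : t ∈ Ioo 0 c) : ∃ q ∈ interior (convexHull ℝ M), height M ξ q = t := by
  obtain ⟨p, hp, hpc⟩ := hA.exists_mem_interior_height_lt hg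
  have ha := gaussInv_mem hg.mem
  have hp0 : 0 < height M ξ p := by linarith [ht.1, ht.2]
  refine ⟨gaussInv M ξ + (t / height M ξ p) • (p - gaussInv M ξ), ?_, ?_⟩
  · exact (convex_convexHull ℝ M).add_smul_sub_mem_interior'
      (subset_closure (subset_convexHull ℝ M ha)) hp
      ⟨div_pos ht.1 hp0, (div_le_one hp0).2 (by linarith [ht.2])⟩
  · rw [height_add, height_gaussInv, inner_smul_left, ← height_eq]
    simp only [conj_trivial]
    rw [div_mul_cancel₀ _ hp0.ne', zero_add]

/-- The frame stays at `e` while the normal varies, so the shadow along `e` has the area of the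
section times a cosine. The shadow is star shaped about the base point, and polar coordinates apply.
-/
lemma sectionVolume_eq_integral {e q w : Space n} {ι : Space (n - 1) →ₗᵢ[ℝ] Space n}
    {c t : ℝ} (h : IsFrame e ι) (hg : IsGoodCap M (‖w‖⁻¹ • w) c) (htc : t < c)
    (he : 0 < ⟪e, ‖w‖⁻¹ • w⟫) (hq : sectionPoint M e q ι ((w, t), 0) ∈ convexHull ℝ M)
    (hr : ∀ θ ∈ Metric.sphere (0 : Space (n - 1)) 1,
      ∃ r : ℝ, 0 < r ∧ sectionPoint M e q ι ((w, t), r • θ) ∈ M) :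
    sectionVolume M (gaussInv M (‖w‖⁻¹ • w)) t = ⟪e, ‖w‖⁻¹ • w⟫⁻¹ *
      ∫ θ : Metric.sphere (0 : Space (n - 1)) 1,
        radial M e q ι ((w, t), θ) ^ (n - 1) / (n - 1 : ℕ)
          ∂(volume : Measure (Space (n - 1))).toSphere := by
  set ξ := ‖w‖⁻¹ • w with hξ
  have hcl := hA.isClosed_slice hg htc
  set T : Set (Space (n - 1)) := {y | sectionPoint M e q ι ((w, t), y) ∈ convexHull ℝ M} with hT
  have hTs : T = (fun y => sectionPoint M e q ι ((w, t), y)) ⁻¹' slice M ξ t := by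
    ext y
    exact ⟨fun hy => ⟨hy, height_sectionPoint he.ne' t y⟩, fun hy => hy.1⟩
  have hTm : MeasurableSet T := by
    rw [hTs]
    exact (hcl.preimage (continuous_sectionPoint M e q ι (w, t))).measurableSet
  have himg : proj ι '' slice M ξ t = (fun y => proj ι q + y) '' T := by
    ext y
    constructor
    · rintro ⟨x, hx, rfl⟩
      have h1 := eq_sectionPoint (M := M) (q := q) h (x := x) he.ne'
      rw [← hξ, hx.2] at h1
      refine ⟨proj ι x - proj ι q, ?_, by simp⟩
      rw [hT, mem_ofPred_eq, ← h1]
      exact hx.1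
    · rintro ⟨y, hy, rfl⟩
      rw [hTs] at hy
      exact ⟨_, hy, proj_sectionPoint h _⟩
  have hv : volume T =
      ENNReal.ofReal |⟪ξ, e⟫| * (μHE[n - 1] : Measure (Space n)) (slice M ξ t) := by
    rw [← volume_proj_image_of_subset_hyperplane hA.one_le (hA.norm_normal hg.mem) h
      (by rw [real_inner_comm]; exact he.ne') hcl.measurableSet (slice_subset_hyperplane ξ t), himg]
    exact (measure_preimage_add volume (-proj ι q) T).symm.trans (by
      congr 1
      ext y
      simp [add_comm, ← sub_eq_add_neg])
  have hrad := volumeReal_of_radial (r := fun θ => radial M e q ι ((w, t), θ))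
    (by have := hA.three_le; omega) hTm (fun θ hθ => (radial_spec (p := ((w, t), θ)) (hr θ hθ)).1)
    (fun θ hθ s hs => by
      obtain ⟨h1, h2⟩ := radial_spec (p := ((w, t), θ)) (hr θ hθ)
      have hθ0 : θ ≠ 0 := by
        rintro rfl
        simp at hθ
      rw [sectionPoint_smul] at h2
      rw [hT, mem_ofPred_eq, sectionPoint_smul]
      exact hA.add_smul_mem_convexHull_iff hq h1 (sectionPoint_ne h _ hθ0) h2 hs)
  rw [sectionVolume_eq hg.mem, ← hrad, Measure.real, Measure.real, hv, ENNReal.toReal_mul,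
    ENNReal.toReal_ofReal (abs_nonneg _), real_inner_comm,
    abs_of_pos (by rwa [real_inner_comm]), inv_mul_cancel_left₀ (by rw [real_inner_comm]; exact he.ne')]

/-- The section volume is an analytic function of the normal direction and the height. -/
lemma analyticAt_sectionVolume {w : Space n} {c t : ℝ} (hw : w ≠ 0)
    (hg : ∀ᶠ v in 𝓝 w, IsGoodCap M (‖v‖⁻¹ • v) c) (ht : t ∈ Ioo 0 c) :
    AnalyticAt ℝ (fun p : Space n × ℝ => sectionVolume M (gaussInv M (‖p.1‖⁻¹ • p.1)) p.2)
      (w, t) := by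
  have hg0 := hg.self_of_nhds
  obtain ⟨e, he⟩ : ∃ e, ‖w‖⁻¹ • w = e := ⟨_, rfl⟩
  rw [he] at hg0
  have hwc : w ∈ coneOver (normals M) := ⟨hw, by rw [he]; exact hg0.mem⟩
  obtain ⟨ι, h⟩ := exists_isFrame hA.one_le (hA.norm_normal hg0.mem)
  have hee : ⟪e, ‖w‖⁻¹ • w⟫ ≠ 0 := by rw [he, h.inner_self]; exact one_ne_zero
  obtain ⟨q, hq, hqt⟩ := hA.exists_mem_interior_height_eq hg0 ht
  have hX := hA.analyticAt_sectionPoint (q := q) (ι := ι) hwc hee t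
  have hθ0 : ∀ θ ∈ Metric.sphere (0 : Space (n - 1)) 1, θ ≠ 0 := by
    rintro θ hθ rfl
    simp at hθ
  have hint : ∀ᶠ z in 𝓝 (w, t), sectionPoint M e q ι (z, 0) ∈ convexHull ℝ M := by
    have h1 : ContinuousAt (fun z : Space n × ℝ => sectionPoint M e q ι (z, 0)) (w, t) :=
      ContinuousAt.comp' (f := fun z : Space n × ℝ => (z, (0 : Space (n - 1))))
        (hX 0).continuousAt (continuousAt_id.prodMk continuousAt_const)
    refine (h1.eventually (isOpen_interior.mem_nhds (?_ : _ ∈ interior (convexHull ℝ M)))).mono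
      fun z hz => interior_subset hz
    simpa [sectionPoint_self h he hqt] using hq
  have hN : AnalyticAt ℝ (fun z : Space n × ℝ => ⟪e, ‖z.1‖⁻¹ • z.1⟫) (w, t) := by
    have h1 : AnalyticAt ℝ (fun v : Space n => ⟪e, ‖v‖⁻¹ • v⟫) w :=
      ((contDiffAt_const (n := ω)).inner ℝ
        ((analyticAt_normalize hw).contDiffAt (n := ω))).analyticAt
    exact AnalyticAt.fun_comp (g := fun v : Space n => ⟪e, ‖v‖⁻¹ • v⟫)
      (f := fun z : Space n × ℝ => z.1) h1 analyticAt_fst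
  have hpos : ∀ᶠ z : Space n × ℝ in 𝓝 (w, t), 0 < ⟪e, ‖z.1‖⁻¹ • z.1⟫ := by
    refine hN.continuousAt.eventually (lt_mem_nhds ?_)
    simp only [he, h.inner_self]
    exact one_pos
  -- Compactness of the sphere of directions gives one neighbourhood of `(w, t)` for all of them.
  have hex : ∀ᶠ z in 𝓝 (w, t), ∀ θ ∈ Metric.sphere (0 : Space (n - 1)) 1,
      ∃ r : ℝ, 0 < r ∧ sectionPoint M e q ι (z, r • θ) ∈ M := by
    refine (isCompact_sphere _ _).eventually_forall_of_forall_eventually fun θ hθ => ?_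
    obtain ⟨φ, -, hφ⟩ := hA.exists_analyticAt_radial h he hg0 hw hq hqt ht.2 (hθ0 θ hθ)
    exact hφ.mono fun p hp => ⟨φ p, hp⟩
  have hrad : ∀ θ : Metric.sphere (0 : Space (n - 1)) 1,
      AnalyticAt ℝ (radial M e q ι) ((w, t), (θ : Space (n - 1))) := by
    intro θ
    obtain ⟨φ, hφa, hφ⟩ := hA.exists_analyticAt_radial h he hg0 hw hq hqt ht.2 (hθ0 θ θ.2)
    refine hφa.congr ?_
    have h1 : ∀ᶠ p : (Space n × ℝ) × Space (n - 1) in 𝓝 ((w, t), (θ : Space (n - 1))),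
        p.2 ≠ 0 := continuousAt_snd.eventually (isOpen_compl_singleton.mem_nhds (hθ0 θ θ.2))
    have h2 : ∀ᶠ p : (Space n × ℝ) × Space (n - 1) in 𝓝 ((w, t), (θ : Space (n - 1))),
        sectionPoint M e q ι (p.1, 0) ∈ convexHull ℝ M := hint.prod_inl_nhds _
    filter_upwards [hφ, h1, h2] with p hp hp1 hp2
    exact hA.eq_radial h hp2 hp1 hp.1 hp.2
  have hI := analyticAt_integral (volume : Measure (Space (n - 1))).toSphere
    (j := fun θ : Metric.sphere (0 : Space (n - 1)) 1 => (θ : Space (n - 1)))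
    continuous_subtype_val
    (f := fun p => radial M e q ι p ^ (n - 1) / ((n - 1 : ℕ) : ℝ)) (z₀ := (w, t))
    (fun θ => by
      simp only [div_eq_mul_inv]
      exact ((hrad θ).fun_pow _).fun_mul analyticAt_const)
  refine ((hN.fun_inv (by simpa using hee)).fun_mul hI).congr ?_
  have hg' : ∀ᶠ z : Space n × ℝ in 𝓝 (w, t), IsGoodCap M (‖z.1‖⁻¹ • z.1) c :=
    hg.prod_inl_nhds t
  have hlt : ∀ᶠ z : Space n × ℝ in 𝓝 (w, t), z.2 < c :=
    continuousAt_snd.eventually (gt_mem_nhds ht.2)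
  filter_upwards [hint, hpos, hex, hg', hlt] with z h1 h2 h3 h4 h5
  exact (hA.sectionVolume_eq_integral h h4 h5 h2 h1 h3).symm

end IsAdmissible

end PolyIntegrable

/-! ### Quadratic estimate for low caps -/

namespace PolyIntegrable

variable {n : ℕ} {M : Set (Space n)}

namespace IsAdmissible

variable (hA : IsAdmissible M)
include hA

/-- The inner product splits into the height of `x` over `η`, the height of `γ⁻¹(η)` over `ξ`, both
nonnegative, and a term bounded by Cauchy–Schwarz and `hL`. -/
lemma neg_mul_norm_sq_le_inner {ξ η x : Space n} {L : ℝ} (hξ : ξ ∈ normals M)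
    (hη : η ∈ normals M) (hx : x ∈ convexHull ℝ M)
    (hL : ‖gaussInv M η - gaussInv M ξ‖ ≤ L * ‖η - ξ‖) :
    -(L * ‖η - ξ‖ ^ 2) ≤ ⟪x - gaussInv M ξ, η⟫ := by
  have h1 := hA.height_nonneg hη (subset_closure hx)
  have h2 := hA.height_nonneg hξ (subset_closure (subset_convexHull ℝ M (gaussInv_mem hη)))
  rw [height_eq] at h1 h2
  have h3 : |⟪gaussInv M η - gaussInv M ξ, η - ξ⟫| ≤ L * ‖η - ξ‖ * ‖η - ξ‖ :=
    (abs_real_inner_le_norm _ _).trans (by gcongr)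
  have h4 : ⟪x - gaussInv M ξ, η⟫ = ⟪x - gaussInv M η, η⟫ +
      ⟪gaussInv M η - gaussInv M ξ, η - ξ⟫ + ⟪gaussInv M η - gaussInv M ξ, ξ⟫ := by
    simp only [inner_sub_left, inner_sub_right]
    ring
  have h5 := (abs_le.1 h3).1
  nlinarith

/-- Points of the convex hull at small height are close to the point of tangency. -/
lemma norm_sub_gaussInv_le {ξ x : Space n} {L δ t : ℝ} (hξ : ξ ∈ normals M) (hL0 : 0 ≤ L)
    (hL : ∀ η, ‖η‖ = 1 → ‖η - ξ‖ < δ →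
      η ∈ normals M ∧ ‖gaussInv M η - gaussInv M ξ‖ ≤ L * ‖η - ξ‖)
    (hx : x ∈ convexHull ℝ M) (hxt : height M ξ x = t) (ht : 0 < t) (ht1 : t ≤ 1)
    (htδ : 2 * √t < δ) : ‖x - gaussInv M ξ‖ ≤ (2 + 2 * L) * √t := by
  have hξ1 := hA.norm_normal hξ
  set s := √t with hs
  have hs0 : 0 < s := Real.sqrt_pos.2 ht
  have hst : s ^ 2 = t := Real.sq_sqrt ht.le
  have hs1 : s ≤ 1 := Real.sqrt_le_one.2 ht1
  have hin : ⟪x - gaussInv M ξ, ξ⟫ = t := by rw [← hxt, height_eq]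
  have hξξ : ⟪ξ, ξ⟫ = 1 := by rw [real_inner_self_eq_norm_sq, hξ1, one_pow]
  set w := x - gaussInv M ξ - t • ξ with hw
  have hwξ : ⟪w, ξ⟫ = 0 := by
    rw [hw, inner_sub_left, hin, inner_smul_left, hξξ]
    simp
  have hxw : x - gaussInv M ξ = w + t • ξ := by rw [hw]; abel
  have hwb : ‖w‖ ≤ (1 + 2 * L) * s := by
    by_cases hw0 : w = 0
    · rw [hw0, norm_zero]
      positivity
    have hwn : 0 < ‖w‖ := norm_pos_iff.2 hw0
    set u := ‖w‖⁻¹ • w with hu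
    have hu1 : ‖u‖ = 1 := norm_normalize hw0
    have huξ : ⟪u, ξ⟫ = 0 := by rw [hu, inner_smul_left, hwξ, mul_zero]
    have hξu : ⟪ξ, u⟫ = 0 := by rw [real_inner_comm, huξ]
    have huu : ⟪u, u⟫ = 1 := by rw [real_inner_self_eq_norm_sq, hu1, one_pow]
    have hwu : ⟪w, u⟫ = ‖w‖ := by
      rw [hu, inner_smul_right, real_inner_self_eq_norm_sq]
      field_simp
    -- `η` is `ξ` rotated away from `u` by the angle whose half has tangent `s = √t`. The rational
    -- form has norm exactly one, and this angle balances `t` and `L‖η - ξ‖²` against `s‖w‖`.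
    set η := ((1 - s ^ 2) / (1 + s ^ 2)) • ξ - (2 * s / (1 + s ^ 2)) • u with hη
    have hD : (1 + s ^ 2) ≠ 0 := by positivity
    have hη1 : ‖η‖ = 1 := by
      have : ‖η‖ ^ 2 = 1 := by
        rw [← real_inner_self_eq_norm_sq, hη]
        simp only [inner_sub_left, inner_sub_right, inner_smul_left, inner_smul_right, hξξ, huξ,
          hξu, huu, conj_trivial]
        field_simp
        ring
      exact (sq_eq_sq₀ (norm_nonneg _) zero_le_one).1 (by rw [this, one_pow])
    have hd : ‖η - ξ‖ ^ 2 = 4 * s ^ 2 / (1 + s ^ 2) := by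
      rw [← real_inner_self_eq_norm_sq, hη]
      simp only [inner_sub_left, inner_sub_right, inner_smul_left, inner_smul_right, hξξ, huξ,
        hξu, huu, conj_trivial]
      field_simp
      ring
    have hdle : ‖η - ξ‖ ≤ 2 * s := by
      refine abs_le_of_sq_le_sq' ?_ (by positivity) |>.2
      rw [hd, div_le_iff₀ (by positivity)]
      nlinarith [sq_nonneg s, sq_nonneg (s ^ 2)]
    obtain ⟨hηn, hηL⟩ := hL η hη1 (hdle.trans_lt htδ)
    have key := hA.neg_mul_norm_sq_le_inner hξ hηn hx hηL
    have hxη : ⟪x - gaussInv M ξ, η⟫ = (1 - s ^ 2) / (1 + s ^ 2) * t -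
        2 * s / (1 + s ^ 2) * ‖w‖ := by
      rw [hxw, hη]
      simp only [inner_sub_right, inner_add_left, inner_smul_left, inner_smul_right, hξξ, hξu,
        hwξ, hwu, conj_trivial]
      ring
    rw [hxη, hd, neg_le_sub_iff_le_add, ← hst] at key
    have key2 : 2 * s * ‖w‖ ≤ (1 - s ^ 2) * s ^ 2 + L * (4 * s ^ 2) := by
      have h1 := mul_le_mul_of_nonneg_right key (show 0 ≤ 1 + s ^ 2 by positivity)
      have e1 : 2 * s / (1 + s ^ 2) * ‖w‖ * (1 + s ^ 2) = 2 * s * ‖w‖ := by field_simp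
      have e2 : ((1 - s ^ 2) / (1 + s ^ 2) * s ^ 2 + L * (4 * s ^ 2 / (1 + s ^ 2))) *
          (1 + s ^ 2) = (1 - s ^ 2) * s ^ 2 + L * (4 * s ^ 2) := by field_simp
      rwa [e1, e2] at h1
    have key3 : s * ‖w‖ ≤ s * ((1 + 2 * L) * s) := by nlinarith [sq_nonneg (s ^ 2)]
    exact le_of_mul_le_mul_left key3 hs0
  calc ‖x - gaussInv M ξ‖ ≤ ‖w‖ + ‖t • ξ‖ := by rw [hxw]; exact norm_add_le _ _
    _ ≤ (1 + 2 * L) * s + s := by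
      rw [norm_smul, hξ1, mul_one, Real.norm_of_nonneg ht.le]
      refine add_le_add hwb ?_
      rw [← hst]
      nlinarith
    _ = (2 + 2 * L) * s := by ring

/-- In a closed ball inside the domain of a local defining function, `M` is a closed zero set. -/
lemma exists_isCompact_inter_closedBall {a : Space n} (ha : a ∈ M) :
    ∃ r : ℝ, 0 < r ∧ ∀ r' ≤ r, IsCompact (M ∩ Metric.closedBall a r') := by
  obtain ⟨V, F, hV, haV, hF, -, hMV⟩ := hA.analytic a ha
  obtain ⟨r, hr, hrV⟩ := Metric.nhds_basis_closedBall.mem_iff.1 (hV.mem_nhds haV)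
  refine ⟨r, hr, fun r' hr' => ?_⟩
  have hsub : Metric.closedBall a r' ⊆ V := (Metric.closedBall_subset_closedBall hr').trans hrV
  have h1 : M ∩ Metric.closedBall a r' = Metric.closedBall a r' ∩ F ⁻¹' {0} := by
    ext x
    constructor
    · rintro ⟨h1, h2⟩
      have : x ∈ M ∩ V := ⟨h1, hsub h2⟩
      rw [hMV] at this
      exact ⟨h2, this.2⟩
    · rintro ⟨h1, h2⟩
      have : x ∈ {x ∈ V | F x = 0} := ⟨hsub h1, h2⟩
      rw [← hMV] at this
      exact ⟨this.1, h1⟩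
  rw [h1]
  refine (isCompact_closedBall a r').of_isClosed_subset ?_ inter_subset_left
  exact (hF.continuousOn.mono hsub).preimage_isClosed_of_isClosed
    Metric.isClosed_closedBall isClosed_singleton

/-- Every normal direction has a neighbourhood over which all sufficiently low caps are compact
and satisfy a uniform quadratic estimate. -/
lemma exists_uniform_cap {ξ₀ : Space n} (hξ₀ : ξ₀ ∈ normals M) :
    ∃ c C : ℝ, 0 < c ∧ 0 ≤ C ∧ ∀ᶠ ξ in 𝓝 ξ₀, ‖ξ‖ = 1 → IsGoodCap M ξ c ∧
      ∀ x ∈ convexHull ℝ M, ∀ t ∈ Ioc 0 c, height M ξ x = t →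
        ‖x - gaussInv M ξ‖ ≤ C * √t := by
  have hξ1 := hA.norm_normal hξ₀
  have hcone : ξ₀ ∈ coneOver (normals M) := (mem_coneOver_of_norm_eq_one hξ1).2 hξ₀
  set g : Space n → Space n := fun w => gaussInv M (‖w‖⁻¹ • w) with hg
  have hga : AnalyticAt ℝ g ξ₀ := hA.analyticAt_gaussInv_normalize hcone
  have hgξ : ∀ ξ : Space n, ‖ξ‖ = 1 → g ξ = gaussInv M ξ := fun ξ h => by simp [hg, h]
  obtain ⟨L, S, hS, hLip⟩ := (hga.contDiffAt (n := 1)).exists_lipschitzOnWith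
  have hS' : S ∩ coneOver (normals M) ∈ 𝓝 ξ₀ :=
    inter_mem hS (hA.gauss.2.1.isOpen_coneOver.mem_nhds hcone)
  obtain ⟨δ, hδ, hδS⟩ := Metric.mem_nhds_iff.1 hS'
  have ha := gaussInv_mem hξ₀
  obtain ⟨r₁, hr₁, hcpt⟩ := hA.exists_isCompact_inter_closedBall ha
  obtain ⟨b, hb, hba⟩ := hA.exists_ne ha
  have hba' : 0 < ‖b - gaussInv M ξ₀‖ := norm_pos_iff.2 (sub_ne_zero.2 hba)
  -- The first bound makes `M` compact within the ball; the second leaves `b` outside, so a cap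
  -- inside the ball is proper.
  set r := min r₁ (‖b - gaussInv M ξ₀‖ / 2) with hr
  have hr0 : 0 < r := lt_min hr₁ (by positivity)
  set C : ℝ := 2 + 2 * L with hC
  have hC0 : 0 < C := by positivity
  obtain ⟨c, hc0, hc1, hcδ, hcr⟩ :
      ∃ c : ℝ, 0 < c ∧ c ≤ 1 ∧ 2 * √c < δ / 2 ∧ C * √c ≤ r / 2 := by
    have h1 : Tendsto (fun c : ℝ => 2 * √c) (𝓝[>] 0) (𝓝 0) := by
      have : Continuous fun c : ℝ => 2 * √c := by fun_prop
      simpa using (this.tendsto 0).mono_left nhdsWithin_le_nhds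
    have h2 : Tendsto (fun c : ℝ => C * √c) (𝓝[>] 0) (𝓝 0) := by
      have : Continuous fun c : ℝ => C * √c := by fun_prop
      simpa using (this.tendsto 0).mono_left nhdsWithin_le_nhds
    have h3 : ∀ᶠ c : ℝ in 𝓝[>] 0, c ≤ 1 :=
      nhdsWithin_le_nhds (ge_mem_nhds one_pos)
    obtain ⟨c, h⟩ := ((eventually_mem_nhdsWithin.and h3).and
      ((h1.eventually (gt_mem_nhds (half_pos hδ))).and
        (h2.eventually (ge_mem_nhds (half_pos hr0))))).exists
    exact ⟨c, h.1.1, h.1.2, h.2.1, h.2.2⟩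
  refine ⟨c, C, hc0, hC0.le, ?_⟩
  have hnear : ∀ᶠ ξ in 𝓝 ξ₀, ‖g ξ - g ξ₀‖ < r / 2 := by
    have := hga.continuousAt.eventually (Metric.ball_mem_nhds _ (half_pos hr0))
    filter_upwards [this] with ξ hξ
    rwa [dist_eq_norm] at hξ
  filter_upwards [Metric.ball_mem_nhds ξ₀ (half_pos hδ), hnear] with ξ hξδ hξr hξn
  rw [hgξ ξ hξn, hgξ ξ₀ hξ1] at hξr
  have hξS := hδS (Metric.ball_subset_ball (by linarith) hξδ)
  have hξ : ξ ∈ normals M := (mem_coneOver_of_norm_eq_one hξn).1 hξS.2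
  have hquad : ∀ x ∈ convexHull ℝ M, ∀ t ∈ Ioc 0 c, height M ξ x = t →
      ‖x - gaussInv M ξ‖ ≤ C * √t := by
    intro x hx t ht hxt
    have hsq : √t ≤ √c := Real.sqrt_le_sqrt ht.2
    refine hA.norm_sub_gaussInv_le (δ := δ / 2) hξ L.2 (fun η hη hηξ => ?_) hx hxt ht.1
      (ht.2.trans hc1) (by linarith)
    have hηS : η ∈ S ∩ coneOver (normals M) := hδS <| by
      rw [mem_ball_iff_norm] at hξδ ⊢
      calc ‖η - ξ₀‖ ≤ ‖η - ξ‖ + ‖ξ - ξ₀‖ := norm_sub_le_norm_sub_add_norm_sub _ _ _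
        _ < δ := by linarith
    refine ⟨(mem_coneOver_of_norm_eq_one hη).1 hηS.2, ?_⟩
    have := hLip.norm_sub_le hηS.1 hξS.1
    rwa [hgξ η hη, hgξ ξ hξn] at this
  have hcapr : ∀ x ∈ cap M ξ c, ‖x - gaussInv M ξ₀‖ ≤ r := by
    intro x hx
    have hxK := subset_convexHull ℝ M hx.1
    have h0 := hA.height_nonneg hξ (subset_closure hxK)
    have h1 : ‖x - gaussInv M ξ‖ ≤ r / 2 := by
      rcases h0.eq_or_lt with h0 | h0
      · have : x = gaussInv M ξ := by
          by_contra hne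
          have := hA.inner_pos_of_mem_convexHull (gaussInv_mem hξ) hxK hne
          rw [gaussMap_gaussInv hξ, ← height_eq] at this
          exact this.ne h0
        rw [this, sub_self, norm_zero]
        positivity
      · refine (hquad x hxK _ ⟨h0, hx.2⟩ rfl).trans (le_trans ?_ hcr)
        gcongr
        exact hx.2
    calc ‖x - gaussInv M ξ₀‖ ≤ ‖x - gaussInv M ξ‖ + ‖gaussInv M ξ - gaussInv M ξ₀‖ :=
          norm_sub_le_norm_sub_add_norm_sub _ _ _
      _ ≤ r := by linarith
  refine ⟨⟨hξ, hc0, ?_, ?_⟩, hquad⟩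
  · have h1 : cap M ξ c = (M ∩ Metric.closedBall (gaussInv M ξ₀) r) ∩
        {x | height M ξ x ≤ c} := by
      ext x
      constructor
      · exact fun hx => ⟨⟨hx.1, by rw [mem_closedBall_iff_norm]; exact hcapr x hx⟩, hx.2⟩
      · exact fun hx => ⟨hx.1.1, hx.2⟩
    rw [h1]
    exact (hcpt r (min_le_left _ _)).inter_right
      (isClosed_le (continuous_height M ξ) continuous_const)
  · intro h
    have h1 := hcapr b (by rw [h]; exact hb)
    have h2 : r ≤ ‖b - gaussInv M ξ₀‖ / 2 := min_le_right _ _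
    linarith

/-- The section projects isometrically into a ball of radius `C √t` in dimension `n - 1`. -/
lemma sectionVolume_le {ξ : Space n} {c C t : ℝ} (hg : IsGoodCap M ξ c) (hC : 0 ≤ C)
    (ht : t ∈ Ioo 0 c)
    (h : ∀ x ∈ convexHull ℝ M, height M ξ x = t → ‖x - gaussInv M ξ‖ ≤ C * √t) :
    sectionVolume M (gaussInv M ξ) t ≤
      C ^ (n - 1) * volume.real (Metric.closedBall (0 : Space (n - 1)) 1) * √t ^ (n - 1) := by
  obtain ⟨ι, hι⟩ := exists_isFrame hA.one_le (hA.norm_normal hg.mem)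
  have hsub : proj ι '' slice M ξ t ⊆
      Metric.closedBall (proj ι (gaussInv M ξ)) (C * √t) := by
    rintro _ ⟨x, hx, rfl⟩
    rw [mem_closedBall_iff_norm, ← map_sub]
    exact (hι.norm_proj_le _).trans (h x hx.1 hx.2)
  rw [sectionVolume_eq hg.mem, Measure.real, ← hA.volume_proj_slice hg ht.2 hι, ← Measure.real]
  refine (measureReal_mono hsub measure_closedBall_lt_top.ne).trans_eq ?_
  rw [measureReal_def, Measure.addHaar_closedBall _ _ (by positivity), ENNReal.toReal_mul,
    ENNReal.toReal_ofReal (by positivity), finrank_euclideanSpace_fin, mul_pow, measureReal_def,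
    Measure.addHaar_unitClosedBall_eq_addHaar_unitBall]
  ring

end IsAdmissible

end PolyIntegrable

/-! ### Degrees and coefficients in analytic families of polynomials -/

namespace PolyIntegrable

section PolynomialFamily

open Polynomial

/-- Equidistributed nodes in the interval `(0, c)`. -/
noncomputable def node (c : ℝ) (N j : ℕ) : ℝ := c * ((j + 1) / (N + 2))

/-- The shifts by `1` and `2` keep the nodes off both endpoints, since the families are controlled
only on the open interval. -/
lemma node_mem {c : ℝ} (hc : 0 < c) {N j : ℕ} (hj : j ∈ Finset.range (N + 1)) :
    node c N j ∈ Ioo 0 c := by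
  have h1 : (j : ℝ) + 1 < N + 2 := by
    have := Finset.mem_range.1 hj
    exact_mod_cast (by omega : j + 1 < N + 2)
  have h2 : ((j : ℝ) + 1) / (N + 2) < 1 := (div_lt_one (by positivity)).2 h1
  refine ⟨by unfold node; positivity, ?_⟩
  unfold node
  nlinarith

lemma injOn_node {c : ℝ} (hc : 0 < c) (N : ℕ) (s : Set ℕ) : InjOn (node c N) s := by
  intro i _ j _ h
  have h1 := mul_left_cancel₀ hc.ne' h
  have h2 : ((N : ℝ) + 2) ≠ 0 := by positivity
  rw [div_left_inj' h2] at h1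
  exact_mod_cast add_right_cancel h1

/-- The interpolation polynomial of degree at most `N` of a function on `(0, c)`. -/
noncomputable def interp (c : ℝ) (N : ℕ) (f : ℝ → ℝ) : ℝ[X] :=
  Lagrange.interpolate (Finset.range (N + 1)) (node c N) fun j => f (node c N j)

lemma interp_eq_sum (c : ℝ) (N : ℕ) (f : ℝ → ℝ) :
    interp c N f = ∑ j ∈ Finset.range (N + 1),
      C (f (node c N j)) * Lagrange.basis (Finset.range (N + 1)) (node c N) j :=
  Lagrange.interpolate_apply _ _ _

lemma eq_interp {c : ℝ} (hc : 0 < c) {N : ℕ} {f : ℝ → ℝ} {p : ℝ[X]}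
    (hf : ∀ t ∈ Ioo 0 c, f t = p.eval t) (hp : p.natDegree ≤ N) : p = interp c N f := by
  refine Lagrange.eq_interpolate_of_eval_eq _ (injOn_node hc N _) ?_ fun j hj =>
    (hf _ (node_mem hc hj)).symm
  rw [Finset.card_range]
  exact (natDegree_le_iff_degree_le.1 hp).trans_lt (by exact_mod_cast Nat.lt_succ_self N)

/-- The degree bound becomes a system of equations between functions analytic in the parameter,
suited both to closedness and to the identity theorem. -/
lemma natDegree_le_iff_eq_eval_interp {c : ℝ} (hc : 0 < c) {N : ℕ} {f : ℝ → ℝ} {p : ℝ[X]}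
    (hf : ∀ t ∈ Ioo 0 c, f t = p.eval t) :
    p.natDegree ≤ N ↔ ∀ t ∈ Ioo 0 c, f t = (interp c N f).eval t := by
  refine ⟨fun h t ht => by rw [← eq_interp hc hf h, hf t ht], fun h => ?_⟩
  have h1 : p = interp c N f := eq_of_infinite_eval_eq _ _ <|
    (Ioo_infinite hc).mono fun t ht => by
      rw [mem_ofPred_eq, ← hf t ht, h t ht]
  have h2 := Lagrange.degree_interpolate_lt (fun j => f (node c N j))
    (injOn_node hc N (Finset.range (N + 1)))
  rw [Finset.card_range] at h2
  rw [h1, natDegree_le_iff_degree_le]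
  exact Order.le_of_lt_succ h2

variable {E : Type*} [NormedAddCommGroup E] [NormedSpace ℝ E]

lemma analyticAt_eval_interp {c : ℝ} (hc : 0 < c) (N : ℕ) {f : E → ℝ → ℝ} {w : E}
    (hf : ∀ t ∈ Ioo 0 c, AnalyticAt ℝ (fun w => f w t) w) (t : ℝ) :
    AnalyticAt ℝ (fun w => (interp c N (f w)).eval t) w := by
  simp only [interp_eq_sum, eval_finsetSum, eval_mul, eval_C]
  exact Finset.analyticAt_fun_sum _ fun j hj => (hf _ (node_mem hc hj)).fun_mul analyticAt_const

lemma analyticAt_coeff_interp {c : ℝ} (hc : 0 < c) (N : ℕ) {f : E → ℝ → ℝ} {w : E}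
    (hf : ∀ t ∈ Ioo 0 c, AnalyticAt ℝ (fun w => f w t) w) (k : ℕ) :
    AnalyticAt ℝ (fun w => (interp c N (f w)).coeff k) w := by
  simp only [interp_eq_sum, finsetSum_coeff, coeff_C_mul]
  exact Finset.analyticAt_fun_sum _ fun j hj => (hf _ (node_mem hc hj)).fun_mul analyticAt_const

variable {f : E → ℝ → ℝ} {P : E → ℝ[X]}

/-- A bound for the degrees of an analytic family of polynomials propagates over balls. -/
lemma natDegree_le_of_isOpen {c δ : ℝ} (hc : 0 < c) {w₀ : E} {N : ℕ}
    (hf : ∀ w ∈ Metric.ball w₀ δ, ∀ t ∈ Ioo 0 c, AnalyticAt ℝ (fun w => f w t) w ∧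
      f w t = (P w).eval t) {O : Set E} (hO : IsOpen O) (hOne : O.Nonempty)
    (hOB : O ⊆ Metric.ball w₀ δ) (hON : ∀ w ∈ O, (P w).natDegree ≤ N) :
    ∀ w ∈ Metric.ball w₀ δ, (P w).natDegree ≤ N := by
  intro w hw
  rw [natDegree_le_iff_eq_eval_interp hc fun t ht => (hf w hw t ht).2]
  intro t ht
  have h1 : AnalyticOnNhd ℝ (fun w => f w t) (Metric.ball w₀ δ) := fun w hw => (hf w hw t ht).1
  have h2 : AnalyticOnNhd ℝ (fun w => (interp c N (f w)).eval t) (Metric.ball w₀ δ) :=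
    fun w hw => analyticAt_eval_interp hc N (fun t ht => (hf w hw t ht).1) t
  obtain ⟨v, hv⟩ := hOne
  refine h1.eqOn_of_preconnected_of_eventuallyEq h2 (convex_ball w₀ δ).isPreconnected (hOB hv)
    ?_ hw
  filter_upwards [hO.mem_nhds hv] with u hu
  exact (natDegree_le_iff_eq_eval_interp hc fun t ht => (hf u (hOB hu) t ht).2).1 (hON u hu) t ht

/-- By Baire's theorem the degrees of an analytic family of polynomials are bounded on some open
set. -/
lemma exists_isOpen_natDegree_le [CompleteSpace E] {c δ : ℝ} (hc : 0 < c) (hδ : 0 < δ) {w₀ : E}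
    (hf : ∀ w ∈ Metric.ball w₀ δ, ∀ t ∈ Ioo 0 c, AnalyticAt ℝ (fun w => f w t) w ∧
      f w t = (P w).eval t) :
    ∃ N : ℕ, ∃ O ⊆ Metric.ball w₀ δ, IsOpen O ∧ O.Nonempty ∧ ∀ w ∈ O, (P w).natDegree ≤ N := by
  have hB : IsOpen (Metric.ball w₀ δ) := Metric.isOpen_ball
  have := hB.baireSpace
  have : Nonempty (Metric.ball w₀ δ) := ⟨⟨w₀, Metric.mem_ball_self hδ⟩⟩
  set S : ℕ → Set (Metric.ball w₀ δ) := fun N => {w | (P w).natDegree ≤ N} with hS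
  have hcl : ∀ N, IsClosed (S N) := by
    intro N
    have h1 : S N = ⋂ t ∈ Ioo 0 c,
        {w : Metric.ball w₀ δ | f w t = (interp c N (f w)).eval t} := by
      ext w
      simp only [hS, mem_ofPred_eq, mem_iInter₂]
      exact natDegree_le_iff_eq_eval_interp hc fun t ht => (hf w w.2 t ht).2
    rw [h1]
    refine isClosed_biInter fun t ht => isClosed_eq ?_ ?_
    · refine continuous_iff_continuousAt.2 fun w => ?_
      exact ContinuousAt.comp' (g := fun w => f w t) (f := fun w : Metric.ball w₀ δ => (w : E))
        (hf w w.2 t ht).1.continuousAt continuousAt_subtype_val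
    · refine continuous_iff_continuousAt.2 fun w => ?_
      exact ContinuousAt.comp' (g := fun w => (interp c N (f w)).eval t)
        (f := fun w : Metric.ball w₀ δ => (w : E))
        (analyticAt_eval_interp hc N (fun t ht => (hf w w.2 t ht).1) t).continuousAt
        continuousAt_subtype_val
  obtain ⟨N, hN⟩ := nonempty_interior_of_iUnion_of_closed hcl
    (eq_univ_of_forall fun w => mem_iUnion.2 ⟨(P w).natDegree, le_refl (P w).natDegree⟩)
  refine ⟨N, Subtype.val '' interior (S N), ?_, hB.isOpenMap_subtype_val _ isOpen_interior,
    hN.image _, ?_⟩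
  · rintro _ ⟨w, -, rfl⟩
    exact w.2
  · rintro _ ⟨w, hw, rfl⟩
    exact (interior_subset hw : w ∈ S N)

/-- The degrees of an analytic family of polynomials over a connected set are bounded. -/
lemma exists_natDegree_le [CompleteSpace E] {Ω : Set E} (hΩ : IsPreconnected Ω)
    (hf : ∀ w₀ ∈ Ω, ∃ c > 0, ∀ᶠ w in 𝓝 w₀, ∀ t ∈ Ioo 0 c, AnalyticAt ℝ (fun w => f w t) w ∧
      f w t = (P w).eval t) :
    ∃ N : ℕ, ∀ w ∈ Ω, (P w).natDegree ≤ N := by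
  rcases Ω.eq_empty_or_nonempty with rfl | ⟨w₀, hw₀⟩
  · exact ⟨0, fun w hw => absurd hw (notMem_empty w)⟩
  have hf' : ∀ w₀ ∈ Ω, ∃ c > 0, ∃ δ > 0, ∀ w ∈ Metric.ball w₀ δ, ∀ t ∈ Ioo 0 c,
      AnalyticAt ℝ (fun w => f w t) w ∧ f w t = (P w).eval t := by
    intro w₀ hw₀
    obtain ⟨c, hc, h⟩ := hf w₀ hw₀
    obtain ⟨δ, hδ, h'⟩ := Metric.eventually_nhds_iff_ball.1 h
    exact ⟨c, hc, δ, hδ, h'⟩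
  obtain ⟨c, hc, δ, hδ, hball⟩ := hf' w₀ hw₀
  obtain ⟨N, O, hOB, hO, hOne, hON⟩ := exists_isOpen_natDegree_le hc hδ hball
  have hN := natDegree_le_of_isOpen hc hball hO hOne hOB hON
  -- This set is open. It is also relatively closed: a ball about a point of its closure meets it in
  -- an open set, from which the bound spreads over the ball.
  set u : Set E := {w | ∀ᶠ v in 𝓝 w, (P v).natDegree ≤ N} with hu
  have huo : IsOpen u := isOpen_setOfPred_eventually_nhds
  have hw₀u : w₀ ∈ u := by
    filter_upwards [Metric.ball_mem_nhds w₀ hδ] with v hv using hN v hv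
  refine ⟨N, fun w hw => (?_ : ∀ᶠ v in 𝓝 w, (P v).natDegree ≤ N).self_of_nhds⟩
  refine hΩ.subset_of_closure_inter_subset huo ⟨w₀, hw₀, hw₀u⟩ ?_ hw
  rintro w ⟨hwu, hw⟩
  obtain ⟨c, hc, δ, hδ, hball⟩ := hf' w hw
  have hne : (Metric.ball w δ ∩ u).Nonempty :=
    mem_closure_iff.1 hwu _ Metric.isOpen_ball (Metric.mem_ball_self hδ)
  have := natDegree_le_of_isOpen hc hball (Metric.isOpen_ball.inter huo) hne inter_subset_left
    fun v hv => (hv.2 : ∀ᶠ v in 𝓝 v, (P v).natDegree ≤ N).self_of_nhds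
  filter_upwards [Metric.ball_mem_nhds w hδ] with v hv using this v hv

/-- Once the degree is bounded, each coefficient is a fixed linear combination of the values at the
nodes. -/
lemma analyticAt_coeff {c : ℝ} (hc : 0 < c) {w₀ : E} {N : ℕ}
    (hf : ∀ᶠ w in 𝓝 w₀, ∀ t ∈ Ioo 0 c, AnalyticAt ℝ (fun w => f w t) w ∧
      f w t = (P w).eval t) (hN : ∀ᶠ w in 𝓝 w₀, (P w).natDegree ≤ N) (k : ℕ) :
    AnalyticAt ℝ (fun w => (P w).coeff k) w₀ := by
  refine (analyticAt_coeff_interp hc N (fun t ht => (hf.self_of_nhds t ht).1) k).congr ?_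
  filter_upwards [hf, hN] with w h1 h2
  rw [← eq_interp hc (fun t ht => (h1 t ht).2) h2]

/-- A polynomial which is `O(t ^ k)` at the origin is divisible by `X ^ k`. -/
lemma coeff_eq_zero_of_abs_eval_le {p : ℝ[X]} {c C : ℝ} (hc : 0 < c) {k : ℕ}
    (h : ∀ t ∈ Ioo 0 c, |p.eval t| ≤ C * t ^ k) {j : ℕ} (hj : j < k) : p.coeff j = 0 := by
  induction j using Nat.strong_induction_on with
  | _ j ih =>
    -- With the lower coefficients gone, `X ^ j` factors out; dividing the bound by `t ^ j` and
    -- letting `t → 0` gives `q(0) = 0`.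
    obtain ⟨q, hq⟩ := (X_pow_dvd_iff (n := j)).2 fun d hd => ih d hd (hd.trans hj)
    rw [hq, coeff_X_pow_mul', if_pos le_rfl, Nat.sub_self]
    have h1 : Tendsto (fun t : ℝ => |q.eval t|) (𝓝[>] 0) (𝓝 |q.eval 0|) :=
      (q.continuous.abs.tendsto 0).mono_left nhdsWithin_le_nhds
    have h2 : Tendsto (fun t : ℝ => C * t ^ (k - j)) (𝓝[>] 0) (𝓝 0) := by
      have : Continuous fun t : ℝ => C * t ^ (k - j) := by fun_prop
      have h3 := (this.tendsto 0).mono_left (nhdsWithin_le_nhds (s := Ioi (0 : ℝ)))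
      simpa [zero_pow (Nat.sub_ne_zero_of_lt hj)] using h3
    have h3 : |q.eval 0| ≤ 0 := by
      refine le_of_tendsto_of_tendsto h1 h2 ?_
      filter_upwards [Ioo_mem_nhdsGT hc] with t ht
      have h4 := h t ht
      have h5 : 0 < t ^ j := pow_pos ht.1 j
      rw [hq, eval_mul, eval_pow, eval_X, abs_mul, abs_of_pos h5,
        ← Nat.add_sub_of_le hj.le, pow_add] at h4
      exact le_of_mul_le_mul_left (by linarith) h5
    rw [coeff_zero_eq_eval_zero]
    exact abs_nonpos_iff.1 h3

end PolynomialFamily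

end PolyIntegrable

/-! ### Section volumes as polynomials in the height -/

namespace PolyIntegrable

open Polynomial

variable {n : ℕ} {M : Set (Space n)}

namespace IsAdmissible

variable (hA : IsAdmissible M)
include hA

/-- Polynomial integrability concerns only small heights, depending on the point; analyticity in the
height carries the identity to the whole cap. -/
lemma sectionVolume_eq_eval {ξ : Space n} {c ε : ℝ} {p : ℝ[X]} (hξ : ‖ξ‖ = 1)
    (hg : ∀ᶠ v in 𝓝 ξ, IsGoodCap M (‖v‖⁻¹ • v) c) (hε : 0 < ε)
    (hp : ∀ t ∈ Ico 0 ε, sectionVolume M (gaussInv M ξ) t = p.eval t) {t : ℝ}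
    (ht : t ∈ Ioo 0 c) : sectionVolume M (gaussInv M ξ) t = p.eval t := by
  have hξ0 : ξ ≠ 0 := by
    rintro rfl
    simp at hξ
  have hc : 0 < c := ht.1.trans ht.2
  have h1 : AnalyticOnNhd ℝ (fun t => sectionVolume M (gaussInv M ξ) t) (Ioo 0 c) := by
    intro s hs
    have h2 : AnalyticAt ℝ (fun s : ℝ => (ξ, s)) s := analyticAt_const.prod analyticAt_id
    have h3 := AnalyticAt.fun_comp (f := fun s : ℝ => (ξ, s))
      (g := fun p : Space n × ℝ => sectionVolume M (gaussInv M (‖p.1‖⁻¹ • p.1)) p.2)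
      (hA.analyticAt_sectionVolume hξ0 hg hs) h2
    simpa [hξ] using h3
  have h2 : AnalyticOnNhd ℝ (fun t => p.eval t) (Ioo 0 c) := fun s _ =>
    AnalyticAt.aeval_polynomial analyticAt_id p
  have hm : 0 < min ε c := lt_min hε hc
  refine h1.eqOn_of_preconnected_of_eventuallyEq h2 isPreconnected_Ioo (z₀ := min ε c / 2)
    ⟨by positivity, by linarith [min_le_right ε c]⟩ ?_ ht
  filter_upwards [Ioo_mem_nhds (half_pos hm) (by linarith [min_le_left ε c] : min ε c / 2 < ε)]
    with s hs
  exact hp s ⟨hs.1.le, hs.2⟩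

/-- The section volumes of a polynomially integrable hypersurface are given by a family of
polynomials in the height, which has bounded degree and coefficients depending analytically on the
normal direction. -/
theorem exists_section_polynomials (hodd : Odd n) (hpoly : IsPolynomiallyIntegrable M) :
    ∃ (N : ℕ) (P : Space n → ℝ[X]), (∀ ξ ∈ normals M, (P ξ).natDegree ≤ N) ∧
      (∀ w ∈ coneOver (normals M), ∀ k,
        AnalyticAt ℝ (fun w => (P (‖w‖⁻¹ • w)).coeff k) w) ∧
      (∀ ξ ∈ normals M, ∀ j < (n - 1) / 2, (P ξ).coeff j = 0) ∧
      ∀ ξ c, ‖ξ‖ = 1 → (∀ᶠ v in 𝓝 ξ, IsGoodCap M (‖v‖⁻¹ • v) c) → ∀ t ∈ Ioo 0 c,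
        sectionVolume M (gaussInv M ξ) t = (P ξ).eval t := by
  have hex : ∀ ξ : Space n, ∃ p : ℝ[X], ξ ∈ normals M → ∃ ε : ℝ, 0 < ε ∧
      ∀ t ∈ Ico 0 ε, sectionVolume M (gaussInv M ξ) t = p.eval t := by
    intro ξ
    by_cases hξ : ξ ∈ normals M
    · obtain ⟨ε, hε, p, hp⟩ := hpoly _ (gaussInv_mem hξ)
      exact ⟨p, fun _ => ⟨ε, hε, hp⟩⟩
    · exact ⟨0, fun h => absurd h hξ⟩
  choose P hP using hex
  have heval : ∀ ξ c, ‖ξ‖ = 1 → (∀ᶠ v in 𝓝 ξ, IsGoodCap M (‖v‖⁻¹ • v) c) → ∀ t ∈ Ioo 0 c,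
      sectionVolume M (gaussInv M ξ) t = (P ξ).eval t := by
    intro ξ c hξ hg t ht
    have hξn : ξ ∈ normals M := by simpa [hξ] using hg.self_of_nhds.mem
    obtain ⟨ε, hε, hp⟩ := hP ξ hξn
    exact hA.sectionVolume_eq_eval hξ hg hε hp ht
  have hcap : ∀ w₀ ∈ coneOver (normals M), ∃ c C : ℝ, 0 < c ∧ 0 ≤ C ∧ ∀ᶠ w in 𝓝 w₀,
      w ≠ 0 ∧ IsGoodCap M (‖w‖⁻¹ • w) c ∧ ∀ x ∈ convexHull ℝ M, ∀ t ∈ Ioc 0 c,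
        height M (‖w‖⁻¹ • w) x = t → ‖x - gaussInv M (‖w‖⁻¹ • w)‖ ≤ C * √t := by
    intro w₀ hw₀
    obtain ⟨c, C, hc, hC, h⟩ := hA.exists_uniform_cap hw₀.2
    refine ⟨c, C, hc, hC, ?_⟩
    filter_upwards [(analyticAt_normalize hw₀.1).continuousAt.eventually h,
      isOpen_compl_singleton.mem_nhds hw₀.1] with w h1 h2
    exact ⟨h2, h1 (norm_normalize h2)⟩
  have hgood : ∀ (w : Space n) (c : ℝ), w ≠ 0 → (∀ᶠ v in 𝓝 w, IsGoodCap M (‖v‖⁻¹ • v) c) →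
      ∀ᶠ v in 𝓝 (‖w‖⁻¹ • w), IsGoodCap M (‖v‖⁻¹ • v) c := by
    intro w c hw h
    have hw' := norm_pos_iff.2 hw
    have h1 : Tendsto (fun v : Space n => ‖w‖ • v) (𝓝 (‖w‖⁻¹ • w)) (𝓝 w) := by
      have : Continuous fun v : Space n => ‖w‖ • v := by fun_prop
      simpa [smul_smul, hw'.ne'] using this.tendsto (‖w‖⁻¹ • w)
    filter_upwards [h1.eventually h] with v hv
    rwa [norm_smul, norm_norm, mul_inv, mul_comm, smul_smul, mul_assoc, inv_mul_cancel₀ hw'.ne',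
      mul_one] at hv
  have hfam : ∀ w₀ ∈ coneOver (normals M), ∃ c > 0, ∀ᶠ w in 𝓝 w₀, ∀ t ∈ Ioo 0 c,
      AnalyticAt ℝ (fun w => sectionVolume M (gaussInv M (‖w‖⁻¹ • w)) t) w ∧
        sectionVolume M (gaussInv M (‖w‖⁻¹ • w)) t = (P (‖w‖⁻¹ • w)).eval t := by
    intro w₀ hw₀
    obtain ⟨c, C, hc, -, h⟩ := hcap w₀ hw₀
    refine ⟨c, hc, ?_⟩
    filter_upwards [eventually_eventually_nhds.2 h] with w hw t ht
    have hw0 := hw.self_of_nhds.1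
    have hg : ∀ᶠ v in 𝓝 w, IsGoodCap M (‖v‖⁻¹ • v) c := hw.mono fun v hv => hv.2.1
    refine ⟨?_, heval _ c (norm_normalize hw0) (hgood w c hw0 hg) t ht⟩
    have h2 : AnalyticAt ℝ (fun w : Space n => (w, t)) w := analyticAt_id.prod analyticAt_const
    exact AnalyticAt.fun_comp (f := fun w : Space n => (w, t))
      (g := fun p : Space n × ℝ => sectionVolume M (gaussInv M (‖p.1‖⁻¹ • p.1)) p.2)
      (hA.analyticAt_sectionVolume hw0 hg ht) h2
  have hpre : IsPreconnected (coneOver (normals M)) := by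
    have h1 : IsPreconnected (normals M) :=
      hA.connected.isPreconnected.image _ hA.continuousOn_gaussMap
    have h2 : coneOver (normals M) =
        (fun p : ℝ × Space n => p.1 • p.2) '' (Ioi 0 ×ˢ normals M) := by
      ext w
      constructor
      · rintro ⟨hw, hwn⟩
        have := norm_pos_iff.2 hw
        exact ⟨(‖w‖, ‖w‖⁻¹ • w), ⟨this, hwn⟩, by simp [smul_smul, this.ne']⟩
      · rintro ⟨⟨r, ξ⟩, ⟨hr, hξ⟩, rfl⟩
        have hr' : 0 < r := hr
        have h1 := hA.norm_normal hξ
        refine ⟨?_, ?_⟩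
        · rw [← norm_pos_iff, norm_smul, h1, mul_one, Real.norm_of_nonneg hr'.le]
          exact hr'
        · simp only [norm_smul, h1, mul_one, Real.norm_of_nonneg hr'.le, smul_smul,
            inv_mul_cancel₀ hr'.ne', one_smul]
          exact hξ
    rw [h2]
    exact (isPreconnected_Ioi.prod h1).image _ (by fun_prop)
  obtain ⟨N, hN⟩ := exists_natDegree_le (P := fun w => P (‖w‖⁻¹ • w)) hpre hfam
  have hcone : ∀ ξ ∈ normals M, ξ ∈ coneOver (normals M) := fun ξ hξ =>
    (mem_coneOver_of_norm_eq_one (hA.norm_normal hξ)).2 hξ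
  have hself : ∀ ξ ∈ normals M, ‖ξ‖⁻¹ • ξ = ξ := fun ξ hξ => by simp [hA.norm_normal hξ]
  refine ⟨N, P, fun ξ hξ => ?_, fun w hw k => ?_, fun ξ hξ j hj => ?_, heval⟩
  · simpa only [hself ξ hξ] using hN ξ (hcone ξ hξ)
  · obtain ⟨c, hc, h⟩ := hfam w hw
    refine analyticAt_coeff (P := fun w => P (‖w‖⁻¹ • w)) hc h (N := N) ?_ k
    filter_upwards [hA.gauss.2.1.isOpen_coneOver.mem_nhds hw] with v hv using hN v hv
  · obtain ⟨c, C, hc, hC, h⟩ := hcap ξ (hcone ξ hξ)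
    obtain ⟨-, hg, hq⟩ := h.self_of_nhds
    simp only [hself ξ hξ] at hg hq
    refine coeff_eq_zero_of_abs_eval_le (C := C ^ (n - 1) *
      volume.real (Metric.closedBall (0 : Space (n - 1)) 1)) hc (fun t ht => ?_) hj
    have h0 : 0 ≤ sectionVolume M (gaussInv M ξ) t := measureReal_nonneg
    rw [← heval ξ c (hA.norm_normal hξ) (h.mono fun v hv => hv.2.1) t ht, abs_of_nonneg h0]
    have h1 := hA.sectionVolume_le hg hC ht fun x hx hxt => hq x hx t ⟨ht.1, ht.2.le⟩ hxt
    -- Oddness of `n` enters here: the order of vanishing is an integer.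
    have h2 : √t ^ (n - 1) = t ^ ((n - 1) / 2) := by
      obtain ⟨k, rfl⟩ := hodd
      rw [Nat.add_sub_cancel, Nat.mul_div_cancel_left k two_pos, pow_mul, Real.sq_sqrt ht.1.le]
    rwa [h2] at h1

end IsAdmissible

end PolyIntegrable

/-! ### One-dimensional oscillating integrals -/

namespace PolyIntegrable

section OneDimensional

variable {φ : ℝ → ℝ} {c l : ℝ}

lemma hasDerivAt_amplitude (hφ : ContDiff ℝ ∞ φ) (l t : ℝ) :
    HasDerivAt (amplitude φ l)
      (Complex.I * l * amplitude φ l t + amplitude (deriv φ) l t) t := by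
  have h1 : HasDerivAt (fun t : ℝ => Complex.I * l * (t : ℂ)) (Complex.I * l * 1) t :=
    (Complex.ofRealCLM.hasDerivAt (x := t)).const_mul _
  have h2 : HasDerivAt (fun t : ℝ => (φ t : ℂ)) (deriv φ t : ℝ) t :=
    ((hφ.differentiable (by simp)) t).hasDerivAt.ofReal_comp
  refine (h1.cexp.mul h2).congr_deriv ?_
  unfold amplitude
  ring

lemma integral_amplitude_eq (hφ : ContDiff ℝ ∞ φ) (hφc : φ c = 0) (hl : l ≠ 0) :
    ∫ t in (0 : ℝ)..c, amplitude φ l t =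
      Complex.I / l * (φ 0 + ∫ t in (0 : ℝ)..c, amplitude (deriv φ) l t) := by
  have hφ' : ContDiff ℝ ∞ (deriv φ) := hφ.iterate_deriv 1
  have hi : ∀ {ψ : ℝ → ℝ}, ContDiff ℝ ∞ ψ →
      IntervalIntegrable (amplitude ψ l) volume 0 c := fun hψ =>
    (contDiff_amplitude hψ l).continuous.intervalIntegrable _ _
  have h1 := intervalIntegral.integral_eq_sub_of_hasDerivAt
    (fun t _ => hasDerivAt_amplitude hφ l t) (((hi hφ).const_mul _).add (hi hφ'))
  rw [intervalIntegral.integral_add ((hi hφ).const_mul _) (hi hφ'),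
    intervalIntegral.integral_const_mul] at h1
  have h2 : amplitude φ l c = 0 := by simp [amplitude, hφc]
  have h3 : amplitude φ l 0 = φ 0 := by simp [amplitude]
  rw [h2, h3] at h1
  have h4 : (l : ℂ) ≠ 0 := by exact_mod_cast hl
  field_simp
  have h5 : (φ 0 : ℂ) + ∫ t in (0 : ℝ)..c, amplitude (deriv φ) l t =
      -(Complex.I * l * ∫ t in (0 : ℝ)..c, amplitude φ l t) := by linear_combination h1
  rw [h5]
  linear_combination ((∫ t in (0 : ℝ)..c, amplitude φ l t) * (l : ℂ)) * Complex.I_sq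

/-- Expansion of a one-dimensional oscillating integral by repeated integration by parts. -/
lemma integral_amplitude_expand (hφ : ContDiff ℝ ∞ φ) (hφc : ∀ j, iteratedDeriv j φ c = 0)
    (hl : l ≠ 0) (m : ℕ) :
    ∫ t in (0 : ℝ)..c, amplitude φ l t =
      ∑ j ∈ Finset.range m, (Complex.I / l) ^ (j + 1) * (iteratedDeriv j φ 0 : ℝ) +
        (Complex.I / l) ^ m * ∫ t in (0 : ℝ)..c, amplitude (iteratedDeriv m φ) l t := by
  induction m with
  | zero => simp
  | succ m ih =>
    have hm : ContDiff ℝ ∞ (iteratedDeriv m φ) := by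
      rw [iteratedDeriv_eq_iterate]
      exact hφ.iterate_deriv m
    rw [ih, integral_amplitude_eq hm (hφc m) hl, ← iteratedDeriv_succ, Finset.sum_range_succ]
    ring

lemma norm_amplitude (φ : ℝ → ℝ) (l t : ℝ) : ‖amplitude φ l t‖ = |φ t| := by
  have : Complex.I * l * t = ((l * t : ℝ) : ℂ) * Complex.I := by
    push_cast
    ring
  rw [amplitude, norm_mul, this, Complex.norm_exp_ofReal_mul_I, one_mul, Complex.norm_real,
    Real.norm_eq_abs]

/-- The error in the asymptotic formula for the oscillating integral of `t ^ k ρ(t)`. -/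
noncomputable def momentError (ρ : ℝ → ℝ) (c : ℝ) (k : ℕ) (l : ℝ) : ℂ :=
  (∫ t in (0 : ℝ)..c, amplitude (fun t => t ^ k * ρ t) l t) -
    k.factorial * (Complex.I / l) ^ (k + 1)

/-- The error `momentError` decays rapidly. -/
lemma IsCutoff.exists_norm_momentError_le {ρ : ℝ → ℝ} (hρ : IsCutoff ρ c) (hc : 0 < c)
    (k m : ℕ) : ∃ D : ℝ, ∀ l : ℝ, 1 ≤ l → ‖momentError ρ c k l‖ * l ^ m ≤ D := by
  set φ : ℝ → ℝ := fun t => t ^ k * ρ t with hφ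
  have hφs : ContDiff ℝ ∞ φ := (contDiff_id.pow k).mul hρ.1
  -- At least `k + 1` integrations by parts, so that the one nonzero boundary term is reached, and
  -- at least `m` for the decay.
  set q := max m (k + 1) with hq
  -- Near `0` the function is exactly `t ^ k`, so only the derivative of order `k` survives at `0`.
  have hφ0 : ∀ j, iteratedDeriv j φ 0 = if j = k then (k.factorial : ℝ) else 0 := by
    intro j
    have h1 : φ =ᶠ[𝓝 0] fun t => t ^ k := by
      filter_upwards [hρ.2.1] with t ht
      simp [hφ, ht]
    rw [h1.iteratedDeriv_eq, iteratedDeriv_fun_pow_zero]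
    push_cast
    rfl
  have hφc : ∀ j, iteratedDeriv j φ c = 0 := by
    intro j
    have h1 : ρ =ᶠ[𝓝 c] 0 := by
      refine notMem_tsupport_iff_eventuallyEq.1 fun h => ?_
      exact (hρ.2.2 h).2.false
    have h2 : φ =ᶠ[𝓝 c] fun _ => 0 := by
      filter_upwards [h1] with t ht
      simp [hφ, ht]
    rw [h2.iteratedDeriv_eq]
    simp
  have hqs : Continuous (iteratedDeriv q φ) := by
    rw [iteratedDeriv_eq_iterate]
    exact (hφs.iterate_deriv q).continuous
  obtain ⟨B, hB⟩ := (isCompact_Icc (a := (0 : ℝ)) (b := c)).exists_bound_of_continuousOn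
    hqs.continuousOn
  refine ⟨B * c, fun l hl => ?_⟩
  have hl0 : 0 < l := by linarith
  have hsum : ∑ j ∈ Finset.range q, (Complex.I / l) ^ (j + 1) * (iteratedDeriv j φ 0 : ℝ) =
      k.factorial * (Complex.I / l) ^ (k + 1) := by
    rw [Finset.sum_eq_single k]
    · rw [hφ0 k, if_pos rfl]
      push_cast
      ring
    · intro j _ hj
      rw [hφ0 j, if_neg hj]
      simp
    · intro h
      exact absurd (Finset.mem_range.2 (lt_of_lt_of_le (Nat.lt_succ_self k) (le_max_right _ _))) h
  have hJ : ‖∫ t in (0 : ℝ)..c, amplitude (iteratedDeriv q φ) l t‖ ≤ B * c := by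
    have := intervalIntegral.norm_integral_le_of_norm_le_const (a := (0 : ℝ)) (b := c) (C := B)
      (f := amplitude (iteratedDeriv q φ) l) fun t ht => by
        rw [uIoc_of_le hc.le] at ht
        rw [norm_amplitude]
        exact hB t ⟨ht.1.le, ht.2⟩
    simpa [abs_of_pos hc] using this
  have hme : momentError ρ c k l =
      (Complex.I / l) ^ q * ∫ t in (0 : ℝ)..c, amplitude (iteratedDeriv q φ) l t := by
    rw [momentError, ← hφ, integral_amplitude_expand hφs hφc hl0.ne' q, hsum, add_sub_cancel_left]
  rw [hme, norm_mul, norm_pow, norm_div, Complex.norm_I, Complex.norm_real,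
    Real.norm_of_nonneg hl0.le]
  have h1 : (1 / l) ^ q * l ^ m ≤ 1 := by
    rw [div_pow, one_pow, div_mul_eq_mul_div, one_mul, div_le_one (by positivity)]
    exact pow_le_pow_right₀ hl (le_max_left _ _)
  calc (1 / l) ^ q * ‖∫ t in (0 : ℝ)..c, amplitude (iteratedDeriv q φ) l t‖ * l ^ m
      = ((1 / l) ^ q * l ^ m) * ‖∫ t in (0 : ℝ)..c, amplitude (iteratedDeriv q φ) l t‖ := by ring
    _ ≤ 1 * (B * c) := by gcongr
    _ = B * c := one_mul _

end OneDimensional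

open Polynomial in
/-- The oscillating integral over a cap whose section volumes are given by a polynomial. -/
lemma IsAdmissible.oscIntegral_eq_sum {n : ℕ} {M : Set (Space n)} (hA : IsAdmissible M)
    {ξ : Space n} {c : ℝ} (hg : IsGoodCap M ξ c) {ρ : ℝ → ℝ} (hρ : IsCutoff ρ c) {P : ℝ[X]}
    {N : ℕ} (hN : P.natDegree ≤ N) (hP0 : P.coeff 0 = 0)
    (hP : ∀ t ∈ Ioo 0 c, sectionVolume M (gaussInv M ξ) t = P.eval t) (l : ℝ) :
    oscIntegral M ρ ξ l = phase M ξ l * ∑ k ∈ Finset.range (N + 1), (P.derivative.coeff k : ℂ) *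
      (Complex.I * l * ∫ t in (0 : ℝ)..c, amplitude (fun t => t ^ k * ρ t) l t) := by
  have hc := hg.pos
  have hsm := contDiff_amplitude hρ.1 l
  have h1 : ∫ s in (0 : ℝ)..c, (sectionVolume M (gaussInv M ξ) s : ℂ) * deriv (amplitude ρ l) s =
      ∫ s in (0 : ℝ)..c, ((P.eval s : ℝ) : ℂ) * deriv (amplitude ρ l) s := by
    rw [intervalIntegral.integral_of_le hc.le, intervalIntegral.integral_of_le hc.le,
      integral_Ioc_eq_integral_Ioo, integral_Ioc_eq_integral_Ioo]
    exact setIntegral_congr_fun measurableSet_Ioo fun t ht => by simp only [hP t ht]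
  have hPd : ∀ t : ℝ, HasDerivAt (fun t : ℝ => ((P.eval t : ℝ) : ℂ))
      ((P.derivative.eval t : ℝ) : ℂ) t := fun t => (P.hasDerivAt t).ofReal_comp
  have h2 := intervalIntegral.integral_mul_deriv_eq_deriv_mul (a := (0 : ℝ)) (b := c)
    (fun t _ => hPd t)
    (fun t _ => (hsm.differentiable (by simp) t).hasDerivAt)
    ((Complex.continuous_ofReal.comp P.derivative.continuous).intervalIntegrable _ _)
    ((hsm.continuous_deriv (by simp)).intervalIntegrable _ _)
  -- Both boundary terms vanish: at `c` by the cut-off, at `0` because `P` has no constant term.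
  have h3 : amplitude ρ l c = 0 := by simp [amplitude, hρ.eq_zero le_rfl]
  have h4 : P.eval 0 = 0 := by rw [← coeff_zero_eq_eval_zero, hP0]
  rw [h3, h4, mul_zero, Complex.ofReal_zero, zero_mul, sub_zero, zero_sub] at h2
  have hdeg : P.derivative.natDegree < N + 1 :=
    Nat.lt_succ_of_le ((natDegree_derivative_le P).trans ((Nat.sub_le _ _).trans hN))
  have h5 : ∫ s in (0 : ℝ)..c, ((P.derivative.eval s : ℝ) : ℂ) * amplitude ρ l s =
      ∑ k ∈ Finset.range (N + 1), (P.derivative.coeff k : ℂ) *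
        ∫ t in (0 : ℝ)..c, amplitude (fun t => t ^ k * ρ t) l t := by
    simp only [← intervalIntegral.integral_const_mul]
    rw [← intervalIntegral.integral_finsetSum]
    · congr 1
      funext s
      rw [eval_eq_sum_range' hdeg]
      push_cast
      rw [Finset.sum_mul]
      refine Finset.sum_congr rfl fun k _ => ?_
      unfold amplitude
      push_cast
      ring
    · intro k _
      exact ((contDiff_amplitude ((contDiff_id.pow k).mul hρ.1) l).continuous.intervalIntegrable
        _ _).const_mul _
  rw [hA.oscIntegral_eq hg hρ, h1, h2, h5, mul_neg, neg_neg, mul_assoc, Finset.mul_sum]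
  congr 1
  exact Finset.sum_congr rfl fun k _ => by ring

end PolyIntegrable

/-! ### Derivatives of oscillating factors -/

namespace PolyIntegrable

section Wave

/-- The oscillating factor `exp(i l h)`. -/
noncomputable def wave {E : Type} (h : E → ℝ) (l : ℝ) (w : E) : ℂ := Complex.exp (Complex.I * l * h w)

lemma norm_wave {E : Type} (h : E → ℝ) (l : ℝ) (w : E) : ‖wave h l w‖ = 1 := by
  have : Complex.I * l * h w = ((l * h w : ℝ) : ℂ) * Complex.I := by
    push_cast
    ring
  rw [wave, this, Complex.norm_exp_ofReal_mul_I]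

variable {E : Type} [NormedAddCommGroup E] [NormedSpace ℝ E] {Ω : Set E} {h : E → ℝ}

lemma contDiffOn_wave (hh : ContDiffOn ℝ ∞ h Ω) (l : ℝ) : ContDiffOn ℝ ∞ (wave h l) Ω :=
  (contDiffOn_const.mul (Complex.ofRealCLM.contDiff.comp_contDiffOn hh)).cexp

variable {G : Type} [NormedAddCommGroup G] [NormedSpace ℝ G] [NormedSpace ℂ G]
  [IsScalarTower ℝ ℂ G]

lemma fderiv_wave_smul {a : E → G} {l : ℝ} {w : E} (hh : DifferentiableAt ℝ h w)
    (ha : DifferentiableAt ℝ a w) :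
    fderiv ℝ (fun w => wave h l w • a w) w = wave h l w • fderiv ℝ a w +
      l • (wave h l w • (fderiv ℝ h w).smulRight (Complex.I • a w)) := by
  have h1 : HasFDerivAt (fun w => ((h w : ℝ) : ℂ)) (Complex.ofRealCLM.comp (fderiv ℝ h w)) w :=
    Complex.ofRealCLM.hasFDerivAt.comp w hh.hasFDerivAt
  have h2 := ((h1.const_mul (Complex.I * l)).cexp).smul ha.hasFDerivAt
  refine h2.fderiv.trans ?_
  ext v
  simp only [_root_.add_apply, _root_.smul_apply,
    ContinuousLinearMap.smulRight_apply, ContinuousLinearMap.comp_apply,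
    Complex.ofRealCLM_apply, wave]
  congr 1
  rw [← algebraMap_smul ℂ l, ← algebraMap_smul ℂ (fderiv ℝ h w v)]
  simp only [smul_smul, smul_eq_mul, Complex.coe_algebraMap]
  congr 1
  ring

/-- Derivatives of order `k` of `exp(i l h) a` are `O(l ^ k)` on compact sets. -/
lemma exists_norm_iteratedFDeriv_wave_smul_le (hΩ : IsOpen Ω) (hh : ContDiffOn ℝ ∞ h Ω)
    {K : Set E} (hK : IsCompact K) (hKΩ : K ⊆ Ω) (k : ℕ) :
    ∀ {G : Type} [NormedAddCommGroup G] [NormedSpace ℝ G] [NormedSpace ℂ G]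
      [IsScalarTower ℝ ℂ G] {a : E → G}, ContDiffOn ℝ ∞ a Ω →
      ∃ C : ℝ, ∀ l : ℝ, 1 ≤ l → ∀ w ∈ K,
        ‖iteratedFDeriv ℝ k (fun w => wave h l w • a w) w‖ ≤ C * l ^ k := by
  -- The value space varies in the induction, since a derivative takes values in linear maps. Each
  -- derivative falling on the wave costs one factor `l`.
  induction k with
  | zero =>
    intro G _ _ _ _ a ha
    obtain ⟨C, hC⟩ := hK.exists_bound_of_continuousOn (ha.continuousOn.mono hKΩ)
    refine ⟨C, fun l _ w hw => ?_⟩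
    rw [norm_iteratedFDeriv_zero, norm_smul, norm_wave, one_mul, pow_zero, mul_one]
    exact hC w hw
  | succ k ih =>
    intro G _ _ _ _ a ha
    have ha' : ContDiffOn ℝ ∞ (fderiv ℝ a) Ω := ha.fderiv_of_isOpen hΩ (by simp)
    have hh' : ContDiffOn ℝ ∞ (fderiv ℝ h) Ω := hh.fderiv_of_isOpen hΩ (by simp)
    have hIa : ContDiffOn ℝ ∞ (fun w => Complex.I • a w) Ω := contDiffOn_const.smul ha
    have hb : ContDiffOn ℝ ∞ (fun w => (fderiv ℝ h w).smulRight (Complex.I • a w)) Ω :=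
      hh'.smulRight hIa
    obtain ⟨C₁, hC₁⟩ := ih ha'
    obtain ⟨C₂, hC₂⟩ := ih hb
    refine ⟨C₁ + C₂, fun l hl w hw => ?_⟩
    have hw' := hΩ.mem_nhds (hKΩ hw)
    have heq : fderiv ℝ (fun w => wave h l w • a w) =ᶠ[𝓝 w] (fun w => wave h l w • fderiv ℝ a w) +
        l • fun w => wave h l w • (fderiv ℝ h w).smulRight (Complex.I • a w) := by
      filter_upwards [hw'] with v hv
      exact fderiv_wave_smul ((hh.contDiffAt (hΩ.mem_nhds hv)).differentiableAt (by simp))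
        ((ha.contDiffAt (hΩ.mem_nhds hv)).differentiableAt (by simp))
    have s₁ : ContDiffAt ℝ k (fun w => wave h l w • fderiv ℝ a w) w :=
      (((contDiffOn_wave hh l).smul ha').contDiffAt hw').of_le (by exact_mod_cast le_top)
    have s₂ : ContDiffAt ℝ k
        (fun w => wave h l w • (fderiv ℝ h w).smulRight (Complex.I • a w)) w :=
      (((contDiffOn_wave hh l).smul hb).contDiffAt hw').of_le (by exact_mod_cast le_top)
    have s₃ : ContDiffAt ℝ k
        (l • fun w => wave h l w • (fderiv ℝ h w).smulRight (Complex.I • a w)) w :=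
      s₂.const_smul l
    rw [← norm_iteratedFDeriv_fderiv, (heq.iteratedFDeriv ℝ k).eq_of_nhds, iteratedFDeriv_add_apply s₁ s₃,
      iteratedFDeriv_const_smul_apply s₂]
    refine (norm_add_le _ _).trans ?_
    rw [norm_smul, Real.norm_of_nonneg (by linarith)]
    have h1 := hC₁ l hl w hw
    have h2 := hC₂ l hl w hw
    have h3 : C₁ * l ^ k ≤ C₁ * l ^ k * l := le_mul_of_one_le_right ((norm_nonneg _).trans h1) hl
    calc _ ≤ C₁ * l ^ k + l * (C₂ * l ^ k) := by gcongr
      _ ≤ C₁ * l ^ k * l + l * (C₂ * l ^ k) := by gcongr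
      _ = (C₁ + C₂) * l ^ (k + 1) := by ring

end Wave

end PolyIntegrable

/-! ### Asymptotic expansions in powers of `1 / l` -/

namespace PolyIntegrable

section Expansion

open Polynomial Asymptotics

lemma tendsto_one_div_atTop : Tendsto (fun l : ℝ => 1 / (l : ℂ)) atTop (𝓝 0) := by
  have h := (Complex.continuous_ofReal.tendsto 0).comp (tendsto_inv_atTop_zero (𝕜 := ℝ))
  simpa [Function.comp_def] using h

lemma tendsto_eval_one_div (T : ℂ[X]) :
    Tendsto (fun l : ℝ => T.eval (1 / (l : ℂ))) atTop (𝓝 (T.coeff 0)) := by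
  rw [coeff_zero_eq_eval_zero]
  exact (T.continuous.tendsto 0).comp tendsto_one_div_atTop

/-- A polynomial in `1 / l` is `o(l ^ (-N))` if and only if its coefficients up to order `N`
vanish. -/
lemma eval_one_div_isLittleO_iff (D : ℂ[X]) (N : ℕ) :
    ((fun l : ℝ => D.eval (1 / (l : ℂ))) =o[atTop] fun l : ℝ => (1 / l) ^ N) ↔
      ∀ i ≤ N, D.coeff i = 0 := by
  constructor
  · intro h i
    induction i using Nat.strong_induction_on with
    | _ i ih =>
      intro hi
      -- The first coefficient not yet known to vanish is the limit of `D` divided by the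
      -- corresponding power.
      obtain ⟨T, hT⟩ := (X_pow_dvd_iff (n := i)).2 fun d hd => ih d hd (hd.le.trans hi)
      rw [hT, coeff_X_pow_mul', if_pos le_rfl, Nat.sub_self]
      have h1 : (fun l : ℝ => T.eval (1 / (l : ℂ))) =o[atTop] fun _ => (1 : ℝ) := by
        rw [isLittleO_iff] at h ⊢
        intro ε hε
        filter_upwards [h hε, eventually_ge_atTop 1] with l hl hl1
        have hl0 : 0 < l := by linarith
        have hx : 0 < 1 / l := by positivity
        have hx1 : 1 / l ≤ 1 := (div_le_one hl0).2 hl1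
        rw [hT, eval_mul, eval_pow, eval_X, norm_mul, norm_pow, norm_div, norm_one,
          Complex.norm_real, Real.norm_of_nonneg hl0.le, norm_pow, Real.norm_of_nonneg hx.le] at hl
        rw [norm_one, mul_one]
        have h2 : (1 / l) ^ N ≤ (1 / l) ^ i := pow_le_pow_of_le_one hx.le hx1 hi
        have h3 : 0 < (1 / l) ^ i := pow_pos hx i
        refine le_of_mul_le_mul_left (hl.trans ?_) h3
        rw [mul_comm _ ε]
        gcongr
      exact tendsto_nhds_unique (tendsto_eval_one_div T) ((isLittleO_one_iff ℝ).1 h1)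
  · intro h
    obtain ⟨T, hT⟩ := (X_pow_dvd_iff (n := N + 1)).2 fun d hd => h d (Nat.lt_succ_iff.1 hd)
    have h1 : (fun l : ℝ => 1 / (l : ℂ) * T.eval (1 / (l : ℂ))) =o[atTop] fun _ => (1 : ℝ) := by
      rw [isLittleO_one_iff]
      simpa using tendsto_one_div_atTop.mul (tendsto_eval_one_div T)
    rw [isLittleO_iff] at h1 ⊢
    intro ε hε
    filter_upwards [h1 hε, eventually_gt_atTop 0] with l hl hl0
    have hx : 0 < 1 / l := by positivity
    have e : (1 : ℂ) / (l : ℂ) = ((1 / l : ℝ) : ℂ) := by push_cast; rfl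
    rw [norm_one, mul_one] at hl
    rw [hT, eval_mul, eval_pow, eval_X, pow_succ, mul_assoc, norm_mul, norm_pow, norm_pow,
      mul_comm ε]
    have h2 : ‖(1 : ℂ) / (l : ℂ)‖ = ‖1 / l‖ := by rw [e, Complex.norm_real]
    rw [h2]
    gcongr

/-- Asymptotic expansions of sums of an oscillating polynomial in `1 / l` and a rapidly decaying
term. -/
lemma isLittleO_expansion_iff {f φ R : ℝ → ℂ} {Q : ℂ[X]} {m : ℕ} (hφ : ∀ l, ‖φ l‖ = 1)
    (hf : ∀ l, 0 < l → f l = φ l * Q.eval (1 / (l : ℂ)) + R l)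
    (hR : ∀ N : ℕ, R =o[atTop] fun l : ℝ => (1 / l) ^ N) (hQ : ∀ i < m, Q.coeff i = 0)
    (β : ℕ → ℂ) :
    (∀ N : ℕ, (fun l : ℝ => f l - φ l * ((1 / (l : ℂ)) ^ m *
      ∑ j ∈ Finset.range (N + 1), β j * (1 / (l : ℂ)) ^ j)) =o[atTop]
        fun l : ℝ => (1 / l) ^ (m + N)) ↔ β = fun j => Q.coeff (j + m) := by
  -- Up to a unimodular factor and a negligible term, the error of order `N` is the polynomial `D N`
  -- in `1 / l`. The expansion thus becomes a condition on coefficients, which yields existence and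
  -- uniqueness together.
  set D : ℕ → ℂ[X] := fun N => Q - X ^ m * ∑ j ∈ Finset.range (N + 1), C (β j) * X ^ j with hD
  have hDe : ∀ N (x : ℂ), (D N).eval x =
      Q.eval x - x ^ m * ∑ j ∈ Finset.range (N + 1), β j * x ^ j := fun N x => by
    simp [hD, eval_finsetSum]
  have h1 : ∀ N : ℕ, (fun l : ℝ => f l - φ l * ((1 / (l : ℂ)) ^ m *
      ∑ j ∈ Finset.range (N + 1), β j * (1 / (l : ℂ)) ^ j)) =o[atTop]
        (fun l : ℝ => (1 / l) ^ (m + N)) ↔ ∀ i ≤ m + N, (D N).coeff i = 0 := by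
    intro N
    rw [← eval_one_div_isLittleO_iff]
    have h2 : (fun l : ℝ => f l - φ l * ((1 / (l : ℂ)) ^ m *
        ∑ j ∈ Finset.range (N + 1), β j * (1 / (l : ℂ)) ^ j)) =ᶠ[atTop]
          fun l : ℝ => φ l * (D N).eval (1 / (l : ℂ)) + R l := by
      filter_upwards [eventually_gt_atTop 0] with l hl
      rw [hf l hl, hDe]
      ring
    rw [isLittleO_congr h2 EventuallyEq.rfl, (hR (m + N)).add_iff_left]
    have h3 : ∀ l : ℝ, ‖φ l * (D N).eval (1 / (l : ℂ))‖ = ‖(D N).eval (1 / (l : ℂ))‖ := fun l => by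
      rw [norm_mul, hφ, one_mul]
    rw [← isLittleO_norm_left]
    simp only [h3]
    rw [isLittleO_norm_left]
  have h4 : ∀ N i, (D N).coeff i = Q.coeff i - if m ≤ i ∧ i ≤ m + N then β (i - m) else 0 := by
    intro N i
    simp only [hD, coeff_sub, coeff_X_pow_mul', finsetSum_coeff, coeff_C_mul, coeff_X_pow]
    congr 1
    by_cases hmi : m ≤ i
    · rw [if_pos hmi]
      by_cases hiN : i ≤ m + N
      · rw [if_pos ⟨hmi, hiN⟩, Finset.sum_eq_single (i - m)]
        · simp
        · intro j _ hj
          rw [if_neg (Ne.symm hj), mul_zero]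
        · intro h
          exact absurd (Finset.mem_range.2 (by omega)) h
      · rw [if_neg fun h => hiN h.2]
        refine Finset.sum_eq_zero fun j hj => ?_
        have := Finset.mem_range.1 hj
        rw [if_neg (by omega), mul_zero]
    · rw [if_neg hmi, if_neg fun h => hmi h.1]
  constructor
  · intro h
    funext N
    have h5 := (h1 N).1 (h N) (m + N) le_rfl
    rw [h4, if_pos ⟨Nat.le_add_right _ _, le_rfl⟩, Nat.add_sub_cancel_left, sub_eq_zero] at h5
    rw [← h5, add_comm]
  · rintro rfl N
    refine (h1 N).2 fun i hi => ?_
    rw [h4]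
    by_cases hmi : m ≤ i
    · simp only [if_pos (And.intro hmi hi), Nat.sub_add_cancel hmi, sub_self]
    · rw [if_neg fun h => hmi h.1, hQ i (by omega), sub_zero]

end Expansion

end PolyIntegrable

/-! ### Decay of the remainder -/

namespace PolyIntegrable

lemma norm_iteratedFDeriv_sum_le {E F ι : Type*} [NormedAddCommGroup E] [NormedSpace ℝ E]
    [NormedAddCommGroup F] [NormedSpace ℝ F] {k : ℕ} {w : E} (s : Finset ι) {f : ι → E → F}
    (hf : ∀ i ∈ s, ContDiffAt ℝ k (f i) w) :
    ‖iteratedFDeriv ℝ k (fun w => ∑ i ∈ s, f i w) w‖ ≤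
      ∑ i ∈ s, ‖iteratedFDeriv ℝ k (f i) w‖ := by
  classical
  induction s using Finset.induction_on with
  | empty => simp
  | insert i s hi ih =>
    have h1 : (fun w => ∑ j ∈ insert i s, f j w) = f i + fun w => ∑ j ∈ s, f j w := by
      funext w
      rw [Finset.sum_insert hi]
      rfl
    rw [h1, Finset.sum_insert hi, iteratedFDeriv_add_apply (hf i (Finset.mem_insert_self i s))
      (ContDiffAt.sum fun j hj => hf j (Finset.mem_insert_of_mem hj))]
    exact (norm_add_le _ _).trans
      (add_le_add_right (ih fun j hj => hf j (Finset.mem_insert_of_mem hj)) _)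

variable {n : ℕ} {M : Set (Space n)}

lemma norm_phase (M : Set (Space n)) (ξ : Space n) (l : ℝ) : ‖phase M ξ l‖ = 1 :=
  norm_wave (supp M) l ξ

/-- All dependence on `ξ` is in the waves and the smooth coefficients, whose derivatives grow
polynomially in `l`; the factors `G k`, independent of `ξ`, absorb this growth. -/
lemma isRapidlyDecaying_sum {U : Set (Space n)} (hU : IsOpenInSphere U)
    (hh : ContDiffOn ℝ ∞ (fun w => supp M (‖w‖⁻¹ • w)) (coneOver U)) {p : ℕ → Space n → ℝ}
    (hp : ∀ k, ContDiffOn ℝ ∞ (fun w => p k (‖w‖⁻¹ • w)) (coneOver U)) {G : ℕ → ℝ → ℂ}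
    (hG : ∀ k m : ℕ, ∃ D : ℝ, ∀ l : ℝ, 1 ≤ l → ‖G k l‖ * l ^ m ≤ D) (s : Finset ℕ) :
    IsRapidlyDecaying U fun ξ l => phase M ξ l * ∑ k ∈ s, (p k ξ : ℂ) * G k l := by
  have hΩ := hU.isOpen_coneOver
  have hpc : ∀ k, ContDiffOn ℝ ∞ (fun w => ((p k (‖w‖⁻¹ • w) : ℝ) : ℂ)) (coneOver U) := fun k =>
    Complex.ofRealCLM.contDiff.comp_contDiffOn (hp k)
  set a : ℕ → ℝ → Space n → ℂ := fun k l w =>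
    wave (fun w => supp M (‖w‖⁻¹ • w)) l w • ((p k (‖w‖⁻¹ • w) : ℝ) : ℂ) with ha
  have has : ∀ k l, ContDiffOn ℝ ∞ (a k l) (coneOver U) := fun k l =>
    (contDiffOn_wave hh l).smul (hpc k)
  have hR : ∀ l, (homExt fun ξ => phase M ξ l * ∑ k ∈ s, (p k ξ : ℂ) * G k l) =
      fun w => ∑ k ∈ s, (G k l • a k l) w := by
    intro l
    funext w
    simp only [homExt, Finset.mul_sum]
    refine Finset.sum_congr rfl fun k _ => ?_
    simp only [ha, Pi.smul_apply, smul_eq_mul, wave, phase]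
    ring
  refine ⟨fun l _ => ?_, fun K hK hKU k N => ?_⟩
  · rw [hR]
    exact ContDiffOn.sum fun k _ => contDiffOn_const.smul (has k l)
  · have hKΩ : K ⊆ coneOver U := fun ξ hξ => by
      obtain ⟨W, -, rfl⟩ := hU
      have h1 : ‖ξ‖ = 1 := by simpa using (hKU hξ).2
      exact (mem_coneOver_of_norm_eq_one h1).2 (hKU hξ)
    choose C hC using fun j => exists_norm_iteratedFDeriv_wave_smul_le hΩ hh hK hKΩ k (hpc j)
    -- The exponent pays for `l ^ k` from the derivatives, for the weight `l ^ N`, and for one more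
    -- power to reach the limit zero.
    choose D hD using fun j => hG j (k + N + 1)
    have hbound : ∀ l : ℝ, 1 ≤ l → ∀ ξ ∈ K,
        l ^ N * ‖iteratedFDeriv ℝ k
          (homExt fun ξ' => phase M ξ' l * ∑ k ∈ s, (p k ξ' : ℂ) * G k l) ξ‖ ≤
          (∑ j ∈ s, |C j| * D j) * l⁻¹ := by
      intro l hl ξ hξ
      have hl0 : 0 < l := by linarith
      have hcd : ∀ j, ContDiffAt ℝ k (a j l) ξ := fun j =>
        ((has j l).contDiffAt (hΩ.mem_nhds (hKΩ hξ))).of_le (by exact_mod_cast le_top)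
      rw [hR]
      have h1 := norm_iteratedFDeriv_sum_le (k := k) (w := ξ) s (f := fun j => G j l • a j l)
        fun j _ => (hcd j).const_smul (G j l)
      have h2 : ∀ j ∈ s, l ^ N * ‖iteratedFDeriv ℝ k (G j l • a j l) ξ‖ ≤
          |C j| * D j * l⁻¹ := by
        intro j _
        rw [iteratedFDeriv_const_smul_apply (hcd j), norm_smul]
        have h3 := (hC j l hl ξ hξ).trans
          (mul_le_mul_of_nonneg_right (le_abs_self (C j)) (pow_nonneg hl0.le k))
        have h4 := hD j l hl
        calc l ^ N * (‖G j l‖ * ‖iteratedFDeriv ℝ k (a j l) ξ‖)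
            ≤ l ^ N * (‖G j l‖ * (|C j| * l ^ k)) := by gcongr
          _ = |C j| * (‖G j l‖ * l ^ (k + N + 1)) * l⁻¹ := by
            field_simp
            ring
          _ ≤ |C j| * D j * l⁻¹ := by gcongr
      calc _ ≤ l ^ N * ∑ j ∈ s, ‖iteratedFDeriv ℝ k (G j l • a j l) ξ‖ := by gcongr
        _ = ∑ j ∈ s, l ^ N * ‖iteratedFDeriv ℝ k (G j l • a j l) ξ‖ := Finset.mul_sum _ _ _
        _ ≤ ∑ j ∈ s, |C j| * D j * l⁻¹ := Finset.sum_le_sum h2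
        _ = _ := (Finset.sum_mul _ _ _).symm
    rw [Metric.tendstoUniformlyOn_iff]
    intro ε hε
    have hlim : Tendsto (fun l : ℝ => (∑ j ∈ s, |C j| * D j) * l⁻¹) atTop (𝓝 0) := by
      simpa using tendsto_inv_atTop_zero.const_mul (∑ j ∈ s, |C j| * D j)
    filter_upwards [hlim.eventually (gt_mem_nhds hε), eventually_ge_atTop 1] with l h1 h2 ξ hξ
    rw [dist_zero_left, Real.norm_of_nonneg (by positivity)]
    exact (hbound l h2 ξ hξ).trans_lt h1

lemma isLittleO_of_bound {R : ℝ → ℂ} (hR : ∀ m : ℕ, ∃ D : ℝ, ∀ l : ℝ, 1 ≤ l → ‖R l‖ * l ^ m ≤ D)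
    (N : ℕ) : R =o[atTop] fun l : ℝ => (1 / l) ^ N := by
  obtain ⟨D, hD⟩ := hR (N + 1)
  rw [Asymptotics.isLittleO_iff]
  intro ε hε
  filter_upwards [eventually_ge_atTop 1, eventually_ge_atTop (D / ε)] with l h1 h2
  have hl0 : 0 < l := by linarith
  have h3 := hD l h1
  rw [div_le_iff₀ hε] at h2
  rw [Real.norm_of_nonneg (by positivity), div_pow, one_pow, mul_one_div, le_div_iff₀ (by positivity)]
  refine le_of_mul_le_mul_right ?_ hl0
  calc ‖R l‖ * l ^ N * l = ‖R l‖ * l ^ (N + 1) := by ring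
    _ ≤ ε * l := by linarith

end PolyIntegrable

/-! ### The main term and the conclusion -/

namespace PolyIntegrable

open Polynomial in
/-- The polynomial part of the oscillating integral over a cap with section volumes `P`. -/
noncomputable def mainPart (N : ℕ) (P : ℝ[X]) : ℂ[X] :=
  ∑ k ∈ Finset.range (N + 1),
    C ((P.derivative.coeff k : ℂ) * (k.factorial * Complex.I ^ (k + 2))) * X ^ k

lemma coeff_mainPart (N : ℕ) (P : Polynomial ℝ) (i : ℕ) :
    (mainPart N P).coeff i = if i < N + 1 then
      (P.derivative.coeff i : ℂ) * (i.factorial * Complex.I ^ (i + 2)) else 0 := by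
  simp only [mainPart, Polynomial.finsetSum_coeff, Polynomial.coeff_C_mul_X_pow]
  simp

lemma natDegree_mainPart_le (N : ℕ) (P : Polynomial ℝ) : (mainPart N P).natDegree ≤ N := by
  refine Polynomial.natDegree_le_iff_coeff_eq_zero.2 fun i hi => ?_
  rw [coeff_mainPart, if_neg (by omega)]

/-- The factor `i l` times the boundary term `k!(i/l)^(k+1)` of a moment is `k! i^(k+2) l^(-k)`. -/
lemma sum_moment_eq (N : ℕ) (P : Polynomial ℝ) (ρ : ℝ → ℝ) (c : ℝ) {l : ℝ} (hl : l ≠ 0) :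
    ∑ k ∈ Finset.range (N + 1), (P.derivative.coeff k : ℂ) *
      (Complex.I * l * ∫ t in (0 : ℝ)..c, amplitude (fun t => t ^ k * ρ t) l t) =
    (mainPart N P).eval (1 / (l : ℂ)) + ∑ k ∈ Finset.range (N + 1), (P.derivative.coeff k : ℂ) *
      (Complex.I * l * momentError ρ c k l) := by
  have hl' : (l : ℂ) ≠ 0 := by exact_mod_cast hl
  simp only [mainPart, Polynomial.eval_finsetSum, Polynomial.eval_mul, Polynomial.eval_C,
    Polynomial.eval_pow, Polynomial.eval_X]
  rw [← Finset.sum_add_distrib]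
  refine Finset.sum_congr rfl fun k _ => ?_
  have h1 : (∫ t in (0 : ℝ)..c, amplitude (fun t => t ^ k * ρ t) l t) =
      k.factorial * (Complex.I / l) ^ (k + 1) + momentError ρ c k l := by
    rw [momentError]
    ring
  have h2 : Complex.I * l * (k.factorial * (Complex.I / l) ^ (k + 1)) =
      k.factorial * Complex.I ^ (k + 2) * (1 / (l : ℂ)) ^ k := by
    rw [div_pow, div_pow, one_pow]
    field_simp
    ring
  rw [h1, mul_add, h2]
  ring

end PolyIntegrable

theorem lemma1 {n : ℕ} (hn : 3 ≤ n) (hodd : Odd n)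
    (M : Set (PolyIntegrable.Space n))
    (hM : PolyIntegrable.IsAnalyticHypersurface M) (hconn : IsConnected M)
    (hconv : PolyIntegrable.IsStrictlyConvex M)
    (hγ : PolyIntegrable.IsGaussDiffeo M)
    (hpoly : PolyIntegrable.IsPolynomiallyIntegrable M)
    (c : ℝ) (hc : 0 < c) (ρ : ℝ → ℝ) (hρ : PolyIntegrable.IsCutoff ρ c)
    (U : Set (PolyIntegrable.Space n))
    (hUopen : PolyIntegrable.IsOpenInSphere U) (hU : U ⊆ PolyIntegrable.normals M)
    (hcap : ∀ ξ ∈ U, IsCompact (PolyIntegrable.cap M ξ c) ∧ PolyIntegrable.cap M ξ c ≠ M) :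
    ∃ (Nbar : ℕ) (b : PolyIntegrable.Space n → ℕ → ℂ),
      (∀ ξ ∈ U, ∀ β : ℕ → ℂ,
        PolyIntegrable.IsAsymptoticExpansion M ξ (PolyIntegrable.oscIntegral M ρ ξ)
          ((n - 3) / 2) β ↔ β = b ξ) ∧
      (∀ ξ ∈ U, ∀ j : ℕ, Nbar < j → b ξ j = 0) ∧
      ∃ (Q : PolyIntegrable.Space n → Polynomial ℂ) (R : PolyIntegrable.Space n → ℝ → ℂ),
        (∀ ξ ∈ U, (Q ξ).natDegree ≤ Nbar + (n - 3) / 2) ∧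
        (∀ ξ ∈ U, ∀ l : ℝ, 0 < l →
          PolyIntegrable.oscIntegral M ρ ξ l =
            PolyIntegrable.phase M ξ l * (Q ξ).eval (1 / (l : ℂ)) + R ξ l) ∧
        PolyIntegrable.IsRapidlyDecaying U R := by

  have hA : PolyIntegrable.IsAdmissible M := ⟨hn, hM, hconn, hconv, hγ⟩
  obtain ⟨N, P, hN, hPan, hP0, hPeval⟩ := hA.exists_section_polynomials hodd hpoly
  have hU1 : ∀ ξ ∈ U, ‖ξ‖ = 1 := fun ξ hξ => hA.norm_normal (hU hξ)
  have hcone : PolyIntegrable.coneOver U ⊆ PolyIntegrable.coneOver (PolyIntegrable.normals M) :=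
    fun w hw => ⟨hw.1, hU hw.2⟩
  have hgood : ∀ ξ ∈ U, PolyIntegrable.IsGoodCap M ξ c := fun ξ hξ =>
    ⟨hU hξ, hc, (hcap ξ hξ).1, (hcap ξ hξ).2⟩
  have heval : ∀ ξ ∈ U, ∀ t ∈ Ioo 0 c,
      PolyIntegrable.sectionVolume M (PolyIntegrable.gaussInv M ξ) t = (P ξ).eval t := by
    intro ξ hξ
    refine hPeval ξ c (hU1 ξ hξ) ?_
    filter_upwards [hUopen.isOpen_coneOver.mem_nhds
      ((PolyIntegrable.mem_coneOver_of_norm_eq_one (hU1 ξ hξ)).2 hξ)] with v hv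
    exact hgood _ hv.2
  have hm : (n - 1) / 2 = (n - 3) / 2 + 1 := by omega
  set G : ℕ → ℝ → ℂ := fun k l => Complex.I * l * PolyIntegrable.momentError ρ c k l with hGdef
  have hG : ∀ k m : ℕ, ∃ D : ℝ, ∀ l : ℝ, 1 ≤ l → ‖G k l‖ * l ^ m ≤ D := by
    intro k m
    obtain ⟨D, hD⟩ := hρ.exists_norm_momentError_le hc k (m + 1)
    refine ⟨D, fun l hl => le_of_eq_of_le ?_ (hD l hl)⟩
    rw [hGdef, norm_mul, norm_mul, Complex.norm_I, Complex.norm_real,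
      Real.norm_of_nonneg (by linarith)]
    ring
  set R : PolyIntegrable.Space n → ℝ → ℂ := fun ξ l => PolyIntegrable.phase M ξ l *
    ∑ k ∈ Finset.range (N + 1), ((P ξ).derivative.coeff k : ℂ) * G k l with hRdef
  have hRbound : ∀ ξ, ∀ m : ℕ, ∃ D : ℝ, ∀ l : ℝ, 1 ≤ l → ‖R ξ l‖ * l ^ m ≤ D := by
    intro ξ m
    choose D hD using fun k => hG k m
    refine ⟨∑ k ∈ Finset.range (N + 1), ‖((P ξ).derivative.coeff k : ℂ)‖ * D k, fun l hl => ?_⟩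
    rw [hRdef, norm_mul, PolyIntegrable.norm_phase, one_mul]
    have hl0 : 0 < l := by linarith
    calc _ ≤ (∑ k ∈ Finset.range (N + 1), ‖((P ξ).derivative.coeff k : ℂ)‖ * ‖G k l‖) * l ^ m := by
          gcongr
          exact (norm_sum_le _ _).trans_eq (Finset.sum_congr rfl fun k _ => norm_mul _ _)
      _ = ∑ k ∈ Finset.range (N + 1), ‖((P ξ).derivative.coeff k : ℂ)‖ * (‖G k l‖ * l ^ m) := by
          rw [Finset.sum_mul]
          exact Finset.sum_congr rfl fun k _ => mul_assoc _ _ _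
      _ ≤ _ := Finset.sum_le_sum fun k _ =>
          mul_le_mul_of_nonneg_left (hD k l hl) (norm_nonneg _)
  have hdecomp : ∀ ξ ∈ U, ∀ l : ℝ, 0 < l → PolyIntegrable.oscIntegral M ρ ξ l =
      PolyIntegrable.phase M ξ l * (PolyIntegrable.mainPart N (P ξ)).eval (1 / (l : ℂ)) +
        R ξ l := by
    intro ξ hξ l hl
    rw [hA.oscIntegral_eq_sum (hgood ξ hξ) hρ (hN ξ (hU hξ)) (hP0 ξ (hU hξ) 0 (by omega))
      (heval ξ hξ) l, PolyIntegrable.sum_moment_eq N (P ξ) ρ c hl.ne', mul_add]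
  refine ⟨N, fun ξ j => (PolyIntegrable.mainPart N (P ξ)).coeff (j + (n - 3) / 2),
    fun ξ hξ β => ?_, fun ξ _ j hj => ?_, fun ξ => PolyIntegrable.mainPart N (P ξ), R,
    fun ξ _ => ?_, hdecomp, ?_⟩
  · refine PolyIntegrable.isLittleO_expansion_iff (PolyIntegrable.norm_phase M ξ)
      (hdecomp ξ hξ) (PolyIntegrable.isLittleO_of_bound (hRbound ξ)) (fun i hi => ?_) β
    -- `P ξ` vanishes to order `(n - 1) / 2` at zero; one derivative lowers this to `(n - 3) / 2`,
    -- the leading exponent of the expansion.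
    rw [PolyIntegrable.coeff_mainPart, Polynomial.coeff_derivative,
      hP0 ξ (hU hξ) (i + 1) (by omega)]
    simp
  · exact Polynomial.coeff_eq_zero_of_natDegree_lt
      ((PolyIntegrable.natDegree_mainPart_le N (P ξ)).trans_lt (by omega))
  · exact (PolyIntegrable.natDegree_mainPart_le N (P ξ)).trans (Nat.le_add_right _ _)
  · refine PolyIntegrable.isRapidlyDecaying_sum hUopen ?_ (fun k => ?_) hG _
    · exact fun w hw =>
        (hA.analyticAt_supp_normalize (hcone hw)).contDiffAt.contDiffWithinAt
    · intro w hw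
      simp only [Polynomial.coeff_derivative]
      exact ((hPan w (hcone hw) (k + 1)).contDiffAt.mul contDiffAt_const).contDiffWithinAt
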